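/- Let $\mathcal S$ be a small category and let $R$ be a flat presheaf of commutative rings on $\mathcal S$, i.e. a functor $R:\mathcal S^{op}\to \mathrm{CommRing}$ such that for every morphism $a:v\to w$ of $\mathcal S$ the ring homomorphism $R(w)\to R(v)$ is flat. A (presheaf of) $R$-module(s) $M$ is called cartesian if for every $a:v\to w$ the $R(v)$-linear map $R(v)\otimes_{R(w)}M(w)\to M(v)$, $r\otimes m\mapsto r\,M(a)(m)$, is an isomorphism; $\mathcal A=\mathrm{Mod}_{\mathrm{cart}}(R)$ denotes the abelian category of cartesian $R$-modules and $\mathrm{Ch}(\mathcal A)$ the category of unbounded complexes in $\mathcal A$. A cotorsion pair in an abelian category is a pair $(\mathcal F,\mathcal C)$ of classes of objects with $\mathcal F={}^\perp\mathcal C$ and $\mathcal C=\mathcal F^\perp$, where ${}^\perp\mathcal C=\{X:\mathrm{Ext}^1(X,Y)=0\ \forall Y\in\mathcal C\}$ and $\mathcal F^\perp=\{Y:\mathrm{Ext}^1(X,Y)=0\ \forall X\in\mathcal F\}$. It is cogenerated by a set if $\mathcal C=\mathcal T^\perp$ for some set $\mathcal T$ of objects. It is complete if for every object $M$ there are short exact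 sequences $0\to C\to F\to M\to 0$ and $0\to M\to C'\to F'\to 0$ with $F,F'\in\mathcal F$ and $C,C'\in\mathcal C$. For a cotorsion pair $(\mathcal F,\mathcal C)$ in $\mathcal A$ let $\widetilde{\mathcal F}$ (resp. $\widetilde{\mathcal C}$) be the class of acyclic complexes $X$ all of whose cycle objects $Z_nX$ belong to $\mathcal F$ (resp. $\mathcal C$). Let $dg\,\widetilde{\mathcal F}$ be the class of complexes $X$ with $X_n\in\mathcal F$ for all $n$ such that the total Hom complex $\mathrm{Hom}(X,Y)$ is exact for every $Y\in\widetilde{\mathcal C}$, and let $dg\,\widetilde{\mathcal C}$ be the class of complexes $Y$ with $Y_n\in\mathcal C$ for all $n$ such that $\mathrm{Hom}(X,Y)$ is exact for every $X\in\widetilde{\mathcal F}$. **Theorem.** Let $(\mathcal F,\mathcal C)$ be a cotorsion pair in $\mathrm{Mod}_{\mathrm{cart}}(R)$ which is cogenerated by a set and such that $\mathcal F$ contains a generator of $\mathrm{Mod}_{\mathrm{cart}}(R)$. Then the induced pairs $(\widetilde{\mathcal F},dg\,\widetilde{\mathcal C})$ and $(dg\,\widetilde{\mathcal F},\widetilde{\mathcal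 C})$ are complete cotorsion pairs in $\mathrm{Ch}(\mathrm{Mod}_{\mathrm{cart}}(R))$. Moreover, there are arbitrarily large regular cardinals $\kappa$ such that every complex $X\in\widetilde{\mathcal F}$ is $\widetilde{\mathcal F}^{\kappa}$-filtered, where $\widetilde{\mathcal F}^{\kappa}$ is the class of $\kappa$-presentable objects of $\mathrm{Ch}(\mathrm{Mod}_{\mathrm{cart}}(R))$ lying in $\widetilde{\mathcal F}$; that is, $X$ is the colimit of a continuous well-ordered direct system of monomorphisms of complexes $(X_\alpha)$ with $X_0=0$ such that the cokernel of every $X_\alpha\to X_{\alpha+1}$ is isomorphic to an object of $\widetilde{\mathcal F}^{\kappa}$. -/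

import Mathlib

open CategoryTheory CategoryTheory.Limits ZeroObject

universe w v u

/-! ## Cartesian modules over a flat presheaf of commutative rings -/

namespace CartMod

variable {C : Type u} [SmallCategory C]

/-- A presheaf of commutative rings is flat if all its restriction maps are flat. -/
class IsFlatPresheaf (R : Cᵒᵖ ⥤ CommRingCat.{u}) : Prop where
  flat {X Y : Cᵒᵖ} (f : X ⟶ Y) : (R.map f).hom.Flat

/-- Presheaves of modules over the presheaf of commutative rings `R`. -/
abbrev Mod (R : Cᵒᵖ ⥤ CommRingCat.{u}) : Type (u + 1) :=
  PresheafOfModules.{u} (R ⋙ forget₂ CommRingCat RingCat)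

variable {R : Cᵒᵖ ⥤ CommRingCat.{u}}

/-- For `f : X ⟶ Y` in `Cᵒᵖ`, the `R Y`-linear map `R Y ⊗_{R X} M X ⟶ M Y`,
`r ⊗ m ↦ r • M.map f m` (see `comparison_tmul`). -/
noncomputable def comparison (M : Mod R) {X Y : Cᵒᵖ} (f : X ⟶ Y) :
    (ModuleCat.extendScalars (R.map f).hom).obj (M.obj X) ⟶ M.obj Y :=
  ((ModuleCat.extendRestrictScalarsAdj (R.map f).hom).homEquiv _ _).symm (M.map f)

open ChangeOfRings in
lemma comparison_tmul (M : Mod R) {X Y : Cᵒᵖ} (f : X ⟶ Y) (r : R.obj Y) (m : M.obj X) :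
    (comparison M f).hom (r ⊗ₜ[R.obj X, (R.map f).hom] m) =
      r • (show M.obj Y from M.map f m) :=
  rfl

variable (R) in
/-- Evaluation at `X`, as a functor to modules over the commutative ring `R X`. -/
noncomputable def ev (X : Cᵒᵖ) : Mod R ⥤ ModuleCat.{u} (R.obj X) :=
  PresheafOfModules.evaluation (R ⋙ forget₂ CommRingCat RingCat) X

instance (X : Cᵒᵖ) : PreservesFiniteLimits (ev R X) :=
  PresheafOfModules.evaluation_preservesFiniteLimits (R ⋙ forget₂ CommRingCat RingCat) X

instance (X : Cᵒᵖ) : PreservesFiniteColimits (ev R X) :=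
  inferInstanceAs (PreservesFiniteColimits
    (PresheafOfModules.evaluation (R ⋙ forget₂ CommRingCat RingCat) X))

variable (R) in
/-- The comparison maps, as a natural transformation between functors in `M`. -/
noncomputable def comparisonNat {X Y : Cᵒᵖ} (f : X ⟶ Y) :
    ev R X ⋙ ModuleCat.extendScalars (R.map f).hom ⟶ ev R Y where
  app M := comparison M f
  naturality M N g := by
    dsimp [comparison, ev]
    erw [← Adjunction.homEquiv_naturality_left_symm, ← Adjunction.homEquiv_naturality_right_symm]
    congr 1
    exact (g.naturality f).symm

variable (R) in
/-- A module `M` over `R` is cartesian if all the maps `R Y ⊗_{R X} M X ⟶ M Y` are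
isomorphisms. -/
def isCartesian : ObjectProperty (Mod R) :=
  fun M => ∀ ⦃X Y : Cᵒᵖ⦄ (f : X ⟶ Y), IsIso (comparison M f)

lemma isIso_app_of_isLimit {A : Type*} [Category* A] {B : Type*} [Category* B]
    {J : Type*} [Category* J] {G H : A ⥤ B} (τ : G ⟶ H) {K : J ⥤ A}
    [PreservesLimit K G] [PreservesLimit K H] {c : Cone K} (hc : IsLimit c)
    (hK : ∀ j, IsIso (τ.app (K.obj j))) : IsIso (τ.app c.pt) := by
  let e : K ⋙ G ≅ K ⋙ H := NatIso.ofComponents (fun j => asIso (τ.app (K.obj j)))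
  have h : τ.app c.pt = (IsLimit.conePointsIsoOfNatIso (isLimitOfPreserves G hc)
      (isLimitOfPreserves H hc) e).hom := by
    refine (isLimitOfPreserves H hc).hom_ext fun j => ?_
    rw [IsLimit.conePointsIsoOfNatIso_hom_comp]
    exact (τ.naturality (c.π.app j)).symm
  rw [h]
  infer_instance

lemma isIso_app_of_isColimit {A : Type*} [Category* A] {B : Type*} [Category* B]
    {J : Type*} [Category* J] {G H : A ⥤ B} (τ : G ⟶ H) {K : J ⥤ A}
    [PreservesColimit K G] [PreservesColimit K H] {c : Cocone K} (hc : IsColimit c)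
    (hK : ∀ j, IsIso (τ.app (K.obj j))) : IsIso (τ.app c.pt) := by
  let e : K ⋙ G ≅ K ⋙ H := NatIso.ofComponents (fun j => asIso (τ.app (K.obj j)))
  have h : τ.app c.pt = (IsColimit.coconePointsIsoOfNatIso (isColimitOfPreserves G hc)
      (isColimitOfPreserves H hc) e).hom := by
    refine (isColimitOfPreserves G hc).hom_ext fun j => ?_
    rw [IsColimit.comp_coconePointsIsoOfNatIso_hom]
    exact τ.naturality (c.ι.app j)
  rw [h]
  infer_instance

lemma isCartesian_of_isColimit {J : Type} [SmallCategory J] [FinCategory J] {K : J ⥤ Mod R}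
    {c : Cocone K} (hc : IsColimit c) (hK : ∀ j, isCartesian R (K.obj j)) :
    isCartesian R c.pt := fun _ _ f =>
  isIso_app_of_isColimit (comparisonNat R f) hc (fun j => hK j f)

lemma isCartesian_of_isLimit [IsFlatPresheaf R] {J : Type} [SmallCategory J] [FinCategory J]
    {K : J ⥤ Mod R} {c : Cone K} (hc : IsLimit c) (hK : ∀ j, isCartesian R (K.obj j)) :
    isCartesian R c.pt := fun _ _ f => by
  have := ModuleCat.preservesFiniteLimits_extendScalars_of_flat (IsFlatPresheaf.flat (R := R) f)
  exact isIso_app_of_isLimit (comparisonNat R f) hc (fun j => hK j f)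

instance [IsFlatPresheaf R] : (isCartesian R).IsClosedUnderKernels where
  kernels_le := by
    rintro _ ⟨f, k, hk, h⟩
    exact isCartesian_of_isLimit hk (by rintro (_ | _); exacts [h.1, h.2])

instance : (isCartesian R).IsClosedUnderCokernels where
  cokernels_le := by
    rintro _ ⟨f, k, hk, h⟩
    exact isCartesian_of_isColimit hk (by rintro (_ | _); exacts [h.1, h.2])

instance [IsFlatPresheaf R] : (isCartesian R).IsClosedUnderFiniteProducts where
  isClosedUnderLimitsOfShape J _ := ⟨by
    rintro M ⟨h⟩
    have := Fintype.ofFinite J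
    classical
    exact isCartesian_of_isLimit (K := h.diag) (c := h.cone) h.isLimit h.prop_diag_obj⟩

instance [IsFlatPresheaf R] : (isCartesian R).ContainsZero where
  exists_zero := ⟨⊤_ (Mod R), (isZero_zero _).of_iso (HasZeroObject.zeroIsoTerminal.symm),
    (isCartesian R).prop_of_isTerminal _ terminalIsTerminal⟩

variable (R) in
/-- The category of cartesian `R`-modules: the full subcategory of the category of
presheaves of `R`-modules on the cartesian ones. -/
abbrev ModCart : Type (u + 1) := (isCartesian R).FullSubcategory

noncomputable instance [IsFlatPresheaf R] : Abelian (ModCart R) := inferInstance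

end CartMod

/-! ## Cotorsion pairs and filtrations -/

namespace CotorsionPair

section

variable {A : Type u} [Category.{v} A] [Abelian A]

/-- `Ext¹(X, Y) = 0`. -/
def ExtOneVanishes (X Y : A) : Prop :=
  letI := HasExt.standard A
  Subsingleton (Abelian.Ext X Y 1)

/-- The class `P^⊥` of all `Y` with `Ext¹(X, Y) = 0` for all `X` in `P`. -/
def rightPerp (P : ObjectProperty A) : ObjectProperty A :=
  fun Y => ∀ X, P X → ExtOneVanishes X Y

/-- The class `^⊥P` of all `X` with `Ext¹(X, Y) = 0` for all `Y` in `P`. -/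
def leftPerp (P : ObjectProperty A) : ObjectProperty A :=
  fun X => ∀ Y, P Y → ExtOneVanishes X Y

/-- `(F, C)` is a cotorsion pair: `F = ^⊥C` and `C = F^⊥`. -/
structure IsCotorsionPair (F C : ObjectProperty A) : Prop where
  left_eq : F = leftPerp C
  right_eq : C = rightPerp F

/-- `T` cogenerates the cotorsion pair with right-hand class `C` if `T^⊥ = C`; here `T` ranges
over the `w`-small classes, i.e. the sets of objects. -/
def IsCogeneratedBySet (C : ObjectProperty A) : Prop :=
  ∃ T : ObjectProperty A, ObjectProperty.Small.{w} T ∧ rightPerp T = C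

/-- Every `M` has a short exact sequence `0 ⟶ K ⟶ P ⟶ M ⟶ 0` with `K` in `C`, `P` in `F`. -/
def EnoughProjectives (F C : ObjectProperty A) : Prop :=
  ∀ M : A, ∃ (K P : A) (i : K ⟶ P) (p : P ⟶ M) (zero : i ≫ p = 0),
    (ShortComplex.mk i p zero).ShortExact ∧ C K ∧ F P

/-- Every `M` has a short exact sequence `0 ⟶ M ⟶ E ⟶ Q ⟶ 0` with `E` in `C`, `Q` in `F`. -/
def EnoughInjectives (F C : ObjectProperty A) : Prop :=
  ∀ M : A, ∃ (E Q : A) (i : M ⟶ E) (p : E ⟶ Q) (zero : i ≫ p = 0),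
    (ShortComplex.mk i p zero).ShortExact ∧ C E ∧ F Q

/-- `(F, C)` is a complete cotorsion pair. -/
structure IsCompleteCotorsionPair (F C : ObjectProperty A) : Prop extends
    IsCotorsionPair F C where
  enoughProjectives : EnoughProjectives F C
  enoughInjectives : EnoughInjectives F C

/-- The monomorphisms whose cokernel belongs to `L` up to isomorphism. -/
def monoWithCokernelIn (L : ObjectProperty A) : MorphismProperty A :=
  fun _ _ f => Mono f ∧ L.isoClosure (cokernel f)

/-- `X` is `L`-filtered: `X` is the colimit of a continuous well-ordered system of monomorphisms
starting at `0`, all of whose successive steps have a cokernel isomorphic to an object of `L`. -/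
def IsFilteredBy (L : ObjectProperty A) (X : A) : Prop :=
  ∃ (J : Type w) (_ : LinearOrder J) (_ : OrderBot J) (_ : SuccOrder J) (_ : WellFoundedLT J)
    (s : (monoWithCokernelIn L).TransfiniteCompositionOfShape J (0 : (0 : A) ⟶ X)),
    ∀ ⦃i j : J⦄ (h : i ⟶ j), Mono (s.F.map h)

/-- The class of the `κ`-presentable objects of `L`. -/
def presentableIn (L : ObjectProperty A) (κ : Cardinal.{w}) [Fact κ.IsRegular] :
    ObjectProperty A :=
  fun X => L X ∧ IsCardinalPresentable X κ

/-! ### The induced classes of unbounded complexes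

Unbounded complexes are indexed cohomologically (`X^n = X_{-n}`). -/

/-- Unbounded complexes. -/
abbrev Ch (A : Type u) [Category.{v} A] [Abelian A] := CochainComplex A ℤ

/-- The class `L̃` of acyclic complexes all of whose cycle objects belong to `L`. -/
def tilde (L : ObjectProperty A) : ObjectProperty (Ch A) :=
  fun X => X.Acyclic ∧ ∀ n : ℤ, L (X.cycles n)

/-- The class `dg F̃`: complexes `X` with terms in `F` such that the total Hom complex
`Hom(X, Y)` is exact for all `Y` in `C̃`. -/
def dgLeft (F C : ObjectProperty A) : ObjectProperty (Ch A) :=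
  fun X => (∀ n : ℤ, F (X.X n)) ∧
    ∀ Y : Ch A, tilde C Y → (CochainComplex.HomComplex X Y).Acyclic

/-- The class `dg C̃`: complexes `Y` with terms in `C` such that the total Hom complex
`Hom(X, Y)` is exact for all `X` in `F̃`. -/
def dgRight (F C : ObjectProperty A) : ObjectProperty (Ch A) :=
  fun Y => (∀ n : ℤ, C (Y.X n)) ∧
    ∀ X : Ch A, tilde F X → (CochainComplex.HomComplex X Y).Acyclic

end

end CotorsionPair

/-!
The category of cartesian modules over a flat presheaf of rings is closed under colimits and finite
limits in the category of presheaves of modules, so it is Grothendieck abelian as soon as it has a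
separator (`CartMod.isGrothendieckAbelian`). Everything else holds for a cotorsion pair `(F, C)`
in an arbitrary Grothendieck abelian category `A`, with `C = T^⊥` for a small class `T` and with a
separator `G` in `F`.

*Lifting properties.* Let `i` be a monomorphism with cokernel `X` and let `I` be an injective
object containing `Y`. Then `Ext¹(X, Y) = 0` if and only if `i` has the left lifting property with
respect to `I ⟶ I / Y` (`extOneVanishes_iff_hasLiftingProperty`). Hence `^⊥C` is closed under
filtrations and retracts. The small object argument, applied to `0 ⟶ G` and to the kernels of the
epimorphisms from coproducts of copies of `G` onto the objects of `T`, shows that `(F, C)` is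
complete (`IsCotorsionPair.isCompleteCotorsionPair`).

*The induced pairs.* Adjunctions between `A` and the category of complexes compute `Ext¹` of
complexes when one argument is a sphere (a complex concentrated in one degree) or a disk (a
contractible complex with two terms). They identify `tilde C` with `(spheres F)^⊥`, `tilde F` with
`^⊥(spheres C)`, and, as degreewise split extensions are classified by the total Hom complex,
`dgRight F C` with `(tilde F)^⊥` and `dgLeft F C` with `^⊥(tilde C)`. So both pairs are cotorsion
pairs, and `(dgLeft F C, tilde C)` is cogenerated by the small class of the spheres on `T` and `G`.
The coproduct of all disks on `G` is a separator for complexes which belongs to both left-hand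
classes.

*Size.* The size of `X` is the number of morphisms `G ⟶ X`. For suitable cardinals `θ` (`2 ^ ν` for
all large `ν`, see `exists_forall_isAdmissible`) the objects of size at most `θ` behave like sets of
cardinality at most `θ`, and they are `κ`-presentable for all regular `κ > θ`
(`IsBounded.isCardinalPresentable`).

*Hill families.* An object of `F` is a retract of a relative cell complex for the monomorphisms
above. The subobjects generated by closed sets of cells form a Hill family: a family closed under
suprema, whose successive quotients are in `F`, and which is cofinal among the subobjects of size at
most `θ` (`exists_isHillFamily`).

*Filtrations.* Let `X` be in `tilde F`, and choose Hill families of subobjects of all its cycle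
objects. The subcomplexes which are acyclic and whose cycles belong to these families are closed
under unions of chains. A back-and-forth argument of length `ω` enlarges each of them, unless it is
`X`, by a subcomplex of size at most `θ` to another one (`exists_goodSubcomplex`), and the quotient
is in `tilde F` by the lifting property of the Hill families. Hence `X` is filtered by the
complexes of size at most `θ` in `tilde F` (`isFilteredBy_tilde`). These form a small class up to
isomorphism, so `(tilde F, dgRight F C)` is cogenerated by a set too, and therefore complete.
-/

/-! ### Cartesian modules form a Grothendieck abelian category -/

namespace CartMod

variable {C : Type u} [SmallCategory C] {R : Cᵒᵖ ⥤ CommRingCat.{u}}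

instance (X : Cᵒᵖ) : PreservesColimitsOfSize.{u, u} (ev R X) :=
  inferInstanceAs (PreservesColimitsOfSize.{u, u}
    (PresheafOfModules.evaluation (R ⋙ forget₂ CommRingCat RingCat) X))

lemma isCartesian_of_isColimit_of_small {J : Type u} [SmallCategory J] {K : J ⥤ Mod R}
    {c : Cocone K} (hc : IsColimit c) (hK : ∀ j, isCartesian R (K.obj j)) :
    isCartesian R c.pt := fun _ _ f => by
  have : PreservesColimitsOfSize.{u, u} (ModuleCat.extendScalars.{u} (R.map f).hom) :=
    (ModuleCat.extendRestrictScalarsAdj.{u} (R.map f).hom).leftAdjoint_preservesColimits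
  exact isIso_app_of_isColimit (comparisonNat R f) hc (fun j => hK j f)

instance (J : Type u) [SmallCategory J] : (isCartesian R).IsClosedUnderColimitsOfShape J := ⟨by
  rintro M ⟨h⟩
  exact isCartesian_of_isColimit_of_small (K := h.diag) (c := h.cocone) h.isColimit
    h.prop_diag_obj⟩

instance [IsFlatPresheaf R] (J : Type) [SmallCategory J] [FinCategory J] :
    (isCartesian R).IsClosedUnderLimitsOfShape J := ⟨by
  rintro M ⟨h⟩
  exact isCartesian_of_isLimit (K := h.diag) (c := h.cone) h.isLimit h.prop_diag_obj⟩

instance [IsFlatPresheaf R] : PreservesFiniteLimits (isCartesian R).ι where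
  preservesFiniteLimits _ _ _ := inferInstance

instance [IsFlatPresheaf R] :
    PreservesFiniteLimits ((isCartesian R).ι ⋙ PresheafOfModules.toPresheaf _) :=
  comp_preservesFiniteLimits _ _

instance (J : Type u) [SmallCategory J] : PreservesColimitsOfShape J
    ((isCartesian R).ι ⋙ PresheafOfModules.toPresheaf (R ⋙ forget₂ CommRingCat RingCat)) :=
  inferInstance

/-- Filtered colimits of cartesian modules are computed in presheaves of abelian groups, where they
are exact. -/
lemma isGrothendieckAbelian [IsFlatPresheaf R] (h : HasSeparator (ModCart R)) :
    IsGrothendieckAbelian.{u} (ModCart R) where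
  hasFilteredColimitsOfSize := ⟨fun J _ _ => inferInstance⟩
  ab5OfSize :=
    have : HasFilteredColimitsOfSize.{u, u} (ModCart R) := ⟨fun J _ _ => inferInstance⟩
    ⟨fun J _ _ => by
      have : ReflectsFiniteLimits
          ((isCartesian R).ι ⋙ PresheafOfModules.toPresheaf (R ⋙ forget₂ CommRingCat RingCat)) :=
        ⟨fun J _ _ => reflectsLimitsOfShape_of_reflectsIsomorphisms⟩
      exact HasExactColimitsOfShape.domain_of_functor J
        ((isCartesian R).ι ⋙ PresheafOfModules.toPresheaf _)⟩

end CartMod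

/-! ### Vanishing of `Ext¹` as a lifting property -/

namespace CotorsionPair

variable {A : Type u} [Category.{v} A] [Abelian A]

lemma ExtOneVanishes.exists_lift {S : ShortComplex A} (hS : S.ShortExact) {X : A}
    (h : ExtOneVanishes X S.X₁) (g : X ⟶ S.X₃) : ∃ l : X ⟶ S.X₂, l ≫ S.g = g := by
  let := HasExt.standard A
  have : Subsingleton (Abelian.Ext X S.X₁ 1) := h
  obtain ⟨x, hx⟩ := Abelian.Ext.covariant_sequence_exact₃ X hS (Abelian.Ext.mk₀ g)
    (zero_add 1) (Subsingleton.elim _ _)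
  obtain ⟨l, rfl⟩ := (Abelian.Ext.mk₀_bijective X S.X₂).2 x
  refine ⟨l, (Abelian.Ext.mk₀_bijective X S.X₃).1 ?_⟩
  rw [← hx, Abelian.Ext.mk₀_comp_mk₀]

lemma ExtOneVanishes.exists_extension {S : ShortComplex A} (hS : S.ShortExact) {Y : A}
    (h : ExtOneVanishes S.X₃ Y) (f : S.X₁ ⟶ Y) : ∃ e : S.X₂ ⟶ Y, S.f ≫ e = f := by
  let := HasExt.standard A
  have : Subsingleton (Abelian.Ext S.X₃ Y 1) := h
  obtain ⟨x, hx⟩ := Abelian.Ext.contravariant_sequence_exact₁ hS Y (Abelian.Ext.mk₀ f)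
    (add_zero 1) (Subsingleton.elim _ _)
  obtain ⟨l, rfl⟩ := (Abelian.Ext.mk₀_bijective S.X₂ Y).2 x
  refine ⟨l, (Abelian.Ext.mk₀_bijective S.X₁ Y).1 ?_⟩
  rw [← hx, Abelian.Ext.mk₀_comp_mk₀]

lemma extOneVanishes_of_exists_lift {S : ShortComplex A} (hS : S.ShortExact) [Injective S.X₂]
    {X : A} (h : ∀ g : X ⟶ S.X₃, ∃ l : X ⟶ S.X₂, l ≫ S.g = g) : ExtOneVanishes X S.X₁ := by
  let := HasExt.standard A
  change Subsingleton (Abelian.Ext X S.X₁ 1)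
  refine ⟨fun x y => ?_⟩
  suffices ∀ x : Abelian.Ext X S.X₁ 1, x = 0 by rw [this x, this y]
  intro x
  obtain ⟨y, rfl⟩ := Abelian.Ext.covariant_sequence_exact₁ X hS x
    (Abelian.Ext.eq_zero_of_injective _) (zero_add 1)
  obtain ⟨g, rfl⟩ := (Abelian.Ext.mk₀_bijective X S.X₃).2 y
  obtain ⟨l, rfl⟩ := h g
  rw [← Abelian.Ext.mk₀_comp_mk₀, Abelian.Ext.comp_assoc_of_second_deg_zero, hS.comp_extClass,
    Abelian.Ext.comp_zero]

/-- For a monomorphism `i` with cokernel `X` and a short exact sequence `0 ⟶ Y ⟶ I ⟶ Q ⟶ 0` with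
`I` injective, `Ext¹(X, Y)` vanishes if and only if `i` lifts against `I ⟶ Q`. -/
lemma extOneVanishes_iff_hasLiftingProperty {S T : ShortComplex A} (hS : S.ShortExact)
    (hT : T.ShortExact) [Injective T.X₂] :
    ExtOneVanishes S.X₃ T.X₁ ↔ HasLiftingProperty S.f T.g := by
  have := hS.mono_f
  have := hS.epi_g
  refine ⟨fun h => ⟨fun {a b} sq => ?_⟩, fun h => extOneVanishes_of_exists_lift hT fun g => ?_⟩
  -- an extension of `a` to `S.X₂` is corrected by a lift of its defect, which factors through
  -- `S.X₃`
  · let l := hS.exact.desc (Injective.factorThru a S.f ≫ T.g - b) (by simp [sq.w])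
    obtain ⟨m, hm⟩ := h.exists_lift hT l
    exact ⟨⟨{ l := Injective.factorThru a S.f - S.g ≫ m
              fac_left := by simp
              fac_right := by simp [hm, l] }⟩⟩
  · have sq : CommSq (0 : S.X₁ ⟶ T.X₂) S.f T.g (S.g ≫ g) := ⟨by simp⟩
    refine ⟨hS.exact.desc sq.lift sq.fac_left, ?_⟩
    rw [← cancel_epi S.g]
    simp

lemma ExtOneVanishes.of_iso_right {X Y Y' : A} (h : ExtOneVanishes X Y) (e : Y ≅ Y') :
    ExtOneVanishes X Y' := by
  let := HasExt.standard A
  have : Subsingleton (Abelian.Ext X Y 1) := h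
  refine ⟨fun x y => ?_⟩
  have (z : Abelian.Ext X Y' 1) :
      z = (z.comp (Abelian.Ext.mk₀ e.inv) (add_zero 1)).comp (Abelian.Ext.mk₀ e.hom)
        (add_zero 1) := by
    rw [Abelian.Ext.comp_assoc_of_third_deg_zero, Abelian.Ext.mk₀_comp_mk₀, e.inv_hom_id,
      Abelian.Ext.comp_mk₀_id]
  rw [this x, this y, Subsingleton.elim (x.comp _ _) (y.comp _ _)]

lemma ExtOneVanishes.of_iso_left {X X' Y : A} (h : ExtOneVanishes X Y) (e : X ≅ X') :
    ExtOneVanishes X' Y := by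
  let := HasExt.standard A
  have : Subsingleton (Abelian.Ext X Y 1) := h
  refine ⟨fun x y => ?_⟩
  have (z : Abelian.Ext X' Y 1) :
      z = (Abelian.Ext.mk₀ e.inv).comp ((Abelian.Ext.mk₀ e.hom).comp z (zero_add 1))
        (zero_add 1) := by
    rw [← Abelian.Ext.comp_assoc_of_second_deg_zero, Abelian.Ext.mk₀_comp_mk₀, e.inv_hom_id,
      Abelian.Ext.mk₀_id_comp]
  rw [this x, this y, Subsingleton.elim (Abelian.Ext.comp _ x _) (Abelian.Ext.comp _ y _)]

lemma leftPerp.of_iso {C : ObjectProperty A} {X Y : A} (h : leftPerp C X) (e : X ≅ Y) :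
    leftPerp C Y :=
  fun Z hZ => (h Z hZ).of_iso_left e

lemma rightPerp.of_iso {C : ObjectProperty A} {X Y : A} (h : rightPerp C X) (e : X ≅ Y) :
    rightPerp C Y :=
  fun Z hZ => (h Z hZ).of_iso_right e

lemma shortExact_cokernel {X Y : A} (i : X ⟶ Y) [Mono i] :
    (ShortComplex.mk i (cokernel.π i) (cokernel.condition i)).ShortExact where
  exact := ShortComplex.exact_cokernel i

lemma shortExact_kernel {X Y : A} (p : X ⟶ Y) [Epi p] :
    (ShortComplex.mk (kernel.ι p) p (kernel.condition p)).ShortExact where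
  exact := ShortComplex.exact_kernel p

variable [CategoryTheory.EnoughInjectives A]

/-- The projection `I ⟶ I / Y` for a chosen embedding of `Y` into an injective object `I`. -/
noncomputable abbrev injQuot (Y : A) : Injective.under Y ⟶ cokernel (Injective.ι Y) :=
  cokernel.π (Injective.ι Y)

/-- The projections `I ⟶ I / Y` for `Y` in `C`. A monomorphism lifts against all of them if and
only if its cokernel belongs to `^⊥C`. -/
def injQuots (C : ObjectProperty A) : MorphismProperty A :=
  MorphismProperty.ofHoms (fun Y : Subtype C => injQuot Y.1)

lemma injQuots_llp_iff {C : ObjectProperty A} {X Y : A} (i : X ⟶ Y) :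
    (injQuots C).llp i ↔ ∀ Z, C Z → HasLiftingProperty i (injQuot Z) := by
  refine ⟨fun h Z hZ => h _ (MorphismProperty.ofHoms.mk (⟨Z, hZ⟩ : Subtype C)), fun h => ?_⟩
  rintro _ _ _ ⟨Z⟩
  exact h Z.1 Z.2

/-- Objects of `^⊥C` are detected by a lifting property of any monomorphism of which they are the
cokernel. -/
lemma leftPerp_iff_llp {C : ObjectProperty A} {S : ShortComplex A} (hS : S.ShortExact) :
    leftPerp C S.X₃ ↔ (injQuots C).llp S.f := by
  rw [injQuots_llp_iff]
  exact forall₂_congr fun Y _ =>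
    extOneVanishes_iff_hasLiftingProperty hS (shortExact_cokernel (Injective.ι Y))

lemma leftPerp_cokernel_iff {C : ObjectProperty A} {X Y : A} (i : X ⟶ Y) [Mono i] :
    leftPerp C (cokernel i) ↔ (injQuots C).llp i :=
  leftPerp_iff_llp (shortExact_cokernel i)

lemma leftPerp_iff_llp_zero {C : ObjectProperty A} {X : A} :
    leftPerp C X ↔ (injQuots C).llp (0 : 0 ⟶ X) :=
  leftPerp_iff_llp (S := ShortComplex.mk (0 : 0 ⟶ X) (𝟙 X) (by simp))
    { exact := (ShortComplex.exact_iff_mono _ rfl).2 inferInstance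
      mono_f := by dsimp; infer_instance
      epi_g := by dsimp; infer_instance }

end CotorsionPair

/-! ### Subobjects in Grothendieck abelian categories -/

namespace CategoryTheory.Subobject

section

variable {A : Type u} [Category.{v} A] [Abelian A]

lemma factors_iff_comp_cokernel {X Z : A} (s : Subobject X) (f : Z ⟶ X) :
    s.Factors f ↔ f ≫ cokernel.π s.arrow = 0 := by
  refine ⟨fun h => ?_, fun h => ?_⟩
  · rw [← s.factorThru_arrow f h, Category.assoc, cokernel.condition, comp_zero]
  · have := Abelian.monoLift_comp s.arrow f h
    rw [← this]
    exact factors_comp_arrow _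

lemma factors_of_epi {X Y Z : A} {s : Subobject X} (e : Z ⟶ Y) [Epi e] {f : Y ⟶ X}
    (h : s.Factors (e ≫ f)) : s.Factors f := by
  rw [factors_iff_comp_cokernel] at h ⊢
  rw [← cancel_epi e, ← Category.assoc, h, comp_zero]

lemma exists_le_iff {X Y : A} (p : X ⟶ Y) (s : Subobject X) (t : Subobject Y) :
    (Subobject.exists p).obj s ≤ t ↔ s ≤ (pullback p).obj t :=
  (existsPullbackAdj p).gc s t

lemma Factors.exists_comp {X Y Z : A} {s : Subobject X} {f : Z ⟶ X} (h : s.Factors f)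
    (p : X ⟶ Y) : ((Subobject.exists p).obj s).Factors (f ≫ p) := by
  rw [← pullback_factors_iff]
  exact factors_of_le f ((exists_le_iff p s _).1 le_rfl) h

lemma le_of_forall_factors {G : A} (hG : IsSeparator G) {X : A} {s t : Subobject X}
    (h : ∀ f : G ⟶ X, s.Factors f → t.Factors f) : s ≤ t := by
  refine le_of_factors ((factors_iff_comp_cokernel _ _).2 (hG.def _ _ fun f => ?_))
  rw [comp_zero, ← Category.assoc, ← factors_iff_comp_cokernel]
  exact h _ (factors_comp_arrow f)

section

variable {X : A} {J : Type w} [PartialOrder J] (s : J →o Subobject X)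

/-- The quotients of an object by a monotone family of subobjects. -/
noncomputable def quotFunctor : J ⥤ A where
  obj j := cokernel (s j).arrow
  map {i j} f := cokernel.desc _ (cokernel.π (s j).arrow)
    ((factors_iff_comp_cokernel _ _).1 (factors_of_le _ (s.monotone (leOfHom f)) (factors_self _)))

/-- The projection to the quotient by the `j`-th subobject of a monotone family. -/
noncomputable def quotProj (j : J) : X ⟶ (quotFunctor s).obj j := cokernel.π (s j).arrow

instance (j : J) : Epi (quotProj s j) := inferInstanceAs (Epi (cokernel.π (s j).arrow))

lemma quotProj_map {i j : J} (f : i ⟶ j) :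
    quotProj s i ≫ (quotFunctor s).map f = quotProj s j :=
  cokernel.π_desc _ _ _

lemma comp_quotProj_eq_zero_iff {Z : A} (f : Z ⟶ X) (j : J) :
    f ≫ quotProj s j = 0 ↔ (s j).Factors f :=
  (factors_iff_comp_cokernel _ _).symm

variable {s} in
lemma exists_quotProj_fac {j : J} {Z : A} (f : X ⟶ Z) (hf : (s j).arrow ≫ f = 0) :
    ∃ g : (quotFunctor s).obj j ⟶ Z, quotProj s j ≫ g = f :=
  ⟨cokernel.desc _ f hf, cokernel.π_desc _ _ _⟩

end

end

variable {A : Type u} [Category.{v} A] [Abelian A] [IsGrothendieckAbelian.{w} A]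

lemma exists_iSup {X Y : A} (p : X ⟶ Y) {ι : Sort*}
    (s : ι → Subobject X) :
    (Subobject.exists p).obj (⨆ i, s i) = ⨆ i, (Subobject.exists p).obj (s i) :=
  (existsPullbackAdj p).gc.l_iSup

lemma iSup_factors_of_factors {X Z : A}
    {ι : Sort*} {s : ι → Subobject X} {f : Z ⟶ X} (i : ι) (h : (s i).Factors f) :
    (⨆ i, s i).Factors f :=
  factors_of_le f (le_iSup s i) h

section

variable {X : A} {J : Type w} [PartialOrder J] (s : J →o Subobject X)

lemma arrow_comp_cokernel_iSup (j : J) :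
    (s j).arrow ≫ cokernel.π (⨆ j, s j).arrow = 0 :=
  (factors_iff_comp_cokernel _ _).1 (factors_of_le _ (le_iSup s j) (factors_self _))

/-- The cocone given by the quotient by the supremum of a monotone family of subobjects. -/
noncomputable def quotCocone : Cocone (quotFunctor s) where
  pt := cokernel (⨆ j, s j).arrow
  ι :=
    { app j := (exists_quotProj_fac _ (arrow_comp_cokernel_iSup s j)).choose
      naturality i j f := by
        rw [← cancel_epi (quotProj s i), ← Category.assoc, quotProj_map,
          Exists.choose_spec (exists_quotProj_fac _ (arrow_comp_cokernel_iSup s j))]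
        dsimp
        rw [Category.comp_id,
          Exists.choose_spec (exists_quotProj_fac _ (arrow_comp_cokernel_iSup s i))] }

/-- The projection to the quotient by the supremum of a monotone family. -/
noncomputable def quotCoconeProj : X ⟶ (quotCocone s).pt := cokernel.π (⨆ j, s j).arrow

instance : Epi (quotCoconeProj s) := inferInstanceAs (Epi (cokernel.π (⨆ j, s j).arrow))

lemma quotProj_ι (j : J) : quotProj s j ≫ (quotCocone s).ι.app j = quotCoconeProj s :=
  Exists.choose_spec (exists_quotProj_fac _ (arrow_comp_cokernel_iSup s j))

lemma comp_quotCoconeProj_eq_zero_iff {Z : A} (f : Z ⟶ X) :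
    f ≫ quotCoconeProj s = 0 ↔ (⨆ j, s j).Factors f :=
  (factors_iff_comp_cokernel _ _).symm

/-- The quotient by the supremum of a directed family of subobjects is the colimit of the
quotients. -/
noncomputable def isColimitQuotCocone [Nonempty J] [IsDirectedOrder J] :
    IsColimit (quotCocone s) := by
  have key (c : Cocone (quotFunctor s)) (i j : J) :
      quotProj s i ≫ c.ι.app i = quotProj s j ≫ c.ι.app j := by
    obtain ⟨k, hi, hj⟩ := exists_ge_ge i j
    rw [← c.w (homOfLE hi), ← c.w (homOfLE hj), ← Category.assoc, ← Category.assoc,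
      quotProj_map, quotProj_map]
  have key' (c : Cocone (quotFunctor s)) (i : J) :
      (⨆ j, s j).arrow ≫ quotProj s i ≫ c.ι.app i = 0 := by
    have : (⨆ j, s j) ≤ kernelSubobject (quotProj s i ≫ c.ι.app i) := iSup_le fun j =>
      le_kernelSubobject _ _ (by
        rw [key c i j, ← Category.assoc, (comp_quotProj_eq_zero_iff s _ _).2 (factors_self _),
          zero_comp])
    exact (kernelSubobject_factors_iff _ _).1 (factors_of_le _ this (factors_self _))
  have key'' (c : Cocone (quotFunctor s)) : ∃ g : (quotCocone s).pt ⟶ c.pt,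
      ∀ j, quotCoconeProj s ≫ g = quotProj s j ≫ c.ι.app j :=
    ⟨cokernel.desc _ _ (key' c (Classical.arbitrary J)), fun j =>
      (cokernel.π_desc _ _ _).trans (key c _ _)⟩
  exact
    { desc c := (key'' c).choose
      fac c j := by
        rw [← cancel_epi (quotProj s j), ← Category.assoc, quotProj_ι]
        exact (key'' c).choose_spec j
      uniq c m hm := by
        let j := Classical.arbitrary J
        rw [← cancel_epi (quotCoconeProj s), (key'' c).choose_spec j, ← hm j,
          ← quotProj_ι s j, Category.assoc] }

/-- Inverse images commute with directed unions of subobjects. -/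
lemma pullback_iSup_of_monotone [Nonempty J] [IsDirectedOrder J] {Z : A} (f : Z ⟶ X) :
    (pullback f).obj (⨆ j, s j) = ⨆ j, (pullback f).obj (s j) := by
  refine le_antisymm ?_ (iSup_le fun j => (pullback f).monotone (le_iSup s j))
  let t : J →o Subobject Z := ⟨fun j => (pullback f).obj (s j),
    fun i j h => (pullback f).monotone (s.monotone h)⟩
  have hα (j : J) := exists_quotProj_fac (s := t) (j := j) (f ≫ quotProj s j) (by
    rw [← Category.assoc, comp_quotProj_eq_zero_iff, ← pullback_factors_iff]
    exact factors_self _)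
  choose α hα using hα
  let α : quotFunctor t ⟶ quotFunctor s :=
    { app := α
      naturality i j h := by
        rw [← cancel_epi (quotProj t i), ← Category.assoc, quotProj_map, hα, ← Category.assoc,
          hα, Category.assoc, quotProj_map] }
  replace hα (j : J) : quotProj t j ≫ α.app j = f ≫ quotProj s j := hα j
  have (j : J) : Mono (α.app j) := by
    refine Preadditive.mono_of_cancel_zero _ fun {W} g hg => ?_
    obtain ⟨W', π, _, g', fac⟩ := surjective_up_to_refinements_of_epi (quotProj t j) g
    have h0 : g' ≫ f ≫ quotProj s j = 0 := by
      rw [← hα, ← Category.assoc, ← fac, Category.assoc, hg, comp_zero]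
    rw [← Category.assoc, comp_quotProj_eq_zero_iff, ← pullback_factors_iff] at h0
    rw [← cancel_epi π, comp_zero, fac]
    exact (comp_quotProj_eq_zero_iff t _ _).2 h0
  have := NatTrans.mono_of_mono_app α
  let φ : (quotCocone t).pt ⟶ (quotCocone s).pt :=
    (isColimitQuotCocone t).desc ((Cocone.precompose α).obj (quotCocone s))
  have hφ' (j : J) : (quotCocone t).ι.app j ≫ φ = α.app j ≫ (quotCocone s).ι.app j :=
    (isColimitQuotCocone t).fac ((Cocone.precompose α).obj (quotCocone s)) j
  have hφ : quotCoconeProj t ≫ φ = f ≫ quotCoconeProj s := by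
    let j := Classical.arbitrary J
    rw [← quotProj_ι t j, Category.assoc, hφ', ← Category.assoc, hα, Category.assoc, quotProj_ι]
  have : Mono φ := colim.map_mono' α (isColimitQuotCocone t) (isColimitQuotCocone s) φ hφ'
  refine le_of_factors ((comp_quotCoconeProj_eq_zero_iff t _).1 ?_)
  rw [← cancel_mono φ, Category.assoc, zero_comp, hφ, ← Category.assoc,
    comp_quotCoconeProj_eq_zero_iff, ← pullback_factors_iff]
  exact factors_self _

end

lemma pullback_iSup_nat {X Z : A} (s : ℕ → Subobject X) (hs : Monotone s) (f : Z ⟶ X) :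
    (pullback f).obj (⨆ n, s n) = ⨆ n, (pullback f).obj (s n) := by
  have := pullback_iSup_of_monotone (J := ULift.{w} ℕ)
    ⟨fun n => s n.down, fun i j h => hs h⟩ f
  have e : ∀ t : ℕ → Subobject X, (⨆ n : ULift.{w} ℕ, t n.down) = ⨆ n, t n :=
    fun t => Equiv.ulift.iSup_congr fun _ => rfl
  have e' : ∀ t : ℕ → Subobject Z, (⨆ n : ULift.{w} ℕ, t n.down) = ⨆ n, t n :=
    fun t => Equiv.ulift.iSup_congr fun _ => rfl
  rw [← e, ← e']
  exact this

end CategoryTheory.Subobject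

/-! ### Objects of bounded size -/

namespace CotorsionPair

open CategoryTheory.Subobject Cardinal

variable {A : Type u} [Category.{v} A]

/-- `X` has size at most `θ` (relative to the separator `G`) if there are at most `θ` morphisms
from `G` to `X`. -/
def IsBounded (θ : Cardinal.{v}) (G X : A) : Prop := #(G ⟶ X) ≤ θ

lemma IsBounded.of_mono {θ : Cardinal.{v}} {G X Y : A} (h : IsBounded θ G Y) (i : X ⟶ Y)
    [Mono i] : IsBounded θ G X :=
  (mk_le_of_injective (f := fun g : G ⟶ X => g ≫ i)
    fun _ _ h => (cancel_mono i).1 h).trans h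

lemma IsBounded.of_iso {θ : Cardinal.{v}} {G X Y : A} (h : IsBounded θ G Y) (i : X ≅ Y) :
    IsBounded θ G X :=
  h.of_mono i.hom

lemma IsBounded.of_le {θ : Cardinal.{v}} {G X : A} {s t : Subobject X}
    (h : IsBounded θ G (t : A)) (hst : s ≤ t) : IsBounded θ G (s : A) :=
  h.of_mono (Subobject.ofLE s t hst)

variable [Abelian A] [IsGrothendieckAbelian.{v} A]

lemma factors_imageSubobject_sigmaDesc {G X : A} {I : Type v} (f : I → (G ⟶ X)) (i : I) :
    (imageSubobject (Sigma.desc f)).Factors (f i) := by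
  have h := imageSubobject_factors_comp_self (f := Sigma.desc f) (Sigma.ι (fun _ : I => G) i)
  rwa [Sigma.ι_desc] at h

/-- The properties of a cardinal `θ` which make the objects of size at most `θ` behave like the
sets of cardinality at most `θ`. -/
structure IsAdmissible (θ : Cardinal.{v}) (G : A) : Prop where
  isSeparator : IsSeparator G
  aleph0_le : ℵ₀ ≤ θ
  power_le : θ ^ #(G ⟶ G) ≤ θ
  isBounded_sigma (I : Type v) (hI : #I ≤ θ) : IsBounded θ G (∐ fun _ : I => G)
  card_subobject_le : #(Shrink.{v} (Subobject G)) ≤ θ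

/-- A morphism from `G` to a supremum of subobjects factors through the supremum of few of them. -/
lemma exists_factors_iSup_of_card_subobject_le {ν : Cardinal.{v}} (hν : ℵ₀ ≤ ν) {G : A}
    (hG : #(Shrink.{v} (Subobject G)) ≤ ν) {X : A} {I : Type v} (s : I → Subobject X) (f : G ⟶ X)
    (hf : (⨆ i, s i).Factors f) :
    ∃ B : Set I, #B ≤ ν ∧ (⨆ i : B, s i).Factors f := by
  let J := {B : Set I // #B ≤ ν}
  have : IsDirectedOrder J := ⟨fun B B' => ⟨⟨B.1 ∪ B'.1,
    (mk_union_le _ _).trans (add_le_of_le hν B.2 B'.2)⟩, Set.subset_union_left,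
    Set.subset_union_right⟩⟩
  have : Nonempty J := ⟨⟨∅, by simp⟩⟩
  let t : J →o Subobject X := ⟨fun B => ⨆ i : B.1, s i, fun B B' h =>
    iSup_le fun i => le_iSup (fun i : B'.1 => s i) ⟨i.1, h i.2⟩⟩
  let p (B : J) : Subobject G := (Subobject.pullback f).obj (t B)
  -- one index set is chosen for each of the few values of `p`; their union is the largest value
  let σ : Set.range p → J := fun x => x.2.choose
  have hσ (x : Set.range p) : p (σ x) = x.1 := x.2.choose_spec
  let B₀ : Set I := ⋃ x : Set.range fun j => equivShrink.{v} (Subobject G) (p j),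
    (σ ⟨(equivShrink _).symm x.1, by obtain ⟨_, j, rfl⟩ := x; exact ⟨j, by simp⟩⟩).1
  have hB₀ : #B₀ ≤ ν := by
    refine (mk_iUnion_le _).trans ?_
    refine (mul_le_mul' ((mk_set_le _).trans hG)
      (ciSup_le' (a := ν) fun x => (σ _).2)).trans ?_
    exact (mul_eq_self hν).le
  have hle (B : J) : p B ≤ p ⟨B₀, hB₀⟩ := by
    let x : Set.range fun j => equivShrink.{v} (Subobject G) (p j) := ⟨_, B, rfl⟩
    have h1 : p B = p (σ ⟨(equivShrink _).symm x.1, ⟨B, by simp [x]⟩⟩) := by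
      rw [hσ]; simp [x]
    rw [h1]
    refine (Subobject.pullback f).monotone (t.monotone ?_)
    exact Set.subset_iUnion (fun x : Set.range fun j => equivShrink.{v} (Subobject G) (p j) =>
      (σ ⟨(equivShrink _).symm x.1, by obtain ⟨_, j, rfl⟩ := x; exact ⟨j, by simp⟩⟩).1) x
  refine ⟨B₀, hB₀, ?_⟩
  have h2 : (⨆ i, s i) ≤ ⨆ B, t B := iSup_le fun i =>
    (le_iSup (fun j : ({i} : Set I) => s j) ⟨i, rfl⟩).trans
      (le_iSup t ⟨{i}, by simpa using one_le_aleph0.trans hν⟩)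
  have h3 := factors_of_le f h2 hf
  rw [← Category.id_comp f, ← pullback_factors_iff, pullback_iSup_of_monotone t f] at h3
  have h4 := factors_of_le _ (iSup_le hle) h3
  rw [pullback_factors_iff, Category.id_comp] at h4
  exact h4

namespace IsAdmissible

variable {θ : Cardinal.{v}} {G : A} (hθ : IsAdmissible θ G)

include hθ

/-- A morphism `f` from `G` to a quotient `X` of `Y` is determined by the set of those
endomorphisms `g` of `G` such that `g ≫ f` lifts to `Y`, together with such lifts. -/
lemma isBounded_of_epi {X Y : A} (hY : IsBounded θ G Y) (p : Y ⟶ X) [Epi p] :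
    IsBounded θ G X := by
  classical
  let φ (f : G ⟶ X) (g : G ⟶ G) : Option (G ⟶ Y) :=
    if h : ∃ y : G ⟶ Y, y ≫ p = g ≫ f then some h.choose else none
  have hφ : Function.Injective φ := by
    intro f f' h
    rw [← cancel_epi (pullback.fst f p)]
    refine hθ.isSeparator.def _ _ fun g => ?_
    have h1 : ∃ y : G ⟶ Y, y ≫ p = (g ≫ pullback.fst f p) ≫ f :=
      ⟨g ≫ pullback.snd f p, by simp [pullback.condition]⟩
    have h2 := congr_fun h (g ≫ pullback.fst f p)
    have h3 : φ f (g ≫ pullback.fst f p) = some h1.choose := dif_pos h1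
    rw [h3] at h2
    by_cases h4 : ∃ y : G ⟶ Y, y ≫ p = (g ≫ pullback.fst f p) ≫ f'
    · have h5 : φ f' (g ≫ pullback.fst f p) = some h4.choose := dif_pos h4
      rw [h5, Option.some_inj] at h2
      rw [← Category.assoc, ← h1.choose_spec, h2, h4.choose_spec, Category.assoc]
    · have h5 : φ f' (g ≫ pullback.fst f p) = none := dif_neg h4
      rw [h5] at h2
      cases h2
  refine (mk_le_of_injective hφ).trans ?_
  rw [← power_def]
  refine (power_le_power_right ?_).trans hθ.power_le
  rw [mk_option]
  exact add_le_of_le hθ.aleph0_le hY (one_le_aleph0.trans hθ.aleph0_le)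

lemma isBounded_image {X : A} {I : Type v} (hI : #I ≤ θ) (f : I → (G ⟶ X)) :
    IsBounded θ G (imageSubobject (Sigma.desc f) : A) :=
  hθ.isBounded_of_epi (hθ.isBounded_sigma I hI) (factorThruImageSubobject (Sigma.desc f))

lemma isBounded_iSup {X : A} {I : Type v} (hI : #I ≤ θ) (s : I → Subobject X)
    (hs : ∀ i, IsBounded θ G (s i : A)) : IsBounded θ G ((⨆ i, s i : Subobject X) : A) := by
  let f : (Σ i, (G ⟶ (s i : A))) → (G ⟶ X) := fun x => x.2 ≫ (s x.1).arrow
  have hK : #(Σ i, (G ⟶ (s i : A))) ≤ θ := by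
    rw [mk_sigma]
    refine (sum_le_mk_mul_iSup _).trans ?_
    exact (mul_le_mul' hI (ciSup_le' hs)).trans (mul_eq_self hθ.aleph0_le).le
  refine (hθ.isBounded_image hK f).of_le (iSup_le fun i => le_of_forall_factors hθ.isSeparator ?_)
  intro g hg
  have := factors_imageSubobject_sigmaDesc f ⟨i, (s i).factorThru g hg⟩
  rwa [show f ⟨i, (s i).factorThru g hg⟩ = g from factorThru_arrow _ _ hg] at this

lemma isBounded_iSup_countable {X : A} {I : Type*} [Countable I] (s : I → Subobject X)
    (hs : ∀ i, IsBounded θ G (s i : A)) : IsBounded θ G ((⨆ i, s i : Subobject X) : A) := by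
  let e := equivShrink.{v} I
  have h : (⨆ i, s i) = ⨆ i : Shrink.{v} I, s (e.symm i) := (e.symm.iSup_congr fun _ => rfl).symm
  rw [h]
  have : Countable (Shrink.{v} I) := e.symm.countable_iff.2 inferInstance
  exact hθ.isBounded_iSup (mk_le_aleph0.trans hθ.aleph0_le) _ fun i => hs _

lemma isBounded_sup {X : A} {s t : Subobject X} (hs : IsBounded θ G (s : A))
    (ht : IsBounded θ G (t : A)) : IsBounded θ G ((s ⊔ t : Subobject X) : A) := by
  rw [sup_eq_iSup]
  exact hθ.isBounded_iSup_countable _ (by rintro (_ | _) <;> assumption)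

/-- A subobject of size at most `θ` which is contained in a supremum is contained in the supremum
of at most `θ` members of the family. -/
lemma exists_le_iSup {X : A} {I : Type v} (s : I → Subobject X) {t : Subobject X}
    (ht : IsBounded θ G (t : A)) (hts : t ≤ ⨆ i, s i) :
    ∃ B : Set I, #B ≤ θ ∧ t ≤ ⨆ i : B, s i := by
  have h (f : G ⟶ (t : A)) := exists_factors_iSup_of_card_subobject_le hθ.aleph0_le
    hθ.card_subobject_le s (f ≫ t.arrow) (factors_of_le _ hts (factors_comp_arrow f))
  choose B hB hB' using h
  refine ⟨⋃ f, B f, ?_, le_of_forall_factors hθ.isSeparator fun f hf => ?_⟩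
  · refine (mk_iUnion_le _).trans ((mul_le_mul' ht (ciSup_le' hB)).trans ?_)
    exact (mul_eq_self hθ.aleph0_le).le
  · have := hB' (t.factorThru f hf)
    rw [factorThru_arrow] at this
    refine factors_of_le _ (iSup_le fun i => ?_) this
    exact le_iSup (fun i : (⋃ f, B f : Set I) => s i) ⟨i.1, Set.mem_iUnion_of_mem _ i.2⟩

/-- Along an epimorphism, a subobject of size at most `θ` is covered by the image of one. -/
lemma exists_isBounded_le_exists {X Y : A} (p : X ⟶ Y) [Epi p] {t : Subobject Y}
    (ht : IsBounded θ G (t : A)) :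
    ∃ s : Subobject X, IsBounded θ G (s : A) ∧ t ≤ (Subobject.exists p).obj s := by
  classical
  let l (f : G ⟶ (t : A)) : G ⟶ X :=
    if h : ∃ g : G ⟶ X, g ≫ p = f ≫ t.arrow then h.choose else 0
  refine ⟨imageSubobject (Sigma.desc l), hθ.isBounded_image ht l, le_of_factors ?_⟩
  refine factors_of_epi (pullback.fst t.arrow p) ?_
  rw [factors_iff_comp_cokernel]
  refine hθ.isSeparator.def _ _ fun f => ?_
  rw [comp_zero, ← Category.assoc, ← factors_iff_comp_cokernel]
  have h : ∃ g : G ⟶ X, g ≫ p = (f ≫ pullback.fst t.arrow p) ≫ t.arrow :=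
    ⟨f ≫ pullback.snd _ _, by simp [pullback.condition]⟩
  have h1 : l (f ≫ pullback.fst t.arrow p) = h.choose := dif_pos h
  rw [← Category.assoc, ← h.choose_spec, ← h1]
  refine Factors.exists_comp ?_ p
  exact factors_imageSubobject_sigmaDesc l _

lemma isBounded_exists {X Y : A} (p : X ⟶ Y) {s : Subobject X}
    (hs : IsBounded θ G (s : A)) : IsBounded θ G ((Subobject.exists p).obj s : A) := by
  have h1 : (Subobject.exists p).obj s ≤ imageSubobject (s.arrow ≫ p) :=
    (exists_le_iff _ _ _).2 (le_of_factors ((pullback_factors_iff _ _ _).2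
      (by simpa using imageSubobject_factors_comp_self (f := s.arrow ≫ p) (𝟙 (s : A)))))
  exact (hθ.isBounded_of_epi hs (factorThruImageSubobject (s.arrow ≫ p))).of_le h1

/-- Every object is covered by its bounded subobjects. -/
lemma exists_isBounded_factors {X : A} (f : G ⟶ X) :
    ∃ s : Subobject X, IsBounded θ G (s : A) ∧ s.Factors f := by
  refine ⟨imageSubobject (Sigma.desc (fun _ : PUnit.{v + 1} => f)), hθ.isBounded_image ?_ _, ?_⟩
  · simpa using one_le_aleph0.trans hθ.aleph0_le
  · exact factors_imageSubobject_sigmaDesc (fun _ : PUnit.{v + 1} => f) ⟨⟩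

end IsAdmissible

/-- A morphism from `G` to a coproduct of copies of `G` factors through a small coproduct. -/
lemma exists_fac_sigma {ν : Cardinal.{v}} (hν : ℵ₀ ≤ ν) {G : A}
    (hG : #(Shrink.{v} (Subobject G)) ≤ ν) {I : Type v} [Nonempty I]
    (f : G ⟶ ∐ fun _ : I => G) :
    ∃ (b : ν.out → I) (g : G ⟶ ∐ fun _ : ν.out => G),
      f = g ≫ Sigma.desc fun k => Sigma.ι (fun _ : I => G) (b k) := by
  classical
  let s (i : I) : Subobject (∐ fun _ : I => G) := imageSubobject (Sigma.ι (fun _ : I => G) i)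
  have hs : (⨆ i, s i).Factors f := by
    rw [factors_iff_comp_cokernel]
    have : cokernel.π (⨆ i, s i).arrow = 0 := by
      refine Sigma.hom_ext _ _ fun i => ?_
      rw [comp_zero, ← factors_iff_comp_cokernel]
      refine iSup_factors_of_factors i ?_
      have := imageSubobject_factors_comp_self (f := Sigma.ι (fun _ : I => G) i) (𝟙 G)
      rwa [Category.id_comp] at this
    rw [this, comp_zero]
  obtain ⟨B, hB, hf⟩ := exists_factors_iSup_of_card_subobject_le hν hG s f hs
  rw [← mk_out ν] at hB
  obtain ⟨a⟩ := hB
  let b (k : ν.out) : I := if h : ∃ i : B, a i = k then h.choose else Classical.arbitrary I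
  have hb (i : B) : b (a i) = i := by
    have h : ∃ j : B, a j = a i := ⟨i, rfl⟩
    have : b (a i) = h.choose := dif_pos h
    rw [this, a.injective h.choose_spec]
  let m : (∐ fun _ : ν.out => G) ⟶ ∐ fun _ : I => G :=
    Sigma.desc fun k => Sigma.ι (fun _ : I => G) (b k)
  let e : (∐ fun _ : I => G) ⟶ ∐ fun _ : ν.out => G :=
    Sigma.desc fun i => if h : i ∈ B then Sigma.ι (fun _ : ν.out => G) (a ⟨i, h⟩) else 0
  refine ⟨b, f ≫ e, ?_⟩
  have hle : (⨆ i : B, s i) ≤ kernelSubobject (e ≫ m - 𝟙 _) := iSup_le fun i => by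
    refine imageSubobject_le _ (factorThruKernelSubobject _ (Sigma.ι (fun _ : I => G) i.1) ?_)
      (factorThruKernelSubobject_comp_arrow _ _ _)
    have h1 : Sigma.ι (fun _ : I => G) i.1 ≫ e = Sigma.ι (fun _ : ν.out => G) (a i) := by
      simp [e]
    have h2 : Sigma.ι (fun _ : ν.out => G) (a i) ≫ m = Sigma.ι (fun _ : I => G) i.1 := by
      have : Sigma.ι (fun _ : ν.out => G) (a i) ≫ m = Sigma.ι (fun _ : I => G) (b (a i)) := by
        simp [m]
      rw [this, hb]
    rw [Preadditive.comp_sub, Category.comp_id, ← Category.assoc, h1, h2, sub_self]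
  have h := (kernelSubobject_factors_iff _ _).1 (factors_of_le f hle hf)
  rw [Preadditive.comp_sub, Category.comp_id, sub_eq_zero] at h
  rw [Category.assoc]
  exact h.symm

/-- All large enough powers of `2` are admissible. -/
lemma exists_forall_isAdmissible {G : A} (hG : IsSeparator G) :
    ∃ ν₁ : Cardinal.{v}, ∀ ν, ν₁ ≤ ν → IsAdmissible (2 ^ ν) G := by
  let ν₀ : Cardinal.{v} := max ℵ₀ (max #(G ⟶ G) #(Shrink.{v} (Subobject G)))
  refine ⟨max ν₀ #(G ⟶ ∐ fun _ : ν₀.out => G), fun ν hν₁ => ?_⟩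
  have h0 : ℵ₀ ≤ ν₀ := le_max_left _ _
  have h1 : ν₀ ≤ ν := (le_max_left _ _).trans hν₁
  have h1' : #(G ⟶ ∐ fun _ : ν₀.out => G) ≤ ν := (le_max_right _ _).trans hν₁
  have hν : ν < 2 ^ ν := cantor ν
  have h2 : (2 : Cardinal.{v}) ^ ν ≠ 0 := (lt_of_le_of_lt (_root_.zero_le) hν).ne'
  have hpow : ((2 : Cardinal.{v}) ^ ν) ^ ν = 2 ^ ν := by
    rw [← power_mul, mul_eq_self (h0.trans h1)]
  refine ⟨hG, ?_, ?_, fun I hI => ?_, ?_⟩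
  · exact (h0.trans h1).trans hν.le
  · refine (power_le_power_left h2 ?_).trans hpow.le
    exact ((le_max_left _ _).trans (le_max_right _ _)).trans h1
  · rcases isEmpty_or_nonempty I with hI' | hI'
    · have : Subsingleton (G ⟶ ∐ fun _ : I => G) := ⟨fun f g => by
        have h0 : 𝟙 (∐ fun _ : I => G) = 0 := Sigma.hom_ext _ _ fun i => isEmptyElim i
        rw [← Category.comp_id f, ← Category.comp_id g, h0, comp_zero, comp_zero]⟩
      exact (le_one_iff_subsingleton.2 this).trans (one_le_aleph0.trans ((h0.trans h1).trans hν.le))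
    · have hs : #(Shrink.{v} (Subobject G)) ≤ ν₀ := (le_max_right _ _).trans (le_max_right _ _)
      have hsurj : Function.Surjective
          (fun x : (ν₀.out → I) × (G ⟶ ∐ fun _ : ν₀.out => G) =>
            x.2 ≫ Sigma.desc fun k => Sigma.ι (fun _ : I => G) (x.1 k)) := fun f => by
        obtain ⟨b, g, hf⟩ := exists_fac_sigma h0 hs f
        exact ⟨⟨b, g⟩, hf.symm⟩
      refine (mk_le_of_surjective hsurj).trans ?_
      rw [mk_prod, lift_id, lift_id, ← power_def, mk_out]
      have h3 : #I ^ ν₀ ≤ 2 ^ ν :=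
        ((power_le_power_right hI).trans (power_le_power_left h2 h1)).trans hpow.le
      refine (mul_le_mul' h3 (h1'.trans hν.le)).trans ?_
      exact (mul_eq_self ((h0.trans h1).trans hν.le)).le
  · exact (((le_max_right _ _).trans (le_max_right _ _)).trans h1).trans hν.le

end CotorsionPair

/-! ### Completeness of cotorsion pairs cogenerated by a set -/

namespace CotorsionPair

open MorphismProperty HomotopicalAlgebra

lemma llp_of_relativeCellComplex {A : Type u} [Category.{v} A] {I W : MorphismProperty A}
    (hI : I ≤ W.llp) {J : Type v} [LinearOrder J] [OrderBot J] [SuccOrder J] [WellFoundedLT J]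
    {X Y : A} {f : X ⟶ Y}
    (c : RelativeCellComplex.{v} (fun _ : J => I.homFamily) f) : W.llp f := by
  have h : (coproducts.{v} I).pushouts.TransfiniteCompositionOfShape J f :=
    c.transfiniteCompositionOfShape.ofLE (by simp)
  exact antitone_llp ((le_llp_iff_le_rlp _ _).1 hI) _
    (I.transfiniteCompositionsOfShape_pushouts_coproducts_le_llp_rlp J _ h.mem)

variable {A : Type u} [Category.{v} A] [Abelian A]

/-- A morphism `p` is an epimorphism if all those morphisms from a separator lift along `p` which
lift along some given epimorphism `q`. -/
lemma epi_of_forall_exists_lift {G : A} (hG : IsSeparator G) {X Y Z : A} (p : Y ⟶ X)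
    (q : Z ⟶ X) [Epi q] (h : ∀ (u : G ⟶ X), (∃ v, v ≫ q = u) → ∃ v, v ≫ p = u) : Epi p := by
  refine Preadditive.epi_of_cokernel_zero ?_
  rw [← cancel_epi q, comp_zero]
  refine hG.def _ _ fun g => ?_
  obtain ⟨v, hv⟩ := h (g ≫ q) ⟨g, rfl⟩
  rw [comp_zero, ← Category.assoc, ← hv, Category.assoc, cokernel.condition, comp_zero]

variable [IsGrothendieckAbelian.{v} A]

/-- The generating monomorphisms of a cotorsion pair: `0 ⟶ G`, and the kernels of the
epimorphisms onto objects `t` of `T` from coproducts of copies of `G` which are indexed by sets of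
morphisms `G ⟶ t`. All such sets are allowed, as `G` need not be projective: the set which is needed
in `rightPerp_kernel_of_rlp_cells` depends on the extension to be split. -/
noncomputable def cells (T : ObjectProperty A) (G : A) : MorphismProperty A :=
  ofHoms (fun _ : PUnit.{v + 1} => (0 : 0 ⟶ G)) ⊔
    ofHoms (fun x : Σ t : Subtype T, { S : Set (G ⟶ t.1) // Epi (Sigma.desc fun f : S => f.1) } =>
      kernel.ι (Sigma.desc fun f : x.2.1 => f.1))

lemma cells_le_iff {T : ObjectProperty A} {G : A} {P : MorphismProperty A} :
    cells T G ≤ P ↔ P (0 : 0 ⟶ G) ∧ ∀ t, T t → ∀ (S : Set (G ⟶ t)),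
      Epi (Sigma.desc fun f : S => f.1) → P (kernel.ι (Sigma.desc fun f : S => f.1)) := by
  rw [cells, sup_le_iff]
  refine and_congr ⟨fun h => h _ (ofHoms.mk PUnit.unit), ?_⟩
    ⟨fun h t ht S hS => h _ (ofHoms.mk (⟨⟨t, ht⟩, S, hS⟩ : Σ t : Subtype T,
      { S : Set (G ⟶ t.1) // Epi (Sigma.desc fun f : S => f.1) })), ?_⟩
  · rintro h _ _ _ ⟨⟩
    exact h
  · rintro h _ _ _ ⟨x⟩
    exact h _ x.1.2 _ x.2.2

lemma cells_le_monomorphisms (T : ObjectProperty A) (G : A) :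
    cells T G ≤ monomorphisms A :=
  cells_le_iff.2 ⟨inferInstanceAs (Mono _), fun _ _ _ _ => inferInstanceAs (Mono _)⟩

instance isSmall_cells (T : ObjectProperty A) [ObjectProperty.Small.{v} T] (G : A) :
    IsSmall.{v} (cells T G) := by
  rw [cells, sup_eq_iSup]
  have (b : Bool) : IsSmall.{v} (cond b (ofHoms (fun _ : PUnit.{v + 1} => (0 : 0 ⟶ G)))
      (ofHoms (fun x : Σ t : Subtype T,
        { S : Set (G ⟶ t.1) // Epi (Sigma.desc fun f : S => f.1) } =>
          kernel.ι (Sigma.desc fun f : x.2.1 => f.1)))) := by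
    have : Small.{v} (Subtype T) := inferInstance
    cases b <;> dsimp only [cond] <;> infer_instance
  exact isSmall_iSup _

lemma mono_map_le_succ_of_relativeCellComplex {I : MorphismProperty A}
    (hI : I ≤ monomorphisms A) {J : Type*} [LinearOrder J]
    [OrderBot J] [SuccOrder J] [WellFoundedLT J] {X Y : A} {f : X ⟶ Y}
    (c : RelativeCellComplex.{v} (fun _ : J => I.homFamily) f) (j : J) (hj : ¬ IsMax j) :
    Mono (c.F.map (homOfLE (Order.le_succ j))) := by
  have h := (c.attachCells j hj).pushouts_coproducts
  rw [ofHoms_homFamily] at h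
  refine (?_ : _ ≤ monomorphisms A) _ h
  simpa only [pushouts_le_iff, coproducts_le_iff]

/-- A relative cell complex for a class of monomorphisms, as a transfinite composition of
monomorphisms. -/
def monoTransfiniteComposition {I : MorphismProperty A} (hI : I ≤ monomorphisms A) {J : Type*}
    [LinearOrder J] [OrderBot J] [SuccOrder J] [WellFoundedLT J] {X Y : A} {f : X ⟶ Y}
    (c : RelativeCellComplex.{v} (fun _ : J => I.homFamily) f) :
    (monomorphisms A).TransfiniteCompositionOfShape J f where
  toTransfiniteCompositionOfShape := c.toTransfiniteCompositionOfShape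
  map_mem j hj := mono_map_le_succ_of_relativeCellComplex hI c j hj

/-- In a Grothendieck abelian category, every object is small with respect to relative cell
complexes of monomorphisms. -/
lemma hasSmallObjectArgument_of_le_monomorphisms {I : MorphismProperty A}
    (hI : I ≤ monomorphisms A) [IsSmall.{v} I] : HasSmallObjectArgument.{v} I := by
  have : Small.{v} I.toSet := IsSmall.small_toSet
  obtain ⟨κ, hκ', hκ⟩ := HasCardinalLT.exists_regular_cardinal_forall.{v}
    (fun f : I.toSet => Subobject f.1.left)
  have : Fact κ.IsRegular := ⟨hκ'⟩
  have : Nonempty κ.ord.ToType := by simpa using hκ'.ne_zero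
  have := WellFoundedLT.toOrderBot κ.ord.ToType
  exact ⟨κ, inferInstance, inferInstance,
    { preservesColimit {A B X Y} i hi f hf := by
        have (j j' : κ.ord.ToType) (φ : j ⟶ j') : Mono (hf.F.map φ) :=
          (monoTransfiniteComposition hI hf).mem_map φ
        exact IsGrothendieckAbelian.preservesColimit_coyoneda_obj_of_mono (Y := hf.F) (κ := κ)
          (hκ ⟨Arrow.mk i, hi⟩) }⟩

lemma epi_of_rlp_cells {T : ObjectProperty A} {G : A} (hG : IsSeparator G) {X Y : A} {p : X ⟶ Y}
    (hp : (cells T G).rlp p) : Epi p := by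
  refine epi_of_forall_exists_lift hG p (𝟙 Y) fun u _ => ?_
  have := hp (0 : 0 ⟶ G) ((cells_le_iff.1 le_rfl).1)
  have sq : CommSq (0 : 0 ⟶ X) (0 : 0 ⟶ G) p u := ⟨by simp⟩
  exact ⟨sq.lift, sq.fac_right⟩

/-- An extension of `t` by `kernel p` is given by a morphism `g` from `t` to the cokernel of an
injective embedding of `kernel p`. It pulls back to a split extension of a coproduct of copies of
`G`, and the lifting property of `p` allows to choose the splitting such that it descends to `t`. -/
lemma rightPerp_kernel_of_rlp_cells {T : ObjectProperty A} {G : A} (hG : IsSeparator G) {X Y : A}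
    {p : X ⟶ Y} (hp : (cells T G).rlp p) : rightPerp T (kernel p) := by
  intro t ht
  refine extOneVanishes_of_exists_lift (shortExact_cokernel (Injective.ι (kernel p))) fun g => ?_
  dsimp at g ⊢
  -- the summands are indexed by the morphisms along which `g` lifts
  let S : Set (G ⟶ t) := {u | ∃ v : G ⟶ _, v ≫ injQuot (kernel p) = u ≫ g}
  let π : (∐ fun _ : S => G) ⟶ t := Sigma.desc fun f : S => f.1
  have hπ : Epi π := by
    refine epi_of_forall_exists_lift hG π (pullback.fst g (injQuot (kernel p))) ?_
    rintro _ ⟨v, rfl⟩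
    have hv : v ≫ pullback.fst g (injQuot (kernel p)) ∈ S :=
      ⟨v ≫ pullback.snd g (injQuot (kernel p)), by simp [pullback.condition]⟩
    exact ⟨Sigma.ι (fun _ : S => G) ⟨_, hv⟩, by simp [π]⟩
  let l : (∐ fun _ : S => G) ⟶ Injective.under (kernel p) := Sigma.desc fun u : S => u.2.choose
  have hl : l ≫ injQuot (kernel p) = π ≫ g := Sigma.hom_ext _ _ fun u => by
    simpa [l, π] using u.2.choose_spec
  have hK := (shortExact_cokernel (Injective.ι (kernel p))).exact
  let m : kernel π ⟶ kernel p := hK.lift (kernel.ι π ≫ l) (by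
    dsimp; rw [Category.assoc, hl, kernel.condition_assoc, zero_comp])
  have hm : m ≫ Injective.ι (kernel p) = kernel.ι π ≫ l := hK.lift_f _ _
  have := hp (kernel.ι π) ((cells_le_iff.1 le_rfl).2 t ht S hπ)
  have sq : CommSq (m ≫ kernel.ι p) (kernel.ι π) p 0 := ⟨by simp⟩
  let e : (∐ fun _ : S => G) ⟶ kernel p := kernel.lift p sq.lift sq.fac_right
  have he : kernel.ι π ≫ e = m := by
    rw [← cancel_mono (kernel.ι p), Category.assoc, kernel.lift_ι, sq.fac_left]
  have hE := (shortExact_kernel π).exact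
  refine ⟨hE.desc (l - e ≫ Injective.ι (kernel p)) ?_, ?_⟩
  · dsimp
    rw [Preadditive.comp_sub, ← Category.assoc, he, hm, sub_self]
  · rw [← cancel_epi π]
    have h := hE.g_desc (l - e ≫ Injective.ι (kernel p)) (by
      dsimp; rw [Preadditive.comp_sub, ← Category.assoc, he, hm, sub_self])
    dsimp at h
    rw [reassoc_of% h, Preadditive.sub_comp, Category.assoc, cokernel.condition, comp_zero,
      sub_zero, hl]

lemma cells_le_llp {T : ObjectProperty A} {G : A} (hG : leftPerp (rightPerp T) G) :
    cells T G ≤ (injQuots (rightPerp T)).llp :=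
  cells_le_iff.2 ⟨leftPerp_iff_llp_zero.1 hG, fun t ht S _ =>
    (leftPerp_iff_llp (shortExact_kernel (Sigma.desc fun f : S => f.1))).1 fun _ hY => hY t ht⟩

lemma mono_of_relativeCellComplex {I : MorphismProperty A} (hI : I ≤ monomorphisms A) {J : Type v}
    [LinearOrder J] [OrderBot J] [SuccOrder J] [WellFoundedLT J] {X Y : A} {f : X ⟶ Y}
    (c : RelativeCellComplex.{v} (fun _ : J => I.homFamily) f) : Mono f :=
  (monomorphisms A).transfiniteCompositionsOfShape_le J _ (monoTransfiniteComposition hI c).mem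

/-- Every morphism is a relative cell complex followed by an epimorphism whose kernel belongs to
`T^⊥`. -/
lemma exists_relativeCellComplex (T : ObjectProperty A) [ObjectProperty.Small.{v} T] {G : A}
    (hG : IsSeparator G) {X Y : A} (f : X ⟶ Y) :
    ∃ (J : Type v) (_ : LinearOrder J) (_ : OrderBot J) (_ : SuccOrder J) (_ : WellFoundedLT J)
      (P : A) (i : X ⟶ P) (p : P ⟶ Y)
      (_ : RelativeCellComplex.{v} (fun _ : J => (cells T G).homFamily) i),
      i ≫ p = f ∧ Epi p ∧ rightPerp T (kernel p) := by
  have := hasSmallObjectArgument_of_le_monomorphisms (cells_le_monomorphisms T G)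
  obtain ⟨κ, _, _, _⟩ := HasSmallObjectArgument.exists_cardinal (I := cells T G)
  have h := SmallObject.rlp_πObj (cells T G) κ f
  exact ⟨_, _, _, _, _, _, _, _, SmallObject.relativeCellComplexιObj (cells T G) κ f,
    SmallObject.ιObj_πObj _ _ _, epi_of_rlp_cells hG h, rightPerp_kernel_of_rlp_cells hG h⟩

/-- A cotorsion pair which is cogenerated by a set is complete if its left-hand class contains a
separator. -/
theorem IsCotorsionPair.isCompleteCotorsionPair {F C : ObjectProperty A} (h : IsCotorsionPair F C)
    {T : ObjectProperty A} [ObjectProperty.Small.{v} T] (hT : rightPerp T = C) {G : A}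
    (hGF : F G) (hG : IsSeparator G) : IsCompleteCotorsionPair F C := by
  subst hT
  have hcells := cells_le_llp (h.left_eq ▸ hGF)
  refine { h with enoughProjectives := fun M => ?_, enoughInjectives := fun M => ?_ }
  -- `0 ⟶ M` factors through an object of `F`
  · obtain ⟨J, _, _, _, _, P, i, p, c, -, hp, hp'⟩ :=
      exists_relativeCellComplex T hG (0 : 0 ⟶ M)
    refine ⟨_, _, kernel.ι p, p, kernel.condition p, shortExact_kernel p, hp', ?_⟩
    have hi := llp_of_relativeCellComplex hcells c
    rw [h.left_eq, leftPerp_iff_llp_zero]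
    rwa [(isZero_zero A).eq_of_src i 0] at hi
  -- `M ⟶ 0` factors through an object of `C`
  · obtain ⟨J, _, _, _, _, E, i, p, c, -, hp, hp'⟩ :=
      exists_relativeCellComplex T hG (0 : M ⟶ 0)
    have := mono_of_relativeCellComplex (cells_le_monomorphisms T G) c
    refine ⟨_, _, i, cokernel.π i, cokernel.condition i, shortExact_cokernel i, ?_, ?_⟩
    · have : IsIso (kernel.ι p) := by
        rw [(isZero_zero A).eq_of_tgt p 0]
        infer_instance
      exact hp'.of_iso (asIso (kernel.ι p))
    · rw [h.left_eq, leftPerp_cokernel_iff]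
      exact llp_of_relativeCellComplex hcells c

end CotorsionPair

/-! ### Morphisms out of a relative cell complex -/

namespace HomotopicalAlgebra

universe w' t

variable {C : Type u} [Category.{v} C]

lemma AttachCells.attach_comp {α : Type t} {A B : α → C} {g : ∀ a, A a ⟶ B a}
    {X₁ X₂ : C} {f : X₁ ⟶ X₂} (a : AttachCells.{w} g f) (k : a.ι) :
    (a.cofan₁.inj k ≫ a.g₁) ≫ f = g (a.π k) ≫ a.cell k := by
  rw [Category.assoc, a.isPushout.w, a.hm_assoc, a.cell_def]

/-- A morphism from the result of attaching cells is given by a morphism from the original object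
and compatible morphisms from the cells. -/
lemma AttachCells.exists_desc {α : Type t} {A B : α → C} {g : ∀ a, A a ⟶ B a}
    {X₁ X₂ : C} {f : X₁ ⟶ X₂} (a : AttachCells.{w} g f) {Z : C} (l : X₁ ⟶ Z)
    (m : ∀ k, B (a.π k) ⟶ Z) (hm : ∀ k, g (a.π k) ≫ m k = (a.cofan₁.inj k ≫ a.g₁) ≫ l) :
    ∃ l' : X₂ ⟶ Z, f ≫ l' = l ∧ ∀ k, a.cell k ≫ l' = m k := by
  have h : a.g₁ ≫ l = a.m ≫ Cofan.IsColimit.desc a.isColimit₂ m := by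
    refine Cofan.IsColimit.hom_ext a.isColimit₁ _ _ fun k => ?_
    rw [← Category.assoc, ← hm, a.hm_assoc, Cofan.IsColimit.fac]
  refine ⟨a.isPushout.desc l (Cofan.IsColimit.desc a.isColimit₂ m) h, a.isPushout.inl_desc _ _ _,
    fun k => ?_⟩
  rw [a.cell_def, Category.assoc, a.isPushout.inr_desc, Cofan.IsColimit.fac]

namespace RelativeCellComplex

variable {J : Type w'} [LinearOrder J] [OrderBot J] [SuccOrder J] [WellFoundedLT J]
  {α : J → Type t} {A B : (j : J) → α j → C}
  {basicCell : (j : J) → (i : α j) → A j i ⟶ B j i} {X Y : C} {f : X ⟶ Y}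
  {c : RelativeCellComplex.{w} basicCell f}

/-- The attaching morphism of a cell. -/
def Cells.attach (γ : Cells c) : A γ.j γ.i ⟶ c.F.obj γ.j :=
  (c.attachCells γ.j γ.hj).cofan₁.inj γ.k ≫ (c.attachCells γ.j γ.hj).g₁

/-- The inclusion of a cell into the step of the complex where it is added. -/
def Cells.ιSucc (γ : Cells c) : B γ.j γ.i ⟶ c.F.obj (Order.succ γ.j) :=
  (c.attachCells γ.j γ.hj).cell γ.k

/-- The inclusion of a cell into a later step of the complex. -/
def Cells.ιAt (γ : Cells c) {j : J} (h : γ.j < j) : B γ.j γ.i ⟶ c.F.obj j :=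
  γ.ιSucc ≫ c.F.map (homOfLE (Order.succ_le_of_lt h))

lemma Cells.ιAt_succ (γ : Cells c) (h : γ.j < Order.succ γ.j) : γ.ιAt h = γ.ιSucc :=
  (congrArg (γ.ιSucc ≫ ·) (c.F.map_id _)).trans (Category.comp_id _)

@[simp]
lemma Cells.ιAt_map (γ : Cells c) {j j' : J} (h : γ.j < j) (h' : j ⟶ j') :
    γ.ιAt h ≫ c.F.map h' = γ.ιAt (h.trans_le (leOfHom h')) := by
  dsimp only [ιAt]
  rw [Category.assoc, ← Functor.map_comp]
  rfl

@[simp]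
lemma Cells.ιAt_map_assoc (γ : Cells c) {j j' : J} (h : γ.j < j) (h' : j ⟶ j') {Z : C}
    (φ : c.F.obj j' ⟶ Z) : γ.ιAt h ≫ c.F.map h' ≫ φ = γ.ιAt (h.trans_le (leOfHom h')) ≫ φ := by
  rw [← Category.assoc, ιAt_map]

@[simp]
lemma Cells.ιAt_incl (γ : Cells c) {j : J} (h : γ.j < j) :
    γ.ιAt h ≫ c.incl.app j = γ.ι := by
  dsimp only [ιAt]
  rw [Category.assoc, c.incl.naturality]
  exact congrArg (γ.ιSucc ≫ ·) (Category.comp_id _)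

lemma Cells.attach_map (γ : Cells c) :
    γ.attach ≫ c.F.map (homOfLE (Order.le_succ γ.j)) = basicCell γ.j γ.i ≫ γ.ιSucc :=
  (c.attachCells γ.j γ.hj).attach_comp γ.k

lemma Cells.attach_incl (γ : Cells c) :
    γ.attach ≫ c.incl.app γ.j = basicCell γ.j γ.i ≫ γ.ι := by
  have h : c.F.map (homOfLE (Order.le_succ γ.j)) ≫ c.incl.app (Order.succ γ.j) =
      c.incl.app γ.j :=
    (c.incl.naturality _).trans (Category.comp_id _)
  have h' : γ.ιSucc ≫ c.incl.app (Order.succ γ.j) = γ.ι := rfl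
  rw [← h, reassoc_of% γ.attach_map, h']

variable (c) in
/-- A morphism from a step of a relative cell complex, subject to a condition on each cell. -/
@[ext]
structure PartialDesc {Z : C} (Q : ∀ γ : Cells c, (B γ.j γ.i ⟶ Z) → Prop) (j : J) where
  /-- The morphism from the step `j`. -/
  hom : c.F.obj j ⟶ Z
  prop (γ : Cells c) (h : γ.j < j) : Q γ (γ.ιAt h ≫ hom)

/-- The restriction of a morphism to an earlier step. -/
@[simps]
def PartialDesc.restrict {Z : C} {Q : ∀ γ : Cells c, (B γ.j γ.i ⟶ Z) → Prop} {j : J}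
    (l : PartialDesc c Q j) {i : J} (a : i ⟶ j) : PartialDesc c Q i where
  hom := c.F.map a ≫ l.hom
  prop γ h := by simpa using l.prop γ (h.trans_le (leOfHom a))

variable (c) in
/-- The functor given by the restriction to earlier steps. -/
def partialDescFunctor {Z : C} (Q : ∀ γ : Cells c, (B γ.j γ.i ⟶ Z) → Prop) :
    Jᵒᵖ ⥤ Type _ where
  obj j := PartialDesc c Q j.unop
  map a := ↾fun l => l.restrict a.unop

/-- A morphism from a relative cell complex may be constructed cell by cell: it suffices that each
morphism which is already defined on a step of the complex extends to every cell which is attached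
to that step. -/
lemma exists_hom {Z : C} (Q : ∀ γ : Cells c, (B γ.j γ.i ⟶ Z) → Prop) (φ : X ⟶ Z)
    (h : ∀ (γ : Cells c) (l : PartialDesc c Q γ.j), ∃ m, Q γ m ∧
      basicCell γ.j γ.i ≫ m = γ.attach ≫ l.hom) :
    ∃ l : Y ⟶ Z, ∀ γ : Cells c, Q γ (γ.ι ≫ l) := by
  have hsucc (j : J) (hj : ¬ IsMax j) (l : PartialDesc c Q j) :
      ∃ l' : PartialDesc c Q (Order.succ j), l'.restrict (homOfLE (Order.le_succ j)) = l := by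
    choose m hm hm' using fun k : (c.attachCells j hj).ι => h ⟨j, hj, k⟩ l
    obtain ⟨l', hl', hl''⟩ := (c.attachCells j hj).exists_desc l.hom m hm'
    refine ⟨⟨l', fun γ hγ => ?_⟩, PartialDesc.ext hl'⟩
    rcases (Order.le_of_lt_succ hγ).lt_or_eq with h1 | h1
    · have h2 : γ.ιAt hγ = γ.ιAt h1 ≫ c.F.map (homOfLE (Order.le_succ j)) := by simp
      rw [h2, Category.assoc, hl']
      exact l.prop γ h1
    · obtain ⟨_, _, k⟩ := γ
      obtain rfl : _ = j := h1
      have h2 : Cells.ιAt (c := c) ⟨_, hj, k⟩ hγ = Cells.ιSucc ⟨_, hj, k⟩ := Cells.ιAt_succ _ _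
      have h3 : Cells.ιSucc ⟨_, hj, k⟩ ≫ l' = m k := hl'' k
      rw [h2, h3]
      exact hm k
  have hlim (j : J) (hj : Order.IsSuccLimit j) (x : ∀ i, i < j → PartialDesc c Q i)
      (hx : ∀ i i' (hi : i < j) (hi' : i' < j) (a : i ⟶ i'), (x i' hi').restrict a = x i hi) :
      ∃ y : PartialDesc c Q j, ∀ i (hi : i < j), y.restrict (homOfLE hi.le) = x i hi := by
    have hc := c.F.isColimitOfIsWellOrderContinuous j hj
    let t : Cocone ((Set.principalSegIio j).monotone.functor ⋙ c.F) :=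
      { pt := Z
        ι :=
          { app := fun i => (x i.1 i.2).hom
            naturality i i' a := by
              have := congr_arg PartialDesc.hom (hx i.1 i'.1 i.2 i'.2 (homOfLE (leOfHom a)))
              exact this.trans (Category.comp_id _).symm } }
    obtain ⟨l, hl⟩ : ∃ l : c.F.obj j ⟶ Z,
        ∀ (i : J) (hi : i < j), c.F.map (homOfLE hi.le) ≫ l = (x i hi).hom :=
      ⟨hc.desc t, fun i hi => hc.fac t ⟨i, hi⟩⟩
    refine ⟨⟨l, fun γ hγ => ?_⟩, fun i hi => PartialDesc.ext (hl i hi)⟩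
    have h1 := hj.succ_lt hγ
    have h2 : γ.ιAt hγ = γ.ιSucc ≫ c.F.map (homOfLE h1.le) := rfl
    have h3 := (x _ h1).prop γ (Order.lt_succ_of_not_isMax γ.hj)
    rwa [γ.ιAt_succ, ← hl _ h1, ← Category.assoc, ← h2] at h3
  let d : (partialDescFunctor c Q).WellOrderInductionData := .ofExists
    (fun j hj l => hsucc j hj l)
    (fun j hj x => hlim j hj (fun i hi => x.1 ⟨⟨i, hi⟩⟩) fun i i' hi hi' a =>
      x.2 (show Opposite.op (⟨i', hi'⟩ : Set.Iio j) ⟶ Opposite.op ⟨i, hi⟩ from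
        (homOfLE (leOfHom a)).op))
  obtain ⟨s, -⟩ := d.surjective ⟨c.isoBot.hom ≫ φ, fun γ h => (not_lt_bot h).elim⟩
  let x (j : J) : PartialDesc c Q j := s.1 ⟨j⟩
  have hx (i j : J) (a : i ⟶ j) : (x j).restrict a = x i := s.2 a.op
  let t : Cocone c.F :=
    { pt := Z
      ι :=
        { app := fun j => (x j).hom
          naturality i j a :=
            (congr_arg PartialDesc.hom (hx i j a)).trans (Category.comp_id _).symm } }
  refine ⟨c.isColimit.desc t, fun γ => ?_⟩
  have h1 : c.incl.app (Order.succ γ.j) ≫ c.isColimit.desc t = (x (Order.succ γ.j)).hom :=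
    c.isColimit.fac t (Order.succ γ.j)
  have h2 := (x (Order.succ γ.j)).prop γ (Order.lt_succ_of_not_isMax γ.hj)
  rwa [← h1, reassoc_of% γ.ιAt_incl] at h2

end RelativeCellComplex

end HomotopicalAlgebra

/-! ### Hill families -/

namespace CategoryTheory.Subobject

variable {A : Type u} [Category.{v} A] [Abelian A]

lemma imageSubobject_le_iff {X Y : A} (f : X ⟶ Y) (s : Subobject Y) :
    imageSubobject f ≤ s ↔ s.Factors f := by
  refine ⟨fun h => factors_of_le f h ?_, fun h => imageSubobject_le f (s.factorThru f h) (by simp)⟩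
  simpa using imageSubobject_factors_comp_self (f := f) (𝟙 X)

variable [IsGrothendieckAbelian.{v} A]

lemma iSup_imageSubobject_factors {X : A} {I : Type*} {B : I → A} (e : ∀ i, B i ⟶ X) (i : I) :
    (⨆ i, imageSubobject (e i)).Factors (e i) :=
  (imageSubobject_le_iff _ _).1 (le_iSup (fun i => imageSubobject (e i)) i)

/-- A morphism from a supremum of images is determined by its values on the images. -/
lemma hom_ext_of_iSup_imageSubobject {X : A} {I : Type*} {B : I → A} (e : ∀ i, B i ⟶ X)
    {s : Subobject X} (hs : s = ⨆ i, imageSubobject (e i))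
    {Z : A} {φ ψ : (s : A) ⟶ Z} (h : ∀ i (f : B i ⟶ (s : A)), f ≫ s.arrow = e i →
      f ≫ φ = f ≫ ψ) : φ = ψ := by
  have hle : s ≤ Subobject.mk ((kernelSubobject (φ - ψ)).arrow ≫ s.arrow) := by
    conv_lhs => rw [hs]
    refine iSup_le fun i => (imageSubobject_le_iff _ _).2 ?_
    have hf : s.Factors (e i) := by rw [hs]; exact iSup_imageSubobject_factors e i
    have hf' : s.factorThru _ hf ≫ (φ - ψ) = 0 := by
      rw [Preadditive.comp_sub, sub_eq_zero]
      exact h i _ (by simp)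
    have hf'' : factorThruKernelSubobject _ _ hf' ≫ (kernelSubobject (φ - ψ)).arrow ≫ s.arrow =
        e i := by
      rw [← Category.assoc, factorThruKernelSubobject_comp_arrow, factorThru_arrow]
    exact (mk_factors_iff _ _).2 ⟨_, hf''⟩
  have h1 : ofLEMk _ _ hle ≫ (kernelSubobject (φ - ψ)).arrow = 𝟙 _ := by
    rw [← cancel_mono s.arrow, Category.assoc, ofLEMk_comp, Category.id_comp]
  rw [← sub_eq_zero, ← Category.id_comp (φ - ψ), ← h1, Category.assoc, kernelSubobject_arrow_comp,
    comp_zero]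

end CategoryTheory.Subobject

namespace HomotopicalAlgebra.RelativeCellComplex

open CategoryTheory.Subobject hiding sSup
open Cardinal CotorsionPair

universe w' t

variable {A : Type u} [Category.{v} A] [Abelian A] [IsGrothendieckAbelian.{v} A]
  {J : Type w'} [LinearOrder J] [OrderBot J] [SuccOrder J] [WellFoundedLT J]
  {α : J → Type t} {K L : (j : J) → α j → A}
  {basicCell : (j : J) → (i : α j) → K j i ⟶ L j i} {X P : A} {f : X ⟶ P}
  (c : RelativeCellComplex.{w} basicCell f)

/-- The subobject which is generated by a set of cells. -/
noncomputable def span (S : Set (Cells c)) : Subobject P := ⨆ γ : S, imageSubobject γ.1.ι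

variable {c}

lemma span_factors {S : Set (Cells c)} {γ : Cells c} (h : γ ∈ S) : (span c S).Factors γ.ι :=
  iSup_imageSubobject_factors (fun γ : S => γ.1.ι) ⟨γ, h⟩

lemma span_le_iff {S : Set (Cells c)} {s : Subobject P} :
    span c S ≤ s ↔ ∀ γ ∈ S, s.Factors γ.ι := by
  simp only [span, iSup_le_iff, imageSubobject_le_iff, Subtype.forall]

lemma span_mono {S S' : Set (Cells c)} (h : S ⊆ S') : span c S ≤ span c S' :=
  span_le_iff.2 fun _ hγ => span_factors (h hγ)

/-- A set of cells is closed if each of its members is attached to the subobject which is generated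
by those of its members which have been attached before. -/
def IsClosed (S : Set (Cells c)) : Prop :=
  ∀ γ ∈ S, (span c {γ' ∈ S | γ'.j < γ.j}).Factors (γ.attach ≫ c.incl.app γ.j)

lemma isClosed_sUnion {T : Set (Set (Cells c))} (hT : ∀ S ∈ T, IsClosed S) : IsClosed (⋃₀ T) := by
  rintro γ ⟨S, hS, hγ⟩
  exact factors_of_le _ (span_mono fun γ' h => ⟨⟨S, hS, h.1⟩, h.2⟩) (hT S hS γ hγ)

lemma span_sUnion (T : Set (Set (Cells c))) : span c (⋃₀ T) = sSup (span c '' T) := by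
  refine le_antisymm (span_le_iff.2 ?_) (sSup_le ?_)
  · rintro γ ⟨S, hS, hγ⟩
    exact factors_of_le _ (le_sSup ⟨S, hS, rfl⟩) (span_factors hγ)
  · rintro _ ⟨S, hS, rfl⟩
    exact span_mono fun γ hγ => ⟨S, hS, hγ⟩

/-- Let `l` be a morphism from a step of the complex, and `u` a morphism from the subobject which is
generated by a closed set `S` of cells. If they agree on the cells of `S` which belong to that step,
then `u` extends `l` to each cell of `S` which is attached to that step. -/
lemma attach_comp_eq (hmono : ∀ j, Mono (c.incl.app j)) {S : Set (Cells c)}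
    (hS : IsClosed S) {γ : Cells c} (hγ : γ ∈ S) {Z : A} (u : (span c S : A) ⟶ Z)
    (l : c.F.obj γ.j ⟶ Z)
    (hl : ∀ (γ' : Cells c) (hγ' : γ' ∈ S) (h : γ'.j < γ.j),
      γ'.ιAt h ≫ l = (span c S).factorThru γ'.ι (span_factors hγ') ≫ u) :
    γ.attach ≫ l = basicCell γ.j γ.i ≫ (span c S).factorThru γ.ι (span_factors hγ) ≫ u := by
  have := hmono γ.j
  let S' : Set (Cells c) := {γ' ∈ S | γ'.j < γ.j}
  have h1 : span c S' ≤ Subobject.mk (c.incl.app γ.j) := span_le_iff.2 fun γ' h' =>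
    (mk_factors_iff _ _).2 ⟨γ'.ιAt h'.2, γ'.ιAt_incl h'.2⟩
  have h2 : span c S' ≤ span c S := span_mono fun _ h => h.1
  have h3 : ofLEMk _ _ h1 ≫ l = ofLE _ _ h2 ≫ u := by
    refine hom_ext_of_iSup_imageSubobject (s := span c S') (fun γ : S' => γ.1.ι) rfl
      fun γ' g hg => ?_
    have h4 : g ≫ ofLEMk _ _ h1 = γ'.1.ιAt γ'.2.2 := by
      rw [← cancel_mono (c.incl.app γ.j), Category.assoc, ofLEMk_comp, hg, γ'.1.ιAt_incl]
    have h5 : g ≫ ofLE _ _ h2 = (span c S).factorThru γ'.1.ι (span_factors γ'.2.1) := by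
      rw [← cancel_mono (span c S).arrow, Category.assoc, ofLE_arrow, hg, factorThru_arrow]
    rw [reassoc_of% h4, reassoc_of% h5]
    exact hl _ γ'.2.1 _
  have h6 : (span c S').factorThru _ (hS γ hγ) ≫ ofLEMk _ _ h1 = γ.attach := by
    rw [← cancel_mono (c.incl.app γ.j), Category.assoc, ofLEMk_comp, factorThru_arrow]
  have h7 : (span c S').factorThru _ (hS γ hγ) ≫ ofLE _ _ h2 =
      basicCell γ.j γ.i ≫ (span c S).factorThru γ.ι (span_factors hγ) := by
    rw [← cancel_mono (span c S).arrow, Category.assoc, ofLE_arrow, factorThru_arrow,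
      Category.assoc, factorThru_arrow, γ.attach_incl]
  rw [← h6, Category.assoc, h3, reassoc_of% h7]

/-- The inclusion of the subobjects which are generated by closed sets of cells has the left
lifting property with respect to `q`, if the cells have it and if the source of `q` is injective. -/
lemma hasLiftingProperty_ofLE_span (hmono : ∀ j, Mono (c.incl.app j))
    (hcell : ∀ γ : Cells c, Mono (basicCell γ.j γ.i)) {E Q : A} (q : E ⟶ Q) [Injective E]
    (hq : ∀ γ : Cells c, HasLiftingProperty (basicCell γ.j γ.i) q)
    {S S' : Set (Cells c)} (hS : IsClosed S) (hS' : IsClosed S') (h : S ⊆ S')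
    (hle : span c S ≤ span c S') : HasLiftingProperty (ofLE _ _ hle) q := by
  refine ⟨fun {u w} sq => ?_⟩
  have hfac (γ : Cells c) (hγ : γ ∈ S) :
      (span c S).factorThru γ.ι (span_factors hγ) ≫ ofLE _ _ hle =
        (span c S').factorThru γ.ι (span_factors (h hγ)) := by
    rw [← cancel_mono (span c S').arrow, Category.assoc, ofLE_arrow, factorThru_arrow,
      factorThru_arrow]
  have hfac' (γ : Cells c) (hγ : γ ∈ S) :
      ((span c S).factorThru γ.ι (span_factors hγ) ≫ u) ≫ q =
        (span c S').factorThru γ.ι (span_factors (h hγ)) ≫ w := by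
    rw [Category.assoc, sq.w, ← Category.assoc, hfac γ hγ]
  obtain ⟨l, hl⟩ := exists_hom (c := c) (Z := E) (fun γ m =>
    (∀ hγ : γ ∈ S, m = (span c S).factorThru γ.ι (span_factors hγ) ≫ u) ∧
    (∀ hγ : γ ∈ S', m ≫ q = (span c S').factorThru γ.ι (span_factors hγ) ≫ w)) 0 (by
      intro γ l
      by_cases hγ : γ ∈ S
      · refine ⟨(span c S).factorThru γ.ι (span_factors hγ) ≫ u, ⟨fun _ => rfl,
          fun _ => hfac' γ hγ⟩, ?_⟩
        exact (attach_comp_eq hmono hS hγ u l.hom fun γ' hγ' h => (l.prop γ' h).1 hγ').symm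
      · by_cases hγ' : γ ∈ S'
        · have sq' : CommSq (γ.attach ≫ l.hom) (basicCell γ.j γ.i) q
              ((span c S').factorThru γ.ι (span_factors hγ') ≫ w) := ⟨by
            rw [Category.assoc]
            refine attach_comp_eq hmono hS' hγ' w (l.hom ≫ q) fun γ'' hγ'' h => ?_
            rw [← (l.prop γ'' h).2 hγ'', Category.assoc]⟩
          have := hq γ
          exact ⟨sq'.lift, ⟨fun h => (hγ h).elim, fun _ => sq'.fac_right⟩, sq'.fac_left⟩
        · have := hcell γ
          exact ⟨Injective.factorThru (γ.attach ≫ l.hom) (basicCell γ.j γ.i),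
            ⟨fun h => (hγ h).elim, fun h => (hγ' h).elim⟩, Injective.comp_factorThru _ _⟩)
  refine ⟨⟨{ l := (span c S').arrow ≫ l, fac_left := ?_, fac_right := ?_ }⟩⟩
  · refine hom_ext_of_iSup_imageSubobject (s := span c S) (fun γ : S => γ.1.ι) rfl
      fun γ g hg => ?_
    have h1 : g = (span c S).factorThru γ.1.ι (span_factors γ.2) := by
      rw [← cancel_mono (span c S).arrow, hg, factorThru_arrow]
    rw [ofLE_arrow_assoc, reassoc_of% hg, (hl γ.1).1 γ.2, h1]
  · refine hom_ext_of_iSup_imageSubobject (s := span c S') (fun γ : S' => γ.1.ι) rfl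
      fun γ g hg => ?_
    have h1 : g = (span c S').factorThru γ.1.ι (span_factors γ.2) := by
      rw [← cancel_mono (span c S').arrow, hg, factorThru_arrow]
    have h2 := (hl γ.1).2 γ.2
    rw [Category.assoc, reassoc_of% hg, ← Category.assoc, h2, h1]

omit [IsGrothendieckAbelian.{v} A] in
lemma incl_comp_eq_zero (hX : IsZero X) {Z : A} (φ : P ⟶ Z) (j : J)
    (hφ : ∀ γ : Cells c, γ.j < j → γ.ι ≫ φ = 0) : c.incl.app j ≫ φ = 0 := by
  have hmap {i j : J} (a : i ⟶ j) : c.F.map a ≫ c.incl.app j = c.incl.app i :=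
    (c.incl.naturality a).trans (Category.comp_id _)
  induction j using SuccOrder.limitRecOn with
  | isMin j hj =>
    obtain rfl := hj.eq_bot
    exact (hX.of_iso c.isoBot).eq_of_src _ _
  | succ j hj hj' =>
    apply (c.attachCells j hj).hom_ext
    · rw [comp_zero, ← Category.assoc, hmap]
      exact hj' fun γ h => hφ γ (h.trans (Order.lt_succ_of_not_isMax hj))
    · intro k
      rw [comp_zero, ← Category.assoc]
      exact hφ ⟨j, hj, k⟩ (Order.lt_succ_of_not_isMax hj)
  | isSuccLimit j hj hj' =>
    refine (c.F.isColimitOfIsWellOrderContinuous j hj).hom_ext fun i => ?_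
    have h : c.F.map (homOfLE i.2.le) ≫ c.incl.app j ≫ φ = c.F.map (homOfLE i.2.le) ≫ 0 := by
      rw [comp_zero, ← Category.assoc, hmap]
      exact hj' i.1 i.2 fun γ h => hφ γ (h.trans i.2)
    exact h

lemma span_lt_factors (hX : IsZero X) (j : J) :
    (span c {γ | γ.j < j}).Factors (c.incl.app j) := by
  rw [factors_iff_comp_cokernel]
  refine incl_comp_eq_zero hX _ j fun γ hγ => ?_
  rw [← factors_iff_comp_cokernel]
  exact span_factors hγ

lemma span_univ (hX : IsZero X) : span c Set.univ = ⊤ := by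
  rw [eq_top_iff]
  refine le_of_factors ?_
  rw [factors_iff_comp_cokernel, (hom_ext c (hX.eq_of_src _ _) fun γ => ?_ :
    cokernel.π (span c Set.univ).arrow = 0), comp_zero]
  rw [comp_zero, ← factors_iff_comp_cokernel]
  exact span_factors (Set.mem_univ γ)

end HomotopicalAlgebra.RelativeCellComplex

namespace CotorsionPair

open CategoryTheory.Subobject hiding sSup
open Cardinal

variable {A : Type u} [Category.{v} A] [Abelian A] [IsGrothendieckAbelian.{v} A]

/-- A set of size at most `θ` is contained in one which is closed under an operation all of whose
values are sets of size at most `θ`. -/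
lemma exists_closed_superset {Γ : Type v} {θ : Cardinal.{v}} (hθ : ℵ₀ ≤ θ) (B : Γ → Set Γ)
    (hB : ∀ γ, #(B γ) ≤ θ) (S₀ : Set Γ) (hS₀ : #S₀ ≤ θ) :
    ∃ S, S₀ ⊆ S ∧ #S ≤ θ ∧ ∀ γ ∈ S, B γ ⊆ S := by
  let S (n : ℕ) : Set Γ := (fun S => S ∪ ⋃ γ : S, B γ)^[n] S₀
  have hsucc (n : ℕ) : S (n + 1) = S n ∪ ⋃ γ : S n, B γ := Function.iterate_succ_apply' _ _ _
  have hS (n : ℕ) : #(S n) ≤ θ := by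
    induction n with
    | zero => exact hS₀
    | succ n ih =>
      rw [hsucc]
      refine (mk_union_le _ _).trans (add_le_of_le hθ ih ?_)
      refine (mk_iUnion_le _).trans ((mul_le_mul' ih (ciSup_le' fun γ : S n => hB γ.1)).trans ?_)
      exact (mul_eq_self hθ).le
  have h0 : S₀ ⊆ S 0 := subset_rfl
  clear_value S
  refine ⟨⋃ n : ULift.{v} ℕ, S n.down, h0.trans <|
    Set.subset_iUnion (fun n : ULift.{v} ℕ => S n.down) ⟨0⟩, ?_, fun γ hγ γ' hγ' => ?_⟩
  · have h1 : #(ULift.{v} ℕ) ≤ θ := mk_le_aleph0.trans hθ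
    have h2 : ⨆ n : ULift.{v} ℕ, #↥(S n.down) ≤ θ := ciSup_le' fun n => hS n.down
    exact (mk_iUnion_le (fun n : ULift.{v} ℕ => S n.down)).trans
      ((mul_le_mul' h1 h2).trans (mul_eq_self hθ).le)
  · obtain ⟨⟨n⟩, hn⟩ := Set.mem_iUnion.1 hγ
    refine Set.mem_iUnion.2 ⟨⟨n + 1⟩, ?_⟩
    dsimp only
    rw [hsucc]
    exact Or.inr (Set.mem_iUnion.2 ⟨⟨γ, hn⟩, hγ'⟩)

/-- A family `H` of subobjects of `X` which is closed under suprema, whose successive quotients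
belong to `^⊥C`, and which is cofinal among the subobjects of size at most `θ`. The condition on
quotients is expressed as a lifting property of the inclusions, see `leftPerp_iff_llp`. -/
structure IsHillFamily (C : ObjectProperty A) (θ : Cardinal.{v}) (G : A) {X : A}
    (H : Set (Subobject X)) : Prop where
  sSup_mem {K : Set (Subobject X)} (hK : K ⊆ H) : sSup K ∈ H
  llp {h h' : Subobject X} (hh : h ∈ H) (hh' : h' ∈ H) (hle : h ≤ h') :
    (injQuots C).llp (ofLE h h' hle)
  exists_le {s : Subobject X} (hs : IsBounded θ G (s : A)) :
    ∃ h ∈ H, IsBounded θ G (h : A) ∧ s ≤ h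

lemma IsHillFamily.sup_mem {C : ObjectProperty A} {θ : Cardinal.{v}} {G : A} {X : A}
    {H : Set (Subobject X)} (hH : IsHillFamily C θ G H) {h h' : Subobject X} (hh : h ∈ H)
    (hh' : h' ∈ H) : h ⊔ h' ∈ H := by
  rw [← sSup_pair]
  exact hH.sSup_mem (by rintro _ (rfl | rfl) <;> assumption)

lemma IsHillFamily.iSup_mem {C : ObjectProperty A} {θ : Cardinal.{v}} {G : A} {X : A}
    {H : Set (Subobject X)} (hH : IsHillFamily C θ G H) {I : Type*} {h : I → Subobject X}
    (hh : ∀ i, h i ∈ H) : ⨆ i, h i ∈ H :=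
  hH.sSup_mem (by rintro _ ⟨i, rfl⟩; exact hh i)

/-- The closed sets of cells of a cell complex yield a Hill family. -/
lemma isHillFamily_of_relativeCellComplex {C : ObjectProperty A} {θ : Cardinal.{v}} {G : A}
    (hθ : IsAdmissible θ G) {I : MorphismProperty A} (hI : I ≤ MorphismProperty.monomorphisms A)
    (hI' : I ≤ (injQuots C).llp) (hIs : ∀ ⦃X Y : A⦄ (i : X ⟶ Y), I i → IsBounded θ G X)
    (hIt : ∀ ⦃X Y : A⦄ (i : X ⟶ Y), I i → IsBounded θ G Y) {J : Type v} [LinearOrder J]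
    [OrderBot J] [SuccOrder J] [WellFoundedLT J] {Z P : A} (hZ : IsZero Z) {f : Z ⟶ P}
    (c : HomotopicalAlgebra.RelativeCellComplex.{v} (fun _ : J => I.homFamily) f) :
    IsHillFamily C θ G (c.span '' {S | HomotopicalAlgebra.RelativeCellComplex.IsClosed S}) where
  sSup_mem {K} hK := by
    refine ⟨⋃₀ {S | HomotopicalAlgebra.RelativeCellComplex.IsClosed S ∧ c.span S ∈ K},
      HomotopicalAlgebra.RelativeCellComplex.isClosed_sUnion fun S hS => hS.1, ?_⟩
    rw [HomotopicalAlgebra.RelativeCellComplex.span_sUnion]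
    congr 1
    ext s
    refine ⟨?_, fun hs => ?_⟩
    · rintro ⟨S, hS, rfl⟩
      exact hS.2
    · obtain ⟨S, hS, rfl⟩ := hK hs
      exact ⟨S, ⟨hS, hs⟩, rfl⟩
  llp {h h'} hh hh' hle := by
    obtain ⟨S, hS, rfl⟩ := hh
    obtain ⟨S', hS', rfl⟩ := hh'
    -- `S` need not be contained in `S'`, but `S'` may be replaced by the union of both
    have h1 : c.span (⋃₀ {S, S'}) = c.span S' := by
      rw [HomotopicalAlgebra.RelativeCellComplex.span_sUnion, Set.image_pair, sSup_pair,
        sup_eq_right.2 hle]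
    have h2 : HomotopicalAlgebra.RelativeCellComplex.IsClosed (c := c) (⋃₀ {S, S'}) :=
      HomotopicalAlgebra.RelativeCellComplex.isClosed_sUnion
        (by rintro _ (rfl | rfl) <;> assumption)
    refine (injQuots_llp_iff _).2 fun Y hY => ?_
    have hmono (j : J) : Mono (c.incl.app j) := (monoTransfiniteComposition hI c).mem_incl_app j
    have key : ∀ s (hs : s = c.span S') (hle : c.span S ≤ s),
        HasLiftingProperty (ofLE _ _ hle) (injQuot Y) := by
      rintro _ hs hle
      obtain rfl := hs.trans h1.symm
      exact HomotopicalAlgebra.RelativeCellComplex.hasLiftingProperty_ofLE_span hmono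
        (fun γ => hI _ γ.i.2) _ (fun γ => (injQuots_llp_iff _).1 (hI' _ γ.i.2) Y hY) hS h2
        (Set.subset_sUnion_of_mem (by simp)) hle
    exact key _ rfl hle
  exists_le {s} hs := by
    let Γ := HomotopicalAlgebra.RelativeCellComplex.Cells c
    have hcell (γ : Γ) : IsBounded θ G (imageSubobject γ.ι : A) :=
      hθ.isBounded_of_epi (hIt _ γ.i.2) (factorThruImageSubobject γ.ι)
    have hatt (γ : Γ) : ∃ B : Set Γ, #B ≤ θ ∧ B ⊆ {γ' | γ'.j < γ.j} ∧
        (c.span B).Factors (γ.attach ≫ c.incl.app γ.j) := by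
      obtain ⟨B, hB, hle⟩ := hθ.exists_le_iSup (I := {γ' : Γ | γ'.j < γ.j})
        (fun γ' => imageSubobject γ'.1.ι)
        (hθ.isBounded_of_epi (hIs _ γ.i.2)
          (factorThruImageSubobject (γ.attach ≫ c.incl.app γ.j)))
        ((imageSubobject_le_iff _ _).2 (factors_of_factors_right _
          (HomotopicalAlgebra.RelativeCellComplex.span_lt_factors hZ γ.j)))
      refine ⟨Subtype.val '' B, mk_image_le.trans hB, by rintro _ ⟨γ', -, rfl⟩; exact γ'.2, ?_⟩
      refine factors_of_le _ (iSup_le fun γ' => ?_) ((imageSubobject_le_iff _ _).1 hle)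
      exact (imageSubobject_le_iff _ _).2
        (HomotopicalAlgebra.RelativeCellComplex.span_factors ⟨_, γ'.2, rfl⟩)
    choose B hB hB' hB'' using hatt
    obtain ⟨S₀, hS₀, hs'⟩ := hθ.exists_le_iSup (fun γ : Γ => imageSubobject γ.ι) hs (by
      have h := HomotopicalAlgebra.RelativeCellComplex.span_univ (c := c) hZ
      have h' : (⨆ γ : Γ, imageSubobject γ.ι) = ⊤ := by
        rw [← h]
        exact le_antisymm (iSup_le fun γ => le_iSup (fun γ : (Set.univ : Set Γ) =>
          imageSubobject γ.1.ι) ⟨γ, trivial⟩) (iSup_le fun γ => le_iSup (fun γ : Γ =>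
          imageSubobject γ.ι) γ.1)
      rw [h']
      exact le_top)
    obtain ⟨S, hS₀S, hS, hBS⟩ := exists_closed_superset hθ.aleph0_le B hB S₀ hS₀
    refine ⟨c.span S, ⟨_, fun γ hγ => ?_, rfl⟩, ?_, ?_⟩
    · exact factors_of_le _ (HomotopicalAlgebra.RelativeCellComplex.span_mono
        fun γ' hγ' => ⟨hBS γ hγ hγ', hB' γ hγ'⟩) (hB'' γ)
    · exact hθ.isBounded_iSup hS _ fun γ => hcell γ
    · exact hs'.trans (HomotopicalAlgebra.RelativeCellComplex.span_mono hS₀S)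

/-- Hill families are inherited by direct summands. -/
lemma IsHillFamily.of_retract {C : ObjectProperty A} {θ : Cardinal.{v}} {G : A}
    (hθ : IsAdmissible θ G) {P : A} {H : Set (Subobject P)} (hH : IsHillFamily C θ G H) {X : A}
    (i : X ⟶ P) (r : P ⟶ X) (hir : i ≫ r = 𝟙 X) :
    IsHillFamily C θ G
      {s : Subobject X |
        ∃ h ∈ H, (Subobject.exists i).obj s ≤ h ∧ (Subobject.exists r).obj h ≤ s} where
  sSup_mem {K} hK := by
    refine ⟨sSup {h ∈ H | (Subobject.exists r).obj h ≤ sSup K},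
      hH.sSup_mem fun h hh => hh.1, ?_, ?_⟩
    · rw [exists_le_iff]
      refine sSup_le fun s hs => (exists_le_iff _ _ _).1 ?_
      obtain ⟨h, hh, h1, h2⟩ := hK hs
      exact h1.trans (le_sSup ⟨hh, h2.trans (le_sSup hs)⟩)
    · rw [exists_le_iff]
      exact sSup_le fun h hh => (exists_le_iff _ _ _).1 hh.2
  llp {s s'} hs hs' hle := by
    obtain ⟨h, hh, h1, h2⟩ := hs
    obtain ⟨h', hh', h1', h2'⟩ := hs'
    have h3 : (Subobject.exists r).obj (h ⊔ h') ≤ s' := by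
      rw [exists_le_iff]
      exact sup_le ((exists_le_iff _ _ _).1 (h2.trans hle)) ((exists_le_iff _ _ _).1 h2')
    have h4 := h1'.trans (le_sup_right : h' ≤ h ⊔ h')
    rw [exists_le_iff] at h1 h2 h3 h4
    have hi {s : Subobject X} {h : Subobject P} (hle : s ≤ (Subobject.pullback i).obj h) :
        h.Factors (s.arrow ≫ i) :=
      (pullback_factors_iff _ _ _).1 (factors_of_le _ hle (factors_self s))
    have hr {s : Subobject X} {h : Subobject P} (hle : h ≤ (Subobject.pullback r).obj s) :
        s.Factors (h.arrow ≫ r) :=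
      (pullback_factors_iff _ _ _).1 (factors_of_le _ hle (factors_self h))
    let R : RetractArrow (ofLE s s' hle) (ofLE h (h ⊔ h') le_sup_left) :=
      { i := Arrow.homMk (h.factorThru _ (hi h1)) ((h ⊔ h').factorThru _ (hi h4)) (by
          rw [← cancel_mono (h ⊔ h').arrow]; simp)
        r := Arrow.homMk (s.factorThru _ (hr h2)) (s'.factorThru _ (hr h3)) (by
          rw [← cancel_mono s'.arrow]; simp)
        retract := by
          ext
          · simp [← cancel_mono s.arrow, hir]
          · simp [← cancel_mono s'.arrow, hir] }
    exact MorphismProperty.of_retract R (hH.llp hh (hH.sup_mem hh hh') le_sup_left)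
  exists_le {s} hs := by
    choose φ hφ hφ' hφ'' using fun t : {t : Subobject P // IsBounded θ G (t : A)} =>
      hH.exists_le t.2
    let φ' (t : {t : Subobject P // IsBounded θ G (t : A)}) :
      {t : Subobject P // IsBounded θ G (t : A)} := ⟨φ t, hφ' t⟩
    let g (t : {t : Subobject P // IsBounded θ G (t : A)}) :
      {t : Subobject P // IsBounded θ G (t : A)} :=
      ⟨(Subobject.exists i).obj ((Subobject.exists r).obj t.1),
        hθ.isBounded_exists i (hθ.isBounded_exists r t.2)⟩
    -- `t` alternates between enlarging a subobject to a member of `H` and applying `r ≫ i`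
    let t (n : ℕ) : {t : Subobject P // IsBounded θ G (t : A)} :=
      n.rec (φ' ⟨_, hθ.isBounded_exists i hs⟩) fun _ t => φ' (g t)
    have ht (n : ℕ) : (t n).1 ∈ H := by
      cases n <;> exact hφ _
    have h0 : (Subobject.exists i).obj s ≤ (t 0).1 := hφ'' ⟨_, hθ.isBounded_exists i hs⟩
    have hsucc (n : ℕ) :
        (Subobject.exists i).obj ((Subobject.exists r).obj (t n).1) ≤ (t (n + 1)).1 :=
      hφ'' (g (t n))
    refine ⟨⨆ n, (Subobject.exists r).obj (t n).1, ⟨⨆ n, (t n).1, hH.iSup_mem ht, ?_, ?_⟩, ?_, ?_⟩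
    · rw [exists_iSup]
      exact iSup_le fun n => (hsucc n).trans (le_iSup (fun n => (t n).1) (n + 1))
    · rw [exists_iSup]
    · exact hθ.isBounded_iSup_countable _ fun n => hθ.isBounded_exists r (t n).2
    · have h1 : s ≤ (Subobject.exists r).obj (Subobject.exists i |>.obj s) := by
        refine le_of_factors ?_
        have := ((factors_self s).exists_comp i).exists_comp r
        rwa [Category.assoc, hir, Category.comp_id] at this
      exact (h1.trans ((Subobject.exists r).monotone h0)).trans
        (le_iSup (fun n => (Subobject.exists r).obj (t n).1) 0)

/-- The objects of the left-hand class of a cotorsion pair have Hill families, since they are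
retracts of cell complexes. -/
theorem exists_isHillFamily (T : ObjectProperty A) [ObjectProperty.Small.{v} T] {θ : Cardinal.{v}}
    {G : A} (hθ : IsAdmissible θ G) (hT : ∀ t, T t → #(G ⟶ t) ≤ θ)
    (hG : leftPerp (rightPerp T) G) {X : A} (hX : leftPerp (rightPerp T) X) :
    ∃ H : Set (Subobject X), IsHillFamily (rightPerp T) θ G H := by
  obtain ⟨J, _, _, _, _, P, i, p, c, -, hp, hp'⟩ :=
    exists_relativeCellComplex T hθ.isSeparator (0 : 0 ⟶ X)
  obtain ⟨l, hl⟩ := (hX _ hp').exists_lift (shortExact_kernel p) (𝟙 X)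
  have hs (t : A) (ht : T t) (S : Set (G ⟶ t)) : IsBounded θ G (∐ fun _ : S => G) :=
    hθ.isBounded_sigma _ ((mk_set_le S).trans (hT t ht))
  have hGG : IsBounded θ G G := by
    have := hθ.isBounded_sigma PUnit.{v + 1} (by simpa using one_le_aleph0.trans hθ.aleph0_le)
    exact this.of_mono (Sigma.ι (fun _ : PUnit.{v + 1} => G) ⟨⟩)
  have h1 : cells T G ≤ fun X _ _ => IsBounded θ G X := cells_le_iff.2
    ⟨hGG.of_mono 0, fun t ht S _ => (hs t ht S).of_mono (kernel.ι _)⟩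
  have h2 : cells T G ≤ fun _ Y _ => IsBounded θ G Y := cells_le_iff.2
    ⟨hGG, fun t ht S _ => hs t ht S⟩
  exact ⟨_, (isHillFamily_of_relativeCellComplex hθ (cells_le_monomorphisms T G) (cells_le_llp hG)
    (fun _ _ i => h1 i) (fun _ _ i => h2 i) (isZero_zero A) c).of_retract hθ l p hl⟩

end CotorsionPair

/-! ### Objects of bounded size are presentable -/

namespace CotorsionPair

open CategoryTheory.Subobject Cardinal

variable {A : Type u} [Category.{v} A] [Abelian A] [IsGrothendieckAbelian.{v} A]

/-- Every epimorphism onto a bounded object is an epimorphism on some bounded subobject. -/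
lemma IsAdmissible.exists_epi_of_isBounded {θ : Cardinal.{v}} {G : A} (hθ : IsAdmissible θ G)
    {X Y : A} (hX : IsBounded θ G X) (p : Y ⟶ X) [Epi p] :
    ∃ s : Subobject Y, IsBounded θ G (s : A) ∧ Epi (s.arrow ≫ p) := by
  obtain ⟨s, hs, hle⟩ := hθ.exists_isBounded_le_exists p (t := ⊤)
    (hX.of_mono (⊤ : Subobject X).arrow)
  refine ⟨s, hs, Preadditive.epi_of_cokernel_zero ?_⟩
  have h1 : (Subobject.exists p).obj s ≤ kernelSubobject (cokernel.π (s.arrow ≫ p)) := by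
    rw [exists_le_iff]
    refine le_of_factors ((pullback_factors_iff _ _ _).2 ((kernelSubobject_factors_iff _ _).2 ?_))
    exact cokernel.condition _
  have h2 := factors_of_le (𝟙 X) (hle.trans h1) (top_factors _)
  rwa [kernelSubobject_factors_iff, Category.id_comp] at h2

section

variable {θ : Cardinal.{v}} {G : A} {κ : Cardinal.{v}} [Fact κ.IsRegular]
  {J : Type v} [SmallCategory J] [IsCardinalFiltered J κ] {Y : J ⥤ A} {c : Cocone Y}

/-- A morphism from a bounded object to a stage of a `κ`-filtered diagram which vanishes in the
colimit vanishes at some later stage. -/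
lemma IsBounded.exists_comp_map_eq_zero (hθ : IsAdmissible θ G) (hκ : θ < κ) (hc : IsColimit c)
    {X : A} (hX : IsBounded θ G X) {j : J} (y : X ⟶ Y.obj j) (hy : y ≫ c.ι.app j = 0) :
    ∃ (k : J) (φ : j ⟶ k), y ≫ Y.map φ = 0 := by
  have hG : HasCardinalLT (Subobject G) κ := by
    rw [← hasCardinalLT_iff_of_equiv (equivShrink.{v} (Subobject G)).symm,
      hasCardinalLT_iff_cardinal_mk_lt]
    exact hθ.card_subobject_le.trans_lt hκ
  choose k φ h using fun g : G ⟶ X =>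
    IsGrothendieckAbelian.IsPresentable.injectivity₀ hc hG (g ≫ y) (by simp [hy])
  obtain ⟨m, a, b, hab⟩ := IsCardinalFiltered.wideSpan (κ := κ) φ
    ((hasCardinalLT_iff_cardinal_mk_lt _ _).2 (hX.trans_lt hκ))
  refine ⟨m, b, hθ.isSeparator.def _ _ fun g => ?_⟩
  rw [← hab g, comp_zero, Y.map_comp, ← Category.assoc, ← Category.assoc, h, zero_comp]

lemma iSup_imageSubobject_ι_eq_top (hc : IsColimit c) :
    ⨆ j, imageSubobject (c.ι.app j) = ⊤ := by
  rw [eq_top_iff]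
  refine le_of_factors ?_
  rw [factors_iff_comp_cokernel,
    (hc.hom_ext fun j => ?_ : cokernel.π (⨆ j, imageSubobject (c.ι.app j)).arrow = 0), comp_zero]
  rw [comp_zero, ← factors_iff_comp_cokernel]
  exact iSup_imageSubobject_factors (fun j => c.ι.app j) j

/-- A morphism from a bounded object to a `κ`-filtered colimit factors through some stage: it lifts
to a stage on a bounded cover, and the kernel of the cover is killed at a later stage. -/
lemma IsBounded.exists_fac (hθ : IsAdmissible θ G) (hκ : θ < κ) (hc : IsColimit c)
    {X : A} (hX : IsBounded θ G X) (f : X ⟶ c.pt) :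
    ∃ (k : J) (y : X ⟶ Y.obj k), y ≫ c.ι.app k = f := by
  obtain ⟨B, hB, hle⟩ := hθ.exists_le_iSup (fun j => imageSubobject (c.ι.app j))
    (t := imageSubobject f) (hθ.isBounded_of_epi hX (factorThruImageSubobject f))
    (by rw [iSup_imageSubobject_ι_eq_top hc]; exact le_top)
  -- the few stages which are needed to cover the image of `f` are dominated by a single one
  let j := IsCardinalFiltered.max (κ := κ) (fun i : B => i.1)
    ((hasCardinalLT_iff_cardinal_mk_lt _ _).2 (hB.trans_lt hκ))
  have hf : (imageSubobject (c.ι.app j)).Factors f := by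
    refine (imageSubobject_le_iff _ _).1 (hle.trans (iSup_le fun i => ?_))
    rw [imageSubobject_le_iff, ← c.w (IsCardinalFiltered.toMax (κ := κ) (fun i : B => i.1)
      ((hasCardinalLT_iff_cardinal_mk_lt _ _).2 (hB.trans_lt hκ)) i)]
    exact factors_of_factors_right _ ((imageSubobject_le_iff _ _).1 le_rfl)
  let q := factorThruImageSubobject (c.ι.app j)
  let f' := (imageSubobject (c.ι.app j)).factorThru f hf
  let p := pullback.fst f' q
  have hp : Epi p := inferInstance
  obtain ⟨s, hs, hsp⟩ := hθ.exists_epi_of_isBounded hX p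
  have hy : (s.arrow ≫ pullback.snd f' q) ≫ c.ι.app j = (s.arrow ≫ p) ≫ f := by
    have h1 : q ≫ (imageSubobject (c.ι.app j)).arrow = c.ι.app j :=
      imageSubobject_arrow_comp _
    have h2 : f' ≫ (imageSubobject (c.ι.app j)).arrow = f := factorThru_arrow _ _ _
    have h3 : p ≫ f' = pullback.snd f' q ≫ q := pullback.condition
    calc _ = s.arrow ≫ (pullback.snd f' q ≫ q) ≫ (imageSubobject (c.ι.app j)).arrow := by
          rw [Category.assoc, Category.assoc, h1]
      _ = _ := by rw [← h3, Category.assoc, h2, Category.assoc]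
  obtain ⟨k, φ, hφ⟩ := (hs.of_mono (kernel.ι (s.arrow ≫ p))).exists_comp_map_eq_zero hθ hκ hc
    (kernel.ι (s.arrow ≫ p) ≫ s.arrow ≫ pullback.snd f' q)
    (by rw [Category.assoc, hy, kernel.condition_assoc, zero_comp])
  rw [Category.assoc] at hφ
  have hex := (shortExact_kernel (s.arrow ≫ p)).exact
  refine ⟨k, hex.desc _ hφ, ?_⟩
  rw [← cancel_epi (s.arrow ≫ p)]
  have h := hex.g_desc _ hφ
  dsimp only at h
  rw [← Category.assoc, h, Category.assoc, c.w, ← hy, Category.assoc]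

end

/-- An object of size at most `θ` is `κ`-presentable if `θ < κ`. -/
theorem IsBounded.isCardinalPresentable {θ : Cardinal.{v}} {G : A} (hθ : IsAdmissible θ G)
    {κ : Cardinal.{v}} [Fact κ.IsRegular] (hκ : θ < κ) {X : A} (hX : IsBounded θ G X) :
    IsCardinalPresentable X κ where
  preservesColimitOfShape J _ _ := ⟨fun {Y} => ⟨fun {c} hc => ⟨by
    have := isFiltered_of_isCardinalFiltered J κ
    refine Types.FilteredColimit.isColimitOf' _ _ (fun f => ?_) fun j (y y' : X ⟶ Y.obj j) h => ?_
    · obtain ⟨k, y, hy⟩ := hX.exists_fac hθ hκ hc f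
      exact ⟨k, y, hy.symm⟩
    · have h' : (y - y') ≫ c.ι.app j = 0 := by
        rw [Preadditive.sub_comp, sub_eq_zero]
        exact h
      obtain ⟨k, φ, hφ⟩ := hX.exists_comp_map_eq_zero hθ hκ hc (y - y') h'
      rw [Preadditive.sub_comp, sub_eq_zero] at hφ
      exact ⟨k, φ, hφ⟩⟩⟩⟩

end CotorsionPair

/-! ### Vanishing of `Ext¹` and adjunctions -/

namespace CotorsionPair

section

variable {A : Type u} [Category.{v} A] [Abelian A]

/-- `Ext¹(X, Z)` vanishes if all extensions of `X` by `Z` split. -/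
lemma extOneVanishes_of_exists_retraction [CategoryTheory.EnoughInjectives A] {X Z : A}
    (h : ∀ (E : A) (i : Z ⟶ E) (p : E ⟶ X) (w : i ≫ p = 0),
      (ShortComplex.mk i p w).ShortExact → ∃ r : E ⟶ Z, i ≫ r = 𝟙 Z) :
    ExtOneVanishes X Z := by
  have hS := shortExact_cokernel (Injective.ι Z)
  refine extOneVanishes_of_exists_lift
    (S := ShortComplex.mk (Injective.ι Z) (cokernel.π (Injective.ι Z)) (by simp)) hS fun g => ?_
  let i : Z ⟶ pullback (cokernel.π (Injective.ι Z)) g := pullback.lift (Injective.ι Z) 0 (by simp)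
  have hi : i ≫ pullback.fst _ _ = Injective.ι Z := pullback.lift_fst _ _ _
  have hi' : i ≫ pullback.snd _ _ = 0 := pullback.lift_snd _ _ _
  have : Mono i := mono_of_mono_fac hi
  have hE : (ShortComplex.mk i (pullback.snd (cokernel.π (Injective.ι Z)) g) hi').ShortExact :=
    { exact := ShortComplex.exact_of_f_is_kernel _ (KernelFork.IsLimit.ofι' i hi' fun k hk => by
        have hk' : (k ≫ pullback.fst _ _) ≫ cokernel.π (Injective.ι Z) = 0 := by
          rw [Category.assoc, pullback.condition, reassoc_of% hk, zero_comp]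
        refine ⟨hS.exact.lift (k ≫ pullback.fst _ _) hk', pullback.hom_ext ?_ ?_⟩
        · rw [Category.assoc, hi]
          exact hS.exact.lift_f _ hk'
        · rw [Category.assoc, hi', comp_zero, hk])
      mono_f := inferInstanceAs (Mono i)
      epi_g := inferInstanceAs (Epi (pullback.snd _ _)) }
  obtain ⟨r, hr⟩ := h _ _ _ _ hE
  have hr' : i ≫ (𝟙 _ - r ≫ i) = 0 := by simp [reassoc_of% hr]
  have := hE.epi_g
  have hs := hE.exact.g_desc _ hr'
  refine ⟨hE.exact.desc _ hr' ≫ pullback.fst _ _, ?_⟩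
  have h1 : pullback.snd (cokernel.π (Injective.ι Z)) g ≫ hE.exact.desc _ hr' = 𝟙 _ - r ≫ i := hs
  have h2 : Epi (pullback.snd (cokernel.π (Injective.ι Z)) g) := hE.epi_g
  change (_ ≫ _) ≫ cokernel.π (Injective.ι Z) = _
  rw [← cancel_epi (pullback.snd (cokernel.π (Injective.ι Z)) g), Category.assoc,
    reassoc_of% h1, pullback.condition]
  simp [reassoc_of% hi']

lemma extOneVanishes_of_shortExact {X : A} {S : ShortComplex A} (hS : S.ShortExact)
    (h₁ : ExtOneVanishes X S.X₁) (h₃ : ExtOneVanishes X S.X₃) : ExtOneVanishes X S.X₂ := by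
  let := HasExt.standard A
  have : Subsingleton (Abelian.Ext X S.X₁ 1) := h₁
  have : Subsingleton (Abelian.Ext X S.X₃ 1) := h₃
  change Subsingleton (Abelian.Ext X S.X₂ 1)
  refine ⟨fun x y => ?_⟩
  suffices ∀ x : Abelian.Ext X S.X₂ 1, x = 0 by rw [this x, this y]
  intro x
  obtain ⟨y, rfl⟩ := Abelian.Ext.covariant_sequence_exact₂ X hS x (Subsingleton.elim _ _)
  rw [Subsingleton.elim y 0, Abelian.Ext.zero_comp]

lemma extOneVanishes_of_shortExact' {Y : A} {S : ShortComplex A} (hS : S.ShortExact)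
    (h₁ : ExtOneVanishes S.X₁ Y) (h₃ : ExtOneVanishes S.X₃ Y) : ExtOneVanishes S.X₂ Y := by
  let := HasExt.standard A
  have : Subsingleton (Abelian.Ext S.X₁ Y 1) := h₁
  have : Subsingleton (Abelian.Ext S.X₃ Y 1) := h₃
  change Subsingleton (Abelian.Ext S.X₂ Y 1)
  refine ⟨fun x y => ?_⟩
  suffices ∀ x : Abelian.Ext S.X₂ Y 1, x = 0 by rw [this x, this y]
  intro x
  obtain ⟨y, rfl⟩ := Abelian.Ext.contravariant_sequence_exact₂ hS Y x (Subsingleton.elim _ _)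
  rw [Subsingleton.elim y 0, Abelian.Ext.comp_zero]

lemma extOneVanishes_of_injective (X I : A) [Injective I] : ExtOneVanishes X I := by
  let := HasExt.standard A
  exact ⟨fun x y => (Abelian.Ext.eq_zero_of_injective x).trans
    (Abelian.Ext.eq_zero_of_injective y).symm⟩

lemma extOneVanishes_of_isZero_left {X : A} (hX : IsZero X) (Y : A) : ExtOneVanishes X Y := by
  let := HasExt.standard A
  refine ⟨fun x y => ?_⟩
  rw [← Abelian.Ext.mk₀_id_comp x, ← Abelian.Ext.mk₀_id_comp y, hX.eq_of_src (𝟙 X) 0,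
    Abelian.Ext.mk₀_zero, Abelian.Ext.zero_comp, Abelian.Ext.zero_comp]

lemma extOneVanishes_of_isZero_right (X : A) {Y : A} (hY : IsZero Y) : ExtOneVanishes X Y := by
  let := HasExt.standard A
  refine ⟨fun x y => ?_⟩
  rw [← Abelian.Ext.comp_mk₀_id x, ← Abelian.Ext.comp_mk₀_id y, hY.eq_of_src (𝟙 Y) 0,
    Abelian.Ext.mk₀_zero, Abelian.Ext.comp_zero, Abelian.Ext.comp_zero]

end

section

universe v' u'

variable {A : Type u} [Category.{v} A] [Abelian A] {B : Type u'} [Category.{v'} B] [Abelian B]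
  {L : A ⥤ B} {R : B ⥤ A} (adj : L ⊣ R)

include adj

/-- A left adjoint preserves the vanishing of `Ext¹` in its first argument. The right adjoint need
not be exact: one short exact sequence with an injective middle term has to stay exact. -/
lemma ExtOneVanishes.leftAdjoint {X : A} {S : ShortComplex B} (hS : S.ShortExact)
    [Injective S.X₂] [R.PreservesZeroMorphisms] (hRS : (S.map R).ShortExact)
    (h : ExtOneVanishes X (R.obj S.X₁)) : ExtOneVanishes (L.obj X) S.X₁ :=
  extOneVanishes_of_exists_lift hS fun g => by
    obtain ⟨l, hl⟩ : ∃ l : X ⟶ R.obj S.X₂, l ≫ R.map S.g = adj.homEquiv _ _ g :=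
      ExtOneVanishes.exists_lift hRS h (adj.homEquiv _ _ g)
    refine ⟨(adj.homEquiv _ _).symm l, (adj.homEquiv _ _).injective ?_⟩
    rw [Adjunction.homEquiv_naturality_right, Equiv.apply_symm_apply, hl]

/-- The converse of `ExtOneVanishes.leftAdjoint`. The left adjoint need not be exact: the extensions
of `X` have to stay exact. -/
lemma ExtOneVanishes.rightAdjoint [CategoryTheory.EnoughInjectives A] {X : A} {Y : B}
    [L.PreservesZeroMorphisms]
    (hL : ∀ (S : ShortComplex A), S.ShortExact → S.X₃ = X → (S.map L).ShortExact)
    (h : ExtOneVanishes (L.obj X) Y) : ExtOneVanishes X (R.obj Y) :=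
  extOneVanishes_of_exists_retraction fun E i p w hE => by
    obtain ⟨e, he⟩ : ∃ e : L.obj E ⟶ Y, L.map i ≫ e = adj.counit.app Y :=
      ExtOneVanishes.exists_extension (hL _ hE rfl) h (adj.counit.app Y)
    refine ⟨adj.homEquiv _ _ e, ?_⟩
    rw [← Adjunction.homEquiv_naturality_left]
    refine (congrArg (adj.homEquiv _ _) he).trans ?_
    simp [Adjunction.homEquiv_unit]

lemma ExtOneVanishes.leftAdjoint_of_exact [CategoryTheory.EnoughInjectives B] {X : A} {Y : B}
    [R.PreservesZeroMorphisms] [PreservesFiniteColimits R] (h : ExtOneVanishes X (R.obj Y)) :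
    ExtOneVanishes (L.obj X) Y := by
  have := adj.rightAdjoint_preservesLimits
  exact ExtOneVanishes.leftAdjoint adj
    (S := ShortComplex.mk (Injective.ι Y) (cokernel.π (Injective.ι Y)) (by simp))
    (shortExact_cokernel (Injective.ι Y))
    ((shortExact_cokernel (Injective.ι Y)).map_of_exact R) h

lemma ExtOneVanishes.rightAdjoint_of_exact [CategoryTheory.EnoughInjectives A] {X : A} {Y : B}
    [L.PreservesZeroMorphisms] [PreservesFiniteLimits L] (h : ExtOneVanishes (L.obj X) Y) :
    ExtOneVanishes X (R.obj Y) := by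
  have := adj.leftAdjoint_preservesColimits
  exact ExtOneVanishes.rightAdjoint adj (fun S hS _ => hS.map_of_exact L) h

end

end CotorsionPair

/-! ### Spheres, disks, cycles and opcycles -/

namespace CochainComplex

variable {A : Type u} [Category.{v} A] [Abelian A]

variable (A) in
/-- The complex concentrated in degree `n`. -/
noncomputable abbrev sphere (n : ℤ) : A ⥤ CochainComplex A ℤ :=
  HomologicalComplex.single A (ComplexShape.up ℤ) n

open HomologicalComplex

/-- Morphisms from a sphere are morphisms to the cycles. -/
noncomputable def sphereHomEquiv (n : ℤ) (X : A) (Y : CochainComplex A ℤ) :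
    ((sphere A n).obj X ⟶ Y) ≃ (X ⟶ Y.cycles n) where
  toFun f := Y.liftCycles ((singleObjXSelf (ComplexShape.up ℤ) n X).inv ≫ f.f n) (n + 1)
    (by simp) (by rw [Category.assoc, f.comm, single_obj_d, zero_comp, comp_zero])
  invFun g := mkHomFromSingle (g ≫ Y.iCycles n) (fun k _ => by simp)
  left_inv f := by
    apply from_single_hom_ext
    rw [mkHomFromSingle_f, liftCycles_i, Iso.hom_inv_id_assoc]
  right_inv g := by
    rw [← cancel_mono (Y.iCycles n), liftCycles_i, mkHomFromSingle_f, Iso.inv_hom_id_assoc]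

lemma sphereHomEquiv_symm_f {n : ℤ} {X : A} {Y : CochainComplex A ℤ} (g : X ⟶ Y.cycles n) :
    ((sphereHomEquiv n X Y).symm g).f n =
      (singleObjXSelf (ComplexShape.up ℤ) n X).hom ≫ g ≫ Y.iCycles n :=
  (mkHomFromSingle_f (g ≫ Y.iCycles n) (fun k _ => by simp)).trans rfl

lemma sphereHomEquiv_iCycles {n : ℤ} {X : A} {Y : CochainComplex A ℤ}
    (f : (sphere A n).obj X ⟶ Y) : sphereHomEquiv n X Y f ≫ Y.iCycles n =
      (singleObjXSelf (ComplexShape.up ℤ) n X).inv ≫ f.f n :=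
  liftCycles_i _ _ (n + 1) (by simp)
    (by rw [Category.assoc, f.comm, single_obj_d, zero_comp, comp_zero])

lemma sphereHomEquiv_symm_naturality_left {n : ℤ} {X X' : A} {Y : CochainComplex A ℤ}
    (f : X ⟶ X') (g : X' ⟶ Y.cycles n) : (sphereHomEquiv n X Y).symm (f ≫ g) =
      (sphere A n).map f ≫ (sphereHomEquiv n X' Y).symm g := by
  apply from_single_hom_ext
  rw [comp_f, single_map_f_self, sphereHomEquiv_symm_f, sphereHomEquiv_symm_f]
  simp

lemma sphereHomEquiv_naturality_right {n : ℤ} {X : A} {Y Y' : CochainComplex A ℤ}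
    (f : (sphere A n).obj X ⟶ Y) (g : Y ⟶ Y') : sphereHomEquiv n X Y' (f ≫ g) =
      sphereHomEquiv n X Y f ≫ cyclesMap g n := by
  rw [← cancel_mono (Y'.iCycles n), sphereHomEquiv_iCycles, Category.assoc, cyclesMap_i,
    reassoc_of% sphereHomEquiv_iCycles f, comp_f]

variable (A) in
/-- The sphere functor is left adjoint to the cycles functor. -/
noncomputable def sphereAdjCycles (n : ℤ) :
    sphere A n ⊣ cyclesFunctor A (ComplexShape.up ℤ) n :=
  Adjunction.mkOfHomEquiv
    { homEquiv := sphereHomEquiv n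
      homEquiv_naturality_left_symm := sphereHomEquiv_symm_naturality_left
      homEquiv_naturality_right := sphereHomEquiv_naturality_right }

/-- Morphisms to a sphere are morphisms from the opcycles. -/
noncomputable def homSphereEquiv (n : ℤ) (X : CochainComplex A ℤ) (Y : A) :
    (X.opcycles n ⟶ Y) ≃ (X ⟶ (sphere A n).obj Y) where
  toFun g := mkHomToSingle (X.pOpcycles n ≫ g) (fun k _ => by simp)
  invFun f := X.descOpcycles (f.f n ≫ (singleObjXSelf (ComplexShape.up ℤ) n Y).hom) (n - 1)
    (by simp) (by rw [← f.comm_assoc, single_obj_d, zero_comp, comp_zero])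
  left_inv g := by
    rw [← cancel_epi (X.pOpcycles n), p_descOpcycles, mkHomToSingle_f, Category.assoc,
      Category.assoc, Iso.inv_hom_id, Category.comp_id]
  right_inv f := by
    apply to_single_hom_ext
    rw [mkHomToSingle_f, p_descOpcycles, Category.assoc, Iso.hom_inv_id, Category.comp_id]

lemma homSphereEquiv_f {n : ℤ} {X : CochainComplex A ℤ} {Y : A} (g : X.opcycles n ⟶ Y) :
    (homSphereEquiv n X Y g).f n =
      X.pOpcycles n ≫ g ≫ (singleObjXSelf (ComplexShape.up ℤ) n Y).inv :=
  (mkHomToSingle_f (X.pOpcycles n ≫ g) (fun k _ => by simp)).trans (Category.assoc _ _ _)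

lemma homSphereEquiv_symm_naturality_left {n : ℤ} {X X' : CochainComplex A ℤ} {Y : A}
    (f : X ⟶ X') (g : X' ⟶ (sphere A n).obj Y) : (homSphereEquiv n X Y).symm (f ≫ g) =
      opcyclesMap f n ≫ (homSphereEquiv n X' Y).symm g := by
  rw [← cancel_epi (X.pOpcycles n)]
  simp [homSphereEquiv]

lemma homSphereEquiv_naturality_right {n : ℤ} {X : CochainComplex A ℤ} {Y Y' : A}
    (f : X.opcycles n ⟶ Y) (g : Y ⟶ Y') : homSphereEquiv n X Y' (f ≫ g) =
      homSphereEquiv n X Y f ≫ (sphere A n).map g := by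
  apply to_single_hom_ext
  rw [comp_f, single_map_f_self, homSphereEquiv_f, homSphereEquiv_f]
  simp

variable (A) in
/-- The sphere functor is right adjoint to the opcycles functor. -/
noncomputable def opcyclesAdjSphere (n : ℤ) :
    opcyclesFunctor A (ComplexShape.up ℤ) n ⊣ sphere A n :=
  Adjunction.mkOfHomEquiv
    { homEquiv := homSphereEquiv n
      homEquiv_naturality_left_symm := homSphereEquiv_symm_naturality_left
      homEquiv_naturality_right := homSphereEquiv_naturality_right }

instance (n : ℤ) : PreservesFiniteColimits (sphere A n) :=
  have := (sphereAdjCycles.{v, u} A n).leftAdjoint_preservesColimits.{0, 0}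
  ⟨fun _ => inferInstance⟩

instance (n : ℤ) : PreservesFiniteLimits (sphere A n) :=
  have := (opcyclesAdjSphere.{v, u} A n).rightAdjoint_preservesLimits.{0, 0}
  ⟨fun _ => inferInstance⟩

/-- The complex with `X` in degrees `n` and `n + 1`, with the identity as differential. -/
noncomputable def diskObj (n : ℤ) (X : A) : CochainComplex A ℤ :=
  double (c := ComplexShape.up ℤ) (𝟙 X) (i₀ := n) (i₁ := n + 1) rfl

/-- The term of a disk in its lower degree. -/
noncomputable def diskXIso₀ (n : ℤ) (X : A) : (diskObj n X).X n ≅ X := doubleXIso₀ _ _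

/-- The term of a disk in its upper degree. -/
noncomputable def diskXIso₁ (n : ℤ) (X : A) : (diskObj n X).X (n + 1) ≅ X :=
  doubleXIso₁ _ _ (by simp)

lemma diskObj_d (n : ℤ) (X : A) :
    (diskObj n X).d n (n + 1) = (diskXIso₀ n X).hom ≫ (diskXIso₁ n X).inv :=
  (double_d (c := ComplexShape.up ℤ) (𝟙 X) (i₀ := n) (i₁ := n + 1) rfl (by simp)).trans
    (congrArg (_ ≫ ·) (Category.id_comp _))

open scoped Classical in
/-- The morphism to a disk induced by a morphism in degree `n + 1`. -/
noncomputable def toDisk {n : ℤ} {X : CochainComplex A ℤ} {Y : A} (g : X.X (n + 1) ⟶ Y) :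
    X ⟶ diskObj n Y where
  f k := if h : k = n then (XIsoOfEq X h).hom ≫ X.d n (n + 1) ≫ g ≫
      (diskXIso₀ n Y).inv ≫ (XIsoOfEq (diskObj n Y) h).inv
    else if h' : k = n + 1 then (XIsoOfEq X h').hom ≫ g ≫
      (diskXIso₁ n Y).inv ≫ (XIsoOfEq (diskObj n Y) h').inv
    else 0
  comm' i j hij := by
    obtain rfl : i + 1 = j := hij
    by_cases h : i = n
    · subst h
      simp [diskObj_d]
    · rw [show (diskObj n Y).d i (i + 1) = 0 from double_d_eq_zero₀ _ _ _ _ h, comp_zero]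
      by_cases h' : i + 1 = n
      · subst h'
        simp
      · rw [dif_neg h', dif_neg (by lia), comp_zero]

lemma toDisk_f₀ {n : ℤ} {X : CochainComplex A ℤ} {Y : A} (g : X.X (n + 1) ⟶ Y) :
    (toDisk g).f n = X.d n (n + 1) ≫ g ≫ (diskXIso₀ n Y).inv := by
  simp [toDisk]

lemma toDisk_f₁ {n : ℤ} {X : CochainComplex A ℤ} {Y : A} (g : X.X (n + 1) ⟶ Y) :
    (toDisk g).f (n + 1) = g ≫ (diskXIso₁ n Y).inv := by
  simp [toDisk]

lemma to_disk_hom_ext {n : ℤ} {X : CochainComplex A ℤ} {Y : A} {f g : X ⟶ diskObj n Y}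
    (h : f.f (n + 1) = g.f (n + 1)) : f = g := by
  apply to_double_hom_ext _ h
  have := f.comm n (n + 1)
  rw [h, ← g.comm n (n + 1), diskObj_d, ← Category.assoc, ← Category.assoc, cancel_mono,
    cancel_mono] at this
  exact this

/-- Morphisms to a disk. -/
noncomputable def homDiskEquiv (n : ℤ) (X : CochainComplex A ℤ) (Y : A) :
    (X.X (n + 1) ⟶ Y) ≃ (X ⟶ diskObj n Y) where
  toFun g := toDisk g
  invFun f := f.f (n + 1) ≫ (diskXIso₁ n Y).hom
  left_inv g := by simp [toDisk_f₁]
  right_inv f := to_disk_hom_ext (by simp [toDisk_f₁])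

variable (A) in
/-- The disk functor. -/
noncomputable def disk (n : ℤ) : A ⥤ CochainComplex A ℤ where
  obj := diskObj n
  map {X Y} f := toDisk ((diskXIso₁ n X).hom ≫ f)
  map_id X := to_disk_hom_ext (by simp [toDisk_f₁])
  map_comp f g := to_disk_hom_ext (by simp [toDisk_f₁])

lemma homDiskEquiv_symm_naturality_left {n : ℤ} {X X' : CochainComplex A ℤ} {Y : A}
    (f : X ⟶ X') (g : X' ⟶ diskObj n Y) : (homDiskEquiv n X Y).symm (f ≫ g) =
      f.f (n + 1) ≫ (homDiskEquiv n X' Y).symm g := by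
  simp [homDiskEquiv]

lemma homDiskEquiv_naturality_right {n : ℤ} {X : CochainComplex A ℤ} {Y Y' : A}
    (f : X.X (n + 1) ⟶ Y) (g : Y ⟶ Y') : homDiskEquiv n X Y' (f ≫ g) =
      homDiskEquiv n X Y f ≫ toDisk ((diskXIso₁ n Y).hom ≫ g) :=
  to_disk_hom_ext (by simp [homDiskEquiv, toDisk_f₁])

variable (A) in
/-- The disk functor is right adjoint to the evaluation. -/
noncomputable def evalAdjDisk (n : ℤ) : eval A (ComplexShape.up ℤ) (n + 1) ⊣ disk A n :=
  Adjunction.mkOfHomEquiv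
    { homEquiv := homDiskEquiv n
      homEquiv_naturality_left_symm := homDiskEquiv_symm_naturality_left
      homEquiv_naturality_right := homDiskEquiv_naturality_right }

/-- Morphisms from a disk. -/
noncomputable def diskHomEquiv (n : ℤ) (X : A) (Y : CochainComplex A ℤ) :
    (diskObj n X ⟶ Y) ≃ (X ⟶ Y.X n) :=
  (evalCompCoyonedaCorepresentableByDoubleId (C := A) (c := ComplexShape.up ℤ) (i₀ := n)
    (i₁ := n + 1) rfl (by simp) X).homEquiv

lemma diskHomEquiv_apply {n : ℤ} {X : A} {Y : CochainComplex A ℤ} (f : diskObj n X ⟶ Y) :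
    diskHomEquiv n X Y f = (diskXIso₀ n X).inv ≫ f.f n := rfl

lemma diskHomEquiv_symm_naturality_left {n : ℤ} {X X' : A} {Y : CochainComplex A ℤ}
    (f : X ⟶ X') (g : X' ⟶ Y.X n) : (diskHomEquiv n X Y).symm (f ≫ g) =
      toDisk ((diskXIso₁ n X).hom ≫ f) ≫ (diskHomEquiv n X' Y).symm g := by
  obtain ⟨g, rfl⟩ := (diskHomEquiv n X' Y).surjective g
  rw [Equiv.symm_apply_apply, Equiv.symm_apply_eq, diskHomEquiv_apply, diskHomEquiv_apply, comp_f,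
    toDisk_f₀, diskObj_d]
  simp

lemma diskHomEquiv_naturality_right {n : ℤ} {X : A} {Y Y' : CochainComplex A ℤ}
    (f : diskObj n X ⟶ Y) (g : Y ⟶ Y') : diskHomEquiv n X Y' (f ≫ g) =
      diskHomEquiv n X Y f ≫ g.f n := by
  simp [diskHomEquiv_apply]

variable (A) in
/-- The disk functor is left adjoint to the evaluation. -/
noncomputable def diskAdjEval (n : ℤ) : disk A n ⊣ eval A (ComplexShape.up ℤ) n :=
  Adjunction.mkOfHomEquiv
    { homEquiv := diskHomEquiv n
      homEquiv_naturality_left_symm := diskHomEquiv_symm_naturality_left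
      homEquiv_naturality_right := diskHomEquiv_naturality_right }

instance (n : ℤ) : PreservesFiniteColimits (disk A n) :=
  have := (diskAdjEval.{v, u} A n).leftAdjoint_preservesColimits.{0, 0}
  ⟨fun _ => inferInstance⟩

instance (n : ℤ) : PreservesFiniteLimits (disk A n) :=
  have := (evalAdjDisk.{v, u} A n).rightAdjoint_preservesLimits.{0, 0}
  ⟨fun _ => inferInstance⟩

end CochainComplex

/-! ### Vanishing of `Ext¹` for complexes and the total Hom complex -/

namespace CochainComplex

variable {A : Type u} [Category.{v} A] [Abelian A]

open HomologicalComplex HomComplex CotorsionPair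

lemma homComplex_acyclic_iff (X Y : CochainComplex A ℤ) :
    (HomComplex X Y).Acyclic ↔ ∀ (m n : ℤ) (_ : m + 1 = n) (z : Cocycle X Y n),
      ∃ w : Cochain X Y m, δ m n w = z.1 := by
  have key (n : ℤ) : (HomComplex X Y).ExactAt n ↔ ∀ z : Cocycle X Y n,
      CohomologyClass.mk z = 0 := by
    rw [exactAt_iff_isZero_homology]
    constructor
    · intro h z
      have : Subsingleton ((HomComplex X Y).homology n) := AddCommGrpCat.subsingleton_of_isZero h
      exact (homologyAddEquiv X Y n).symm.injective (Subsingleton.elim _ _)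
    · intro h
      have : Subsingleton ((HomComplex X Y).homology n) :=
        ⟨fun a b => (homologyAddEquiv X Y n).injective (by
          obtain ⟨a', ha⟩ := CohomologyClass.mk_surjective (homologyAddEquiv X Y n a)
          obtain ⟨b', hb⟩ := CohomologyClass.mk_surjective (homologyAddEquiv X Y n b)
          rw [← ha, ← hb, h, h])⟩
      exact AddCommGrpCat.isZero_of_subsingleton _
  constructor
  · intro h m n hmn z
    exact (mem_coboundaries_iff z m hmn).1
      ((CohomologyClass.mk_eq_zero_iff z).1 ((key n).1 (h n) z))
  · intro h n
    exact (key n).2 fun z => (CohomologyClass.mk_eq_zero_iff z).2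
      ((mem_coboundaries_iff z (n - 1) (by simp)).2 (h _ _ (by simp) z))

/-- The mapping cone of `𝟙 Y` is contractible, so a `1`-cocycle that lifts to it is a coboundary. -/
lemma exists_δ_eq_of_extOneVanishes {X Y : CochainComplex A ℤ} (h : ExtOneVanishes X Y)
    (z : Cocycle X Y 1) : ∃ w : Cochain X Y 0, δ 0 1 w = z.1 := by
  have hS : (mappingCone.triangleRotateShortComplex (𝟙 Y)).ShortExact :=
    shortExact_of_degreewise_shortExact _ fun n =>
      (mappingCone.triangleRotateShortComplexSplitting (𝟙 Y) n).shortExact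
  obtain ⟨l, hl⟩ : ∃ l : X ⟶ mappingCone (𝟙 Y), l ≫ (mappingCone.triangle (𝟙 Y)).mor₃ =
      Cocycle.homOf (z.rightShift 1 0 (zero_add 1)) :=
    ExtOneVanishes.exists_lift hS h _
  refine ⟨(Cochain.ofHom l).comp (mappingCone.snd (𝟙 Y)) (zero_add 0), ?_⟩
  rw [δ_ofHom_comp, mappingCone.δ_snd]
  ext p q hpq
  obtain rfl : p + 1 = q := hpq
  have h₁ : l.f p ≫ (mappingCone.triangle (𝟙 Y)).mor₃.f p =
      (Cocycle.homOf (z.rightShift 1 0 (zero_add 1))).f p := congrArg (fun f => f.f p) hl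
  have h₂ : (mappingCone.triangle (𝟙 Y)).mor₃.f p =
      -(mappingCone.fst (𝟙 Y)).1.v p (p + 1) rfl := by
    simp [mappingCone.triangle,
      Cochain.rightShift_v _ 1 0 (zero_add 1) p p (add_zero p) (p + 1) rfl]
    erw [Category.comp_id]
    rfl
  have h₃ : (Cocycle.homOf (z.rightShift 1 0 (zero_add 1))).f p = z.1.v p (p + 1) rfl := by
    simp [Cochain.rightShift_v _ 1 0 (zero_add 1) p p (add_zero p) (p + 1) rfl]
    erw [Category.comp_id]
  rw [h₂, h₃] at h₁
  rw [← h₁]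
  simp only [Cochain.zero_cochain_comp_v, Cochain.ofHom_v, Cochain.neg_v, Cochain.comp_id]
  rfl

lemma exists_δ_eq_of_extOneVanishes_shift_right {X Y : CochainComplex A ℤ} {m n : ℤ}
    (hmn : m + 1 = n) (h : ExtOneVanishes X (Y⟦m⟧)) (z : Cocycle X Y n) :
    ∃ w : Cochain X Y m, δ m n w = z.1 := by
  obtain ⟨w, hw⟩ := exists_δ_eq_of_extOneVanishes h (z.rightShift m 1 (by lia))
  refine ⟨m.negOnePow • w.rightUnshift m (zero_add m), ?_⟩
  rw [δ_units_smul, Cochain.δ_rightUnshift w m (zero_add m) n 1 (by lia), hw, smul_smul,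
    Int.units_mul_self, one_smul, Cocycle.rightShift_coe, Cochain.rightUnshift_rightShift]

lemma exists_δ_eq_of_extOneVanishes_shift_left {X Y : CochainComplex A ℤ} {m n : ℤ}
    (hmn : m + 1 = n) (h : ExtOneVanishes (X⟦-m⟧) Y) (z : Cocycle X Y n) :
    ∃ w : Cochain X Y m, δ m n w = z.1 := by
  obtain ⟨w, hw⟩ := exists_δ_eq_of_extOneVanishes h (z.leftShift (-m) 1 (by lia))
  refine ⟨(-m).negOnePow • w.leftUnshift m (by lia), ?_⟩
  rw [δ_units_smul, Cochain.δ_leftUnshift w m (by lia) n 1 (by lia), hw, smul_smul,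
    Int.units_mul_self, one_smul, Cocycle.leftShift_coe, Cochain.leftUnshift_leftShift]

/-- A degreewise lift of `g` fails to be a chain map by a `1`-cocycle with values in `Y`; if this is
a coboundary, the lift can be corrected. -/
lemma exists_lift_of_exists_δ_eq {X Y I Q : CochainComplex A ℤ} {i : Y ⟶ I} {π : I ⟶ Q}
    {w : i ≫ π = 0} (hS : (ShortComplex.mk i π w).ShortExact)
    (hXY : ∀ n, ExtOneVanishes (X.X n) (Y.X n))
    (h : ∀ z : Cocycle X Y 1, ∃ w : Cochain X Y 0, δ 0 1 w = z.1) (g : X ⟶ Q) :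
    ∃ l : X ⟶ I, l ≫ π = g := by
  have hn := (shortExact_iff_degreewise_shortExact _).1 hS
  have hi (n : ℤ) : Mono (i.f n) := (hn n).mono_f
  have hw (n : ℤ) : i.f n ≫ π.f n = 0 := by rw [← comp_f, w, zero_f]
  have hex (n : ℤ) {T : A} (k : T ⟶ I.X n) (hk : k ≫ π.f n = 0) : ∃ k', k' ≫ i.f n = k :=
    have := (hn n).mono_f
    ⟨(hn n).exact.lift k hk, (hn n).exact.lift_f k hk⟩
  obtain ⟨l, hl⟩ : ∃ l : ∀ n, X.X n ⟶ I.X n, ∀ n, l n ≫ π.f n = g.f n :=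
    ⟨_, fun n => (ExtOneVanishes.exists_lift (hn n) (hXY n) (g.f n)).choose_spec⟩
  have hl' : (Cochain.ofHoms l).comp (Cochain.ofHom π) (add_zero 0) = Cochain.ofHom g := by
    ext n
    simp [hl]
  have hδ : (δ 0 1 (Cochain.ofHoms l)).comp (Cochain.ofHom π) (add_zero 1) = 0 := by
    rw [← δ_comp_ofHom, hl', δ_ofHom]
  have hz' (p q : ℤ) (hpq : p + 1 = q) :
      ∃ k, k ≫ i.f q = (δ 0 1 (Cochain.ofHoms l)).v p q hpq := by
    refine hex q _ ?_
    simpa using Cochain.congr_v hδ p q hpq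
  choose z hz using hz'
  let z' : Cochain X Y 1 := Cochain.mk z
  have hz' : z'.comp (Cochain.ofHom i) (add_zero 1) = δ 0 1 (Cochain.ofHoms l) := by
    ext p q hpq
    simp [z', hz]
  have hz'' : δ 1 2 z' = 0 := by
    have : (δ 1 2 z').comp (Cochain.ofHom i) (add_zero 2) = 0 := by
      rw [← δ_comp_ofHom, hz', δ_δ]
    ext p q hpq
    rw [← cancel_mono (i.f q)]
    simpa using Cochain.congr_v this p q hpq
  obtain ⟨b, hb⟩ := h (Cocycle.mk z' 2 rfl hz'')
  have hb' : δ 0 1 b = z' := hb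
  let c : Cocycle X I 0 := Cocycle.mk
    (Cochain.ofHoms l - b.comp (Cochain.ofHom i) (add_zero 0)) 1 rfl (by
      rw [δ_sub, δ_comp_ofHom, hb', hz', sub_self])
  refine ⟨Cocycle.homOf c, ?_⟩
  ext n
  simp [c, hl, hw]

/-- If the extensions of `X` by `Y` split degreewise, they are classified by the `1`-cocycles of
the total Hom complex modulo coboundaries. -/
lemma extOneVanishes_of_exists_δ_eq [CategoryTheory.EnoughInjectives (CochainComplex A ℤ)]
    {X Y : CochainComplex A ℤ} (hXY : ∀ n, ExtOneVanishes (X.X n) (Y.X n))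
    (h : ∀ z : Cocycle X Y 1, ∃ w : Cochain X Y 0, δ 0 1 w = z.1) : ExtOneVanishes X Y :=
  extOneVanishes_of_exists_lift (S := ShortComplex.mk (Injective.ι Y)
    (cokernel.π (Injective.ι Y)) (by simp)) (shortExact_cokernel (Injective.ι Y))
    (exists_lift_of_exists_δ_eq (shortExact_cokernel (Injective.ι Y)) hXY h)

end CochainComplex

/-! ### Cycles and opcycles of acyclic complexes -/

namespace CochainComplex

variable {A : Type u} [Category.{v} A] [Abelian A]

open HomologicalComplex HomComplex

lemma exactAt_iff_epi_toCycles (Y : CochainComplex A ℤ) {m n : ℤ} (hmn : m + 1 = n) :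
    Y.ExactAt n ↔ Epi (Y.toCycles m n) := by
  obtain rfl : m = n - 1 := by lia
  have hc := Y.homologyIsCokernel (n - 1) n (by simp)
  rw [exactAt_iff_isZero_homology]
  refine ⟨fun h => Preadditive.epi_of_isZero_cokernel' _ hc h, fun h => ?_⟩
  rw [IsZero.iff_id_eq_zero, ← cancel_epi (Y.homologyπ n), ← cancel_epi (Y.toCycles (n - 1) n)]
  simp

lemma exactAt_iff_mono_fromOpcycles (Y : CochainComplex A ℤ) {n m : ℤ} (hnm : n + 1 = m) :
    Y.ExactAt n ↔ Mono (Y.fromOpcycles n m) := by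
  obtain rfl := hnm
  have hc := Y.homologyIsKernel n (n + 1) (by simp)
  rw [exactAt_iff_isZero_homology]
  refine ⟨fun h => Preadditive.mono_of_isZero_kernel' _ hc h, fun h => ?_⟩
  rw [IsZero.iff_id_eq_zero, ← cancel_mono (Y.homologyι n),
    ← cancel_mono (Y.fromOpcycles n (n + 1))]
  simp

lemma iCycles_toCycles (Y : CochainComplex A ℤ) (n m : ℤ) : Y.iCycles n ≫ Y.toCycles n m = 0 := by
  rw [← cancel_mono (Y.iCycles m), Category.assoc, toCycles_i, iCycles_d, zero_comp]

lemma toCycles_cyclesMap {X Y : CochainComplex A ℤ} (f : X ⟶ Y) (m n : ℤ) :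
    X.toCycles m n ≫ cyclesMap f n = f.f m ≫ Y.toCycles m n := by
  rw [← cancel_mono (Y.iCycles n)]
  simp

lemma opcyclesMap_fromOpcycles {X Y : CochainComplex A ℤ} (f : X ⟶ Y) (m n : ℤ) :
    opcyclesMap f m ≫ Y.fromOpcycles m n = X.fromOpcycles m n ≫ f.f n := by
  rw [← cancel_epi (X.pOpcycles m)]
  simp

lemma shortExact_cycles {Y : CochainComplex A ℤ} {n m : ℤ} (hnm : n + 1 = m) (h : Y.ExactAt m) :
    (ShortComplex.mk (Y.iCycles n) (Y.toCycles n m) (Y.iCycles_toCycles n m)).ShortExact where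
  exact := ShortComplex.exact_of_f_is_kernel _ (KernelFork.IsLimit.ofι' _ _ fun k hk =>
    ⟨Y.liftCycles k m (by simp [hnm]) (by rw [← Y.toCycles_i, reassoc_of% hk, zero_comp]), by simp⟩)
  mono_f := inferInstanceAs (Mono (Y.iCycles n))
  epi_g := (exactAt_iff_epi_toCycles Y hnm).1 h

/-- The opcycles in degree `n` of an acyclic complex are the cycles in degree `n + 1`. -/
noncomputable def opcyclesIsoCycles {Y : CochainComplex A ℤ} (h : Y.Acyclic) {n m : ℤ}
    (hnm : n + 1 = m) : Y.opcycles n ≅ Y.cycles m :=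
  have := (exactAt_iff_mono_fromOpcycles Y hnm).1 (h n)
  have := (exactAt_iff_epi_toCycles Y hnm).1 (h m)
  have := mono_of_mono_fac (Y.opcyclesToCycles_iCycles n m)
  have := epi_of_epi_fac (Y.pOpcycles_opcyclesToCycles n m)
  have := isIso_of_mono_of_epi (Y.opcyclesToCycles n m)
  asIso (Y.opcyclesToCycles n m)

/-- The cycles functor is exact on short exact sequences which start with an acyclic complex. -/
lemma shortExact_map_cyclesFunctor {S : ShortComplex (CochainComplex A ℤ)} (hS : S.ShortExact)
    (h : S.X₁.Acyclic) (n : ℤ) :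
    (S.map (cyclesFunctor A (ComplexShape.up ℤ) n)).ShortExact := by
  have := hS.mono_f
  have := hS.epi_g
  have hepi : Epi (homologyMap S.g n) :=
    (hS.homology_exact₃ n (n + 1) rfl).epi_f (((h (n + 1)).isZero_homology).eq_of_tgt _ _)
  have hepi' : Epi (S.g.f (n - 1)) := inferInstance
  exact
    { exact := HomologicalComplex.cycles_left_exact S hS.exact n
      mono_f := inferInstanceAs (Mono (cyclesMap S.f n))
      epi_g := by
        change Epi (cyclesMap S.g n)
        rw [Preadditive.epi_iff_cancel_zero]
        intro T t ht
        have h1 : S.X₃.toCycles (n - 1) n ≫ t = 0 := by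
          rw [← cancel_epi (S.g.f (n - 1)), comp_zero, ← reassoc_of% toCycles_cyclesMap S.g,
            ht, comp_zero]
        let hc := S.X₃.homologyIsCokernel (n - 1) n (by simp)
        obtain ⟨k, hk⟩ := CokernelCofork.IsColimit.desc' hc t h1
        have hk' : S.X₃.homologyπ n ≫ k = t := hk
        have h2 : k = 0 := by
          rw [← cancel_epi (homologyMap S.g n), ← cancel_epi (S.X₂.homologyπ n),
            homologyπ_naturality_assoc, hk', ht, comp_zero, comp_zero]
        rw [← hk', h2, comp_zero] }

/-- The opcycles functor is exact on short exact sequences which end with an acyclic complex. -/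
lemma shortExact_map_opcyclesFunctor {S : ShortComplex (CochainComplex A ℤ)} (hS : S.ShortExact)
    (h : S.X₃.Acyclic) (n : ℤ) :
    (S.map (opcyclesFunctor A (ComplexShape.up ℤ) n)).ShortExact := by
  have := hS.mono_f
  have := hS.epi_g
  have hmono : Mono (homologyMap S.f n) :=
    (hS.homology_exact₁ (n - 1) n (by simp)).mono_g (((h (n - 1)).isZero_homology).eq_of_src _ _)
  have hmono' : Mono (S.f.f (n + 1)) := inferInstance
  exact
    { exact := HomologicalComplex.opcycles_right_exact S hS.exact n
      epi_g := inferInstanceAs (Epi (opcyclesMap S.g n))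
      mono_f := by
        change Mono (opcyclesMap S.f n)
        rw [Preadditive.mono_iff_cancel_zero]
        intro T t ht
        have h1 : t ≫ S.X₁.fromOpcycles n (n + 1) = 0 := by
          rw [← cancel_mono (S.f.f (n + 1)), zero_comp, Category.assoc,
            ← opcyclesMap_fromOpcycles S.f, reassoc_of% ht, zero_comp]
        let hc := S.X₁.homologyIsKernel n (n + 1) (by simp)
        obtain ⟨k, hk⟩ := KernelFork.IsLimit.lift' hc t h1
        have hk' : k ≫ S.X₁.homologyι n = t := hk
        have h2 : k = 0 := by
          rw [← cancel_mono (homologyMap S.f n), ← cancel_mono (S.X₂.homologyι n), Category.assoc,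
            homologyι_naturality, reassoc_of% hk', ht, zero_comp, zero_comp]
        rw [← hk', h2, zero_comp] }

end CochainComplex

/-! ### The induced cotorsion pairs -/

namespace CotorsionPair

variable {A : Type u} [Category.{v} A] [Abelian A]

open HomologicalComplex CochainComplex HomComplex

/-- The spheres on the objects of `P`. -/
def spheres (P : ObjectProperty A) : ObjectProperty (Ch A) :=
  ObjectProperty.ofObj fun p : ℤ × Subtype P => (sphere A p.1).obj p.2.1

lemma spheres_le_iff {P : ObjectProperty A} {Q : ObjectProperty (Ch A)} :
    spheres P ≤ Q ↔ ∀ (n : ℤ) (B : A), P B → Q ((sphere A n).obj B) := by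
  refine ⟨fun h n B hB => h _ (ObjectProperty.ofObj_apply _ (⟨n, ⟨B, hB⟩⟩ : ℤ × Subtype P)), ?_⟩
  rintro h _ ⟨n, B, hB⟩
  exact h n B hB

instance (P : ObjectProperty A) [ObjectProperty.Small.{w} P] :
    ObjectProperty.Small.{w} (spheres P) :=
  inferInstanceAs (ObjectProperty.Small.{w} (ObjectProperty.ofObj _))

lemma rightPerp_spheres_iff {P : ObjectProperty A} {Y : Ch A} :
    rightPerp (spheres P) Y ↔ ∀ (n : ℤ) (B : A), P B → ExtOneVanishes ((sphere A n).obj B) Y :=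
  spheres_le_iff (Q := fun X => ExtOneVanishes X Y)

lemma leftPerp_spheres_iff {P : ObjectProperty A} {X : Ch A} :
    leftPerp (spheres P) X ↔ ∀ (n : ℤ) (B : A), P B → ExtOneVanishes X ((sphere A n).obj B) :=
  spheres_le_iff (Q := fun Y => ExtOneVanishes X Y)

/-- The shift of a sphere is a sphere. -/
noncomputable def sphereShiftIso (B : A) {k a a' : ℤ} (h : k + a = a') :
    ((sphere A a').obj B)⟦k⟧ ≅ (sphere A a).obj B :=
  ((singleFunctors A).shiftIso k a a' h).app B

/-- Each `G ⟶ Z^n Y` lifts to `Y^{n-1}`, as the corresponding morphism from a sphere to `Y` is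
null-homotopic. -/
lemma acyclic_of_extOneVanishes_sphere_left {G : A} (hG : IsSeparator G) {Y : Ch A}
    (h : ∀ n, ExtOneVanishes ((sphere A n).obj G) Y) : Y.Acyclic := by
  intro n
  rw [exactAt_iff_epi_toCycles Y (sub_add_cancel n 1)]
  refine epi_of_forall_exists_lift hG _ (𝟙 _) fun g _ => ?_
  let f := (sphereHomEquiv n G Y).symm g
  have hf : f.f n = _ := sphereHomEquiv_symm_f g
  obtain ⟨w, hw⟩ := exists_δ_eq_of_extOneVanishes_shift_left (m := -1) (n := 0) (by simp)
    ((h (n - 1)).of_iso_left (sphereShiftIso G (by lia : -(-1) + (n - 1) = n)).symm)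
    (Cocycle.ofHom f)
  have hw' := Cochain.congr_v hw n n (add_zero n)
  rw [δ_v (-1) 0 (by simp) w n n (add_zero n) (n - 1) (n + 1) rfl rfl, single_obj_d, zero_comp,
    smul_zero, add_zero] at hw'
  have hw'' : w.v n (n - 1) rfl ≫ Y.d (n - 1) n = f.f n :=
    hw'.trans (by simp)
  refine ⟨(singleObjXSelf (ComplexShape.up ℤ) n G).inv ≫ w.v n (n - 1) rfl, ?_⟩
  rw [← cancel_mono (Y.iCycles n), Category.assoc, Category.assoc, toCycles_i, hw'', hf,
    Iso.inv_hom_id_assoc]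

/-- The embedding of the opcycles of `X` into an injective object factors through the next term of
`X`, as the corresponding morphism from `X` to a sphere is null-homotopic. -/
lemma acyclic_of_extOneVanishes_sphere_right [CategoryTheory.EnoughInjectives A] {X : Ch A}
    (h : ∀ (n : ℤ) (I : A) [Injective I], ExtOneVanishes X ((sphere A n).obj I)) : X.Acyclic := by
  intro n
  rw [exactAt_iff_mono_fromOpcycles X rfl]
  let f := homSphereEquiv n X _ (Injective.ι (X.opcycles n))
  have hf : f.f n = _ := homSphereEquiv_f (Injective.ι (X.opcycles n))
  obtain ⟨w, hw⟩ := exists_δ_eq_of_extOneVanishes_shift_right (m := -1) (n := 0) (by simp)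
    ((h (n + 1) _).of_iso_right (sphereShiftIso (Injective.under (X.opcycles n))
      (by lia : -1 + (n + 1) = n)).symm)
    (Cocycle.ofHom f)
  have hw' := Cochain.congr_v hw n n (add_zero n)
  rw [δ_v (-1) 0 (by simp) w n n (add_zero n) (n - 1) (n + 1) rfl rfl, single_obj_d, comp_zero,
    zero_add] at hw'
  have hw'' : X.d n (n + 1) ≫ w.v (n + 1) n (by lia) = f.f n := by
    simpa using hw'
  have := mono_comp (Injective.ι (X.opcycles n))
    (singleObjXSelf (ComplexShape.up ℤ) n (Injective.under (X.opcycles n))).inv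
  have hfac : X.fromOpcycles n (n + 1) ≫ w.v (n + 1) n (by lia) = Injective.ι (X.opcycles n) ≫
      (singleObjXSelf (ComplexShape.up ℤ) n (Injective.under (X.opcycles n))).inv := by
    rw [← cancel_epi (X.pOpcycles n), p_fromOpcycles_assoc, hw'', hf]
  rw [← hfac] at this
  exact mono_of_mono _ (w.v (n + 1) n _)

lemma isCotorsionPair_rightPerp (P : ObjectProperty A) :
    IsCotorsionPair (leftPerp (rightPerp P)) (rightPerp P) where
  left_eq := rfl
  right_eq := le_antisymm (fun _ hY _ hX => hX _ hY) fun _ hY _ hX => hY _ fun _ hZ => hZ _ hX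

lemma isCotorsionPair_leftPerp (P : ObjectProperty A) :
    IsCotorsionPair (leftPerp P) (rightPerp (leftPerp P)) where
  left_eq := le_antisymm (fun _ hX _ hY => hY _ hX) fun _ hX _ hY => hX _ fun _ hZ => hZ _ hY
  right_eq := rfl

section

variable [CategoryTheory.EnoughInjectives A] [CategoryTheory.EnoughInjectives (Ch A)]

lemma extOneVanishes_sphere_left_iff {Y : Ch A} (hY : Y.Acyclic) (n : ℤ) (B : A) :
    ExtOneVanishes ((sphere A n).obj B) Y ↔ ExtOneVanishes B (Y.cycles n) :=
  ⟨fun h => ExtOneVanishes.rightAdjoint_of_exact (sphereAdjCycles A n) h, fun h =>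
    ExtOneVanishes.leftAdjoint (sphereAdjCycles A n)
      (S := ShortComplex.mk (Injective.ι Y) (cokernel.π (Injective.ι Y)) (by simp))
      (shortExact_cokernel (Injective.ι Y))
      (shortExact_map_cyclesFunctor (shortExact_cokernel (Injective.ι Y)) hY n) h⟩

lemma extOneVanishes_sphere_right_iff {X : Ch A} (hX : X.Acyclic) (n : ℤ) (B : A) :
    ExtOneVanishes X ((sphere A n).obj B) ↔ ExtOneVanishes (X.opcycles n) B :=
  ⟨fun h => ExtOneVanishes.leftAdjoint_of_exact (opcyclesAdjSphere A n) h, fun h =>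
    ExtOneVanishes.rightAdjoint (opcyclesAdjSphere A n) (fun _ hS hS' =>
      shortExact_map_opcyclesFunctor hS (hS' ▸ hX) n) h⟩

lemma rightPerp_spheres {P C : ObjectProperty A} (hP : rightPerp P = C) {G : A}
    (hG : IsSeparator G) (hPG : P G) : rightPerp (spheres P) = tilde C := by
  subst hP
  ext Y
  rw [rightPerp_spheres_iff]
  constructor
  · intro h
    have hY := acyclic_of_extOneVanishes_sphere_left hG fun n => h n G hPG
    exact ⟨hY, fun n B hB => (extOneVanishes_sphere_left_iff hY n B).1 (h n B hB)⟩
  · rintro ⟨hY, h⟩ n B hB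
    exact (extOneVanishes_sphere_left_iff hY n B).2 (h n B hB)

variable {F C : ObjectProperty A}

lemma IsCotorsionPair.leftPerp_spheres (h : IsCotorsionPair F C) :
    leftPerp (spheres C) = tilde F := by
  ext X
  rw [leftPerp_spheres_iff]
  constructor
  · intro hX
    have hX' := acyclic_of_extOneVanishes_sphere_right fun n I _ => hX n I (by
      rw [h.right_eq]
      exact fun _ _ => extOneVanishes_of_injective _ _)
    refine ⟨hX', fun n => ?_⟩
    rw [h.left_eq]
    exact fun B hB => ((extOneVanishes_sphere_right_iff hX' (n - 1) B).1
      (hX (n - 1) B hB)).of_iso_left (opcyclesIsoCycles hX' (sub_add_cancel n 1))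
  · rintro ⟨hX, hX'⟩ n B hB
    have := hX' (n + 1)
    rw [h.left_eq] at this
    exact (extOneVanishes_sphere_right_iff hX n B).2
      ((this B hB).of_iso_left (opcyclesIsoCycles hX rfl).symm)

lemma extOneVanishes_disk_left_iff {B : A} {n : ℤ} {Y : Ch A} :
    ExtOneVanishes ((disk A n).obj B) Y ↔ ExtOneVanishes B (Y.X n) :=
  ⟨fun h => ExtOneVanishes.rightAdjoint_of_exact (diskAdjEval A n) h,
    fun h => ExtOneVanishes.leftAdjoint_of_exact (diskAdjEval A n) h⟩

lemma extOneVanishes_disk_right_iff {B : A} {n : ℤ} {X : Ch A} :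
    ExtOneVanishes X ((disk A n).obj B) ↔ ExtOneVanishes (X.X (n + 1)) B :=
  ⟨fun h => ExtOneVanishes.leftAdjoint_of_exact (evalAdjDisk A n) h,
    fun h => ExtOneVanishes.rightAdjoint_of_exact (evalAdjDisk A n) h⟩

lemma IsCotorsionPair.tilde_disk_left (h : IsCotorsionPair F C) {B : A} (hB : F B) (n : ℤ) :
    tilde F ((disk A n).obj B) := by
  rw [← h.leftPerp_spheres, leftPerp_spheres_iff]
  intro m B' hB'
  rw [extOneVanishes_disk_left_iff]
  by_cases hnm : n = m
  · subst hnm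
    rw [h.left_eq] at hB
    exact (hB B' hB').of_iso_right (singleObjXSelf _ _ _).symm
  · exact extOneVanishes_of_isZero_right _ (isZero_single_obj_X _ _ _ _ hnm)

lemma IsCotorsionPair.tilde_disk_right (h : IsCotorsionPair F C) {G : A} (hG : IsSeparator G)
    (hFG : F G) {B : A} (hB : C B) (n : ℤ) : tilde C ((disk A n).obj B) := by
  rw [← rightPerp_spheres h.right_eq.symm hG hFG, rightPerp_spheres_iff]
  intro m B' hB'
  rw [extOneVanishes_disk_right_iff]
  by_cases hnm : n + 1 = m
  · subst hnm
    rw [h.right_eq] at hB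
    exact (hB B' hB').of_iso_left (singleObjXSelf _ _ _).symm
  · exact extOneVanishes_of_isZero_left (isZero_single_obj_X _ _ _ _ hnm) _

omit [CategoryTheory.EnoughInjectives A] [CategoryTheory.EnoughInjectives (Ch A)] in
lemma IsCotorsionPair.of_tilde_left (h : IsCotorsionPair F C) {X : Ch A} (hX : tilde F X) (n : ℤ) :
    F (X.X n) := by
  obtain ⟨hX, hX'⟩ := hX
  rw [h.left_eq] at hX' ⊢
  exact fun B hB => extOneVanishes_of_shortExact' (shortExact_cycles rfl (hX (n + 1)))
    (hX' n B hB) (hX' (n + 1) B hB)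

omit [CategoryTheory.EnoughInjectives A] [CategoryTheory.EnoughInjectives (Ch A)] in
lemma IsCotorsionPair.of_tilde_right (h : IsCotorsionPair F C) {X : Ch A} (hX : tilde C X) (n : ℤ) :
    C (X.X n) := by
  obtain ⟨hX, hX'⟩ := hX
  rw [h.right_eq] at hX' ⊢
  exact fun B hB => extOneVanishes_of_shortExact (shortExact_cycles rfl (hX (n + 1)))
    (hX' n B hB) (hX' (n + 1) B hB)

lemma IsCotorsionPair.tilde_shift_left (h : IsCotorsionPair F C) {X : Ch A} (hX : tilde F X)
    (k : ℤ) : tilde F (X⟦k⟧) := by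
  rw [← h.leftPerp_spheres, leftPerp_spheres_iff] at hX ⊢
  intro n B hB
  exact ExtOneVanishes.leftAdjoint_of_exact (shiftEquiv (Ch A) k).toAdjunction
    ((hX (n + k) B hB).of_iso_right (sphereShiftIso B (by lia : -k + (n + k) = n)).symm)

lemma IsCotorsionPair.tilde_shift_right (h : IsCotorsionPair F C) {G : A} (hG : IsSeparator G)
    (hFG : F G) {Y : Ch A} (hY : tilde C Y) (k : ℤ) : tilde C (Y⟦k⟧) := by
  rw [← rightPerp_spheres h.right_eq.symm hG hFG, rightPerp_spheres_iff] at hY ⊢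
  intro n B hB
  exact ExtOneVanishes.rightAdjoint_of_exact (shiftEquiv (Ch A) k).symm.toAdjunction
    ((hY (n + k) B hB).of_iso_left (sphereShiftIso B (by lia : -k + (n + k) = n)).symm)

/-- Extensions of complexes in `tilde F` by complexes with terms in `C` split degreewise, so `Ext¹`
is the first cohomology of the total Hom complex. The other cohomology groups are obtained by
shifting, and the condition on the terms of complexes in `(tilde F)^⊥` by testing against disks. -/
lemma IsCotorsionPair.dgRight_eq (h : IsCotorsionPair F C) : dgRight F C = rightPerp (tilde F) := by
  ext Y
  constructor
  · rintro ⟨hY, hY'⟩ X hX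
    refine extOneVanishes_of_exists_δ_eq (fun n => ?_) fun z => ?_
    · have := hY n
      rw [h.right_eq] at this
      exact this _ (h.of_tilde_left hX n)
    · exact (homComplex_acyclic_iff X Y).1 (hY' X hX) 0 1 rfl z
  · intro hY
    refine ⟨fun n => ?_, fun X hX => ?_⟩
    · rw [h.right_eq]
      exact fun B hB => extOneVanishes_disk_left_iff.1 (hY _ (h.tilde_disk_left hB n))
    · rw [homComplex_acyclic_iff]
      exact fun m n hmn z => exists_δ_eq_of_extOneVanishes_shift_left hmn
        (hY _ (h.tilde_shift_left hX (-m))) z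

/-- The dual of `IsCotorsionPair.dgRight_eq`. -/
lemma IsCotorsionPair.dgLeft_eq (h : IsCotorsionPair F C) {G : A} (hG : IsSeparator G)
    (hFG : F G) : dgLeft F C = leftPerp (tilde C) := by
  ext X
  constructor
  · rintro ⟨hX, hX'⟩ Y hY
    refine extOneVanishes_of_exists_δ_eq (fun n => ?_) fun z => ?_
    · have := hX n
      rw [h.left_eq] at this
      exact this _ (h.of_tilde_right hY n)
    · exact (homComplex_acyclic_iff X Y).1 (hX' Y hY) 0 1 rfl z
  · intro hX
    refine ⟨fun n => ?_, fun Y hY => ?_⟩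
    · rw [h.left_eq]
      intro B hB
      obtain ⟨n, rfl⟩ : ∃ m, n = m + 1 := ⟨n - 1, by simp⟩
      exact extOneVanishes_disk_right_iff.1 (hX _ (h.tilde_disk_right hG hFG hB n))
    · rw [homComplex_acyclic_iff]
      exact fun m n hmn z => exists_δ_eq_of_extOneVanishes_shift_right hmn
        (hX _ (h.tilde_shift_right hG hFG hY m)) z

lemma IsCotorsionPair.tilde_dgRight (h : IsCotorsionPair F C) :
    IsCotorsionPair (tilde F) (dgRight F C) := by
  rw [h.dgRight_eq, ← h.leftPerp_spheres]
  exact isCotorsionPair_leftPerp _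

lemma IsCotorsionPair.dgLeft_tilde (h : IsCotorsionPair F C) {G : A} (hG : IsSeparator G)
    (hFG : F G) : IsCotorsionPair (dgLeft F C) (tilde C) := by
  rw [h.dgLeft_eq hG hFG, ← rightPerp_spheres h.right_eq.symm hG hFG]
  exact isCotorsionPair_rightPerp _

end

end CotorsionPair

/-! ### Filtrations by chains of subobjects -/

namespace CotorsionPair

open CategoryTheory.Subobject hiding sSup
open Cardinal

variable {A : Type u} [Category.{v} A]

variable [Abelian A] [IsGrothendieckAbelian.{v} A]

section

variable {X : A} {Φ : Subobject X → Subobject X} (hΦ : ∀ U, U ≤ Φ U)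
  (J : Type v) [LinearOrder J] [OrderBot J] [SuccOrder J] [WellFoundedLT J]

/-- The chain of subobjects obtained by iterating `Φ`, starting at `⊥`. -/
noncomputable def iterateMonoOver : J ⥤ MonoOver X where
  obj j := MonoOver.mk (transfiniteIterate Φ j ⊥).arrow
  map {_ _} f := MonoOver.homMk (Subobject.ofLE _ _
    (monotone_transfiniteIterate _ _ hΦ (leOfHom f))) (Subobject.ofLE_arrow _)
  map_id _ := Subsingleton.elim _ _
  map_comp _ _ := Subsingleton.elim _ _

/-- The underlying functor of `iterateMonoOver`. -/
noncomputable abbrev iterateFunctor : J ⥤ A :=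
  iterateMonoOver hΦ J ⋙ MonoOver.forget _ ⋙ Over.forget _

instance : (iterateFunctor hΦ J).IsWellOrderContinuous where
  nonempty_isColimit m hm := ⟨by
    have := hm.nonempty_Iio.to_subtype
    let c := (Set.principalSegIio m).cocone (iterateMonoOver hΦ J ⋙ MonoOver.forget _)
    have hc : Mono c.pt.hom :=
      inferInstanceAs (Mono (transfiniteIterate Φ m (⊥ : Subobject X)).arrow)
    apply IsGrothendieckAbelian.isColimitMapCoconeOfSubobjectMkEqISup
      ((Set.principalSegIio m).monotone.functor ⋙ iterateMonoOver hΦ J) c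
    have h1 : Subobject.mk c.pt.hom = transfiniteIterate Φ m ⊥ := Subobject.mk_arrow _
    have h2 (i : Set.Iio m) : Subobject.mk
        ((((Set.principalSegIio m).monotone.functor ⋙ iterateMonoOver hΦ J).obj i).obj.hom) =
          transfiniteIterate Φ i.1 ⊥ := Subobject.mk_arrow _
    refine Eq.trans h1 ?_
    refine Eq.trans (transfiniteIterate_limit Φ ⊥ m hm) ?_
    exact iSup_congr fun i => (h2 i).symm⟩

variable {J} in
/-- The inclusion of `⊥` into the step `j` of the chain, as a transfinite composition of the
inclusions of the successive steps. -/
noncomputable def iterateTransfiniteComposition {W : MorphismProperty A} (j : J)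
    (hW : ∀ k < j, W (Subobject.ofLE (transfiniteIterate Φ k ⊥)
      (transfiniteIterate Φ (Order.succ k) ⊥)
      (monotone_transfiniteIterate _ _ hΦ (Order.le_succ k)))) :
    W.TransfiniteCompositionOfShape (Set.Iic j)
      ((iterateFunctor hΦ J).map (homOfLE bot_le : ⊥ ⟶ j)) where
  F := (Set.initialSegIic j).monotone.functor ⋙ iterateFunctor hΦ J
  isoBot := Iso.refl _
  incl :=
    { app k := (iterateFunctor hΦ J).map (homOfLE k.2)
      naturality k k' h := by
        refine Eq.trans ?_ (Category.comp_id _).symm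
        exact ((iterateFunctor hΦ J).map_comp (homOfLE (leOfHom h) : k.1 ⟶ k'.1)
          (homOfLE k'.2)).symm }
  isColimit := colimitOfDiagramTerminal isTerminalTop _
  fac := by
    refine (Category.id_comp _).trans ?_
    rfl
  map_mem k hk := by
    have h1 : k.1 < j := lt_of_le_of_ne k.2 fun h => hk fun x hx => by
      exact x.2.trans h.symm.le
    have h2 : ((Order.succ k : Set.Iic j) : J) = Order.succ k.1 :=
      congrArg Subtype.val (Set.Iic.succ_eq_of_not_isMax hk)
    have h3 : ∀ (l : J) (hl : l = Order.succ k.1) (hkl : k.1 ≤ l),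
        W ((iterateFunctor hΦ J).map (homOfLE hkl)) := by
      rintro _ rfl hkl
      exact hW k.1 h1
    exact h3 _ h2 (Order.le_succ k)

end

/-- An object `X` is `L`-filtered if there is a set `K` of subobjects of `X`, closed under unions of
chains, in which each member other than `X` has a successor with quotient in `L`. -/
lemma isFilteredBy_of_subobjects {L : ObjectProperty A} (hL : ∀ Z, IsZero Z → L.isoClosure Z)
    {X : A} (K : Set (Subobject X)) (hbot : ⊥ ∈ K)
    (hsup : ∀ {J : Type v} [LinearOrder J] [Nonempty J] (s : J →o Subobject X),
      (∀ j, s j ∈ K) → (⨆ j, s j) ∈ K)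
    (hsucc : ∀ U ∈ K, U ≠ ⊤ → ∃ U' ∈ K, U ≠ U' ∧ ∃ h : U ≤ U',
      L.isoClosure (cokernel (Subobject.ofLE U U' h))) :
    IsFilteredBy.{v} L X := by
  classical
  let Φ (U : Subobject X) : Subobject X :=
    if h : U ∈ K ∧ U ≠ ⊤ then (hsucc U h.1 h.2).choose else ⊤
  have hΦ₁ (U : Subobject X) (h : U ∈ K ∧ U ≠ ⊤) : Φ U = (hsucc U h.1 h.2).choose := dif_pos h
  have hΦ₂ (U : Subobject X) (h : ¬ (U ∈ K ∧ U ≠ ⊤)) : Φ U = ⊤ := dif_neg h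
  have hΦtop : Φ ⊤ = ⊤ := hΦ₂ _ fun h => h.2 rfl
  have hΦ (U : Subobject X) : U ≤ Φ U := by
    by_cases h : U ∈ K ∧ U ≠ ⊤
    · rw [hΦ₁ U h]
      exact (hsucc U h.1 h.2).choose_spec.2.2.choose
    · rw [hΦ₂ U h]; exact le_top
  have hlt (U : Subobject X) (hU : U ≠ ⊤) : U < Φ U := by
    by_cases h : U ∈ K ∧ U ≠ ⊤
    · refine lt_of_le_of_ne (hΦ U) ?_
      rw [hΦ₁ U h]
      exact (hsucc U h.1 h.2).choose_spec.2.1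
    · rw [hΦ₂ U h]; exact lt_top_iff_ne_top.2 hU
  have hK (U : Subobject X) (hU : U ∈ K) : Φ U ∈ K := by
    by_cases h : U ≠ ⊤
    · rw [hΦ₁ U ⟨hU, h⟩]
      exact (hsucc U hU h).choose_spec.1
    · obtain rfl : U = ⊤ := not_not.1 h
      rwa [hΦtop]
  have hLΦ (U : Subobject X) (hU : U ∈ K) :
      monoWithCokernelIn L (Subobject.ofLE U (Φ U) (hΦ U)) := by
    refine ⟨inferInstance, ?_⟩
    by_cases h : U ≠ ⊤
    · have h1 := (hsucc U hU h).choose_spec.2.2.choose_spec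
      have h2 : ∀ (V : Subobject X) (_ : V = (hsucc U hU h).choose) (hV : U ≤ V),
          L.isoClosure (cokernel (Subobject.ofLE U V hV)) := by
        rintro _ rfl _; exact h1
      exact h2 _ (hΦ₁ U ⟨hU, h⟩) _
    · have h2 : ∀ (V : Subobject X) (_ : V = U) (hV : U ≤ V),
          L.isoClosure (cokernel (Subobject.ofLE U V hV)) := by
        rintro _ rfl hV
        refine hL _ ?_
        rw [Subobject.ofLE_refl]
        exact isZero_cokernel_of_epi _
      refine h2 _ ?_ _
      obtain rfl : U = ⊤ := not_not.1 h
      exact hΦtop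
  -- a chain which is longer than the number of subobjects has to reach `⊤`
  let κ := Order.succ (Cardinal.mk (Shrink.{v} (Subobject X)))
  let J := κ.ord.ToType
  have : Nonempty J := by simp [J, κ]
  let _ : OrderBot J := WellFoundedLT.toOrderBot J
  let _ : SuccOrder J := SuccOrder.ofLinearWellFoundedLT J
  obtain ⟨j, hj⟩ : ∃ j : J, transfiniteIterate Φ j (⊥ : Subobject X) = ⊤ := by
    refine top_mem_range_transfiniteIterate Φ ⊥ hlt hΦtop fun h => ?_
    have h1 := lift_mk_le_lift_mk_of_injective ((equivShrink.{v} (Subobject X)).injective.comp h)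
    have h2 : #J = κ := by simp [J]
    rw [lift_le, h2] at h1
    exact absurd h1 (not_le.2 (Order.lt_succ _))
  have hmem (k : J) : transfiniteIterate Φ k (⊥ : Subobject X) ∈ K := by
    induction k using SuccOrder.limitRecOn with
    | isMin i hi =>
      obtain rfl := hi.eq_bot
      rwa [transfiniteIterate_bot]
    | succ i hi h =>
      rw [transfiniteIterate_succ _ _ _ hi]
      exact hK _ h
    | isSuccLimit i hi h =>
      rw [transfiniteIterate_limit _ _ _ hi]
      have := hi.nonempty_Iio.to_subtype
      exact hsup (J := Set.Iio i) ⟨fun k => transfiniteIterate Φ k.1 ⊥, fun a b hab =>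
        monotone_transfiniteIterate _ _ hΦ hab⟩ fun k => h k.1 k.2
  let c := iterateTransfiniteComposition (W := monoWithCokernelIn L) hΦ j fun k hk => by
    have h3 : ∀ (V : Subobject X) (_ : V = Φ (transfiniteIterate Φ k ⊥))
        (hV : transfiniteIterate Φ k ⊥ ≤ V),
          monoWithCokernelIn L (Subobject.ofLE (transfiniteIterate Φ k ⊥) V hV) := by
      rintro _ rfl _
      exact hLΦ _ (hmem k)
    exact h3 _ (transfiniteIterate_succ _ _ _ (not_isMax_of_lt hk)) _
  have hz : IsZero (Subobject.underlying.obj (transfiniteIterate Φ (⊥ : J) ⊥)) := by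
    rw [transfiniteIterate_bot]
    exact (isZero_zero A).of_iso Subobject.botCoeIsoZero
  have hiso : IsIso (transfiniteIterate Φ j (⊥ : Subobject X)).arrow :=
    (Subobject.isIso_arrow_iff_eq_top _).2 hj
  let e' : Subobject.underlying.obj (transfiniteIterate Φ j ⊥) ≅ X :=
    @asIso _ _ _ _ (transfiniteIterate Φ j (⊥ : Subobject X)).arrow hiso
  let e : Arrow.mk ((iterateFunctor hΦ J).map (homOfLE bot_le : (⊥ : J) ⟶ j)) ≅
      Arrow.mk (0 : (0 : A) ⟶ X) :=
    Arrow.isoMk (hz.iso (isZero_zero A)) e'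
      (hz.eq_of_src _ _)
  refine ⟨Set.Iic j, inferInstance, inferInstance, inferInstance, inferInstance, c.ofArrowIso e,
    fun a b h => ?_⟩
  have hmono (U V : Subobject X) (h : U ≤ V) : Mono (Subobject.ofLE U V h) := inferInstance
  exact hmono _ _ _

end CotorsionPair

/-! ### A separator of the category of complexes -/

namespace CotorsionPair

open Cardinal CochainComplex

variable {A : Type u} [Category.{v} A] [Abelian A] [IsGrothendieckAbelian.{v} A]

lemma extOneVanishes_sigma {I : Type v} {X : I → A} {Y : A} (h : ∀ i, ExtOneVanishes (X i) Y) :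
    ExtOneVanishes (∐ X) Y := by
  refine extOneVanishes_of_exists_lift (shortExact_cokernel (Injective.ι Y)) fun g => ?_
  have h' (i : I) := (h i).exists_lift (shortExact_cokernel (Injective.ι Y)) (Sigma.ι X i ≫ g)
  choose l hl using h'
  refine ⟨Sigma.desc l, Sigma.hom_ext _ _ fun i => ?_⟩
  rw [Sigma.ι_desc_assoc]
  exact hl i

/-- The coproduct of all the disks on `G`. -/
noncomputable def diskSum (G : A) : Ch A := ∐ fun n : ULift.{v} ℤ => diskObj n.down G

/-- The inclusion of a disk into `diskSum G`. -/
noncomputable def diskSumι (G : A) (n : ULift.{v} ℤ) : diskObj n.down G ⟶ diskSum G :=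
  Sigma.ι (fun n : ULift.{v} ℤ => diskObj n.down G) n

lemma exists_diskSumι_comp_eq {G : A} {X : Ch A}
    (g : (n : ULift.{v} ℤ) → (diskObj n.down G ⟶ X)) :
    ∃ f : diskSum G ⟶ X, ∀ n, diskSumι G n ≫ f = g n :=
  ⟨Sigma.desc g, fun n => Sigma.ι_desc g n⟩

/-- A morphism from `diskSum G` to `X` is a family of morphisms from `G` to the terms of `X`. -/
noncomputable def diskSumHomEquiv (G : A) (X : Ch A) :
    (diskSum G ⟶ X) ≃ ((n : ULift.{v} ℤ) → (G ⟶ X.X n.down)) :=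
  Equiv.ofBijective (fun f n => diskHomEquiv n.down G X (diskSumι G n ≫ f))
    ⟨fun _ _ h => Sigma.hom_ext _ _ fun n => (diskHomEquiv n.down G X).injective (congrFun h n),
      fun g => by
        obtain ⟨f, hf⟩ := exists_diskSumι_comp_eq fun n => (diskHomEquiv n.down G X).symm (g n)
        exact ⟨f, funext fun n => ((diskHomEquiv n.down G X).symm_apply_eq.1 (hf n).symm).symm⟩⟩

lemma diskSumHomEquiv_naturality {G : A} {X Y : Ch A} (f : diskSum G ⟶ X) (g : X ⟶ Y)
    (n : ULift.{v} ℤ) :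
    diskSumHomEquiv G Y (f ≫ g) n = diskSumHomEquiv G X f n ≫ g.f n.down :=
  (congrArg (diskHomEquiv n.down G Y) (Category.assoc (diskSumι G n) f g).symm).trans
    (diskHomEquiv_naturality_right (diskSumι G n ≫ f) g)

lemma isSeparator_diskSum {G : A} (hG : IsSeparator G) : IsSeparator (diskSum G) := by
  classical
  refine isSeparator_def _ |>.2 fun X Y f g h => ?_
  ext n
  refine hG.def _ _ fun q => ?_
  let q' := (diskSumHomEquiv G X).symm (Function.update 0 ⟨n⟩ q)
  have h1 := congrFun (congrArg (diskSumHomEquiv G Y) (h q')) ⟨n⟩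
  rw [diskSumHomEquiv_naturality, diskSumHomEquiv_naturality, Equiv.apply_symm_apply,
    Function.update_self] at h1
  exact h1

lemma IsCotorsionPair.tilde_diskSum {F C : ObjectProperty A} (h : IsCotorsionPair F C) {G : A}
    (hFG : F G) : tilde F (diskSum G) := by
  rw [h.tilde_dgRight.left_eq]
  refine fun Y hY => extOneVanishes_sigma fun n => ?_
  have h1 := h.tilde_disk_left hFG n.down
  rw [h.tilde_dgRight.left_eq] at h1
  exact h1 Y hY

lemma IsCotorsionPair.dgLeft_diskSum {F C : ObjectProperty A} (h : IsCotorsionPair F C) {G : A}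
    (hG : IsSeparator G) (hFG : F G) : dgLeft F C (diskSum G) := by
  rw [h.dgLeft_eq hG hFG]
  refine fun Y hY => extOneVanishes_sigma fun n => ?_
  refine extOneVanishes_disk_left_iff.2 ?_
  have h1 : leftPerp C G := by rwa [← h.left_eq]
  exact h1 _ (h.of_tilde_right hY _)

/-- A complex whose terms have size at most `θ` has itself size at most `θ`. -/
lemma IsBounded.of_forall_X {θ : Cardinal.{v}} (hθ : θ ^ ℵ₀ ≤ θ) {G : A} {X : Ch A}
    (h : ∀ n, IsBounded θ G (X.X n)) : IsBounded θ (diskSum G) X := by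
  refine (mk_congr (diskSumHomEquiv G X)).le.trans ?_
  rw [mk_pi]
  refine (prod_le_prod _ (fun _ => θ) fun n : ULift.{v} ℤ => h n.down).trans ?_
  rw [prod_const, lift_id, lift_id]
  have : #(ULift.{v} ℤ) = ℵ₀ := by simp
  rwa [this]

/-- There are arbitrarily large cardinals which are admissible both for objects of `A` and for
complexes in `A`. -/
lemma exists_isAdmissible_diskSum {G : A} (hG : IsSeparator G) (μ : Cardinal.{v}) :
    ∃ θ : Cardinal.{v}, μ ≤ θ ∧ θ ^ ℵ₀ ≤ θ ∧ IsAdmissible θ G ∧ IsAdmissible θ (diskSum G) := by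
  obtain ⟨ν₁, h₁⟩ := exists_forall_isAdmissible hG
  obtain ⟨ν₂, h₂⟩ := exists_forall_isAdmissible (isSeparator_diskSum hG)
  let ν := max (max ℵ₀ μ) (max ν₁ ν₂)
  have hν : ℵ₀ ≤ ν := (le_max_left _ _).trans (le_max_left _ _)
  refine ⟨2 ^ ν, ?_, ?_, h₁ ν ?_, h₂ ν ?_⟩
  · exact ((le_max_right _ _).trans (le_max_left _ _)).trans (cantor ν).le
  · rw [← power_mul, mul_eq_left hν hν aleph0_ne_zero]
  · exact (le_max_left _ _).trans (le_max_right _ _)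
  · exact (le_max_right _ _).trans (le_max_right _ _)

theorem IsCotorsionPair.isComplete_dgLeft_tilde {F C : ObjectProperty A}
    (h : IsCotorsionPair F C) {T : ObjectProperty A} [ObjectProperty.Small.{v} T]
    (hT : rightPerp T = C) {G : A} (hG : IsSeparator G) (hFG : F G) :
    IsCompleteCotorsionPair (dgLeft F C) (tilde C) := by
  have hT' : rightPerp (T ⊔ ObjectProperty.singleton G) = C := by
    refine le_antisymm (fun Y hY => ?_) fun Y hY X hX => ?_
    · rw [← hT]
      exact fun X hX => hY X (Or.inl hX)
    · obtain hX | hX := hX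
      · rw [← hT] at hY
        exact hY X hX
      · obtain rfl : G = X := (ObjectProperty.singleton_iff _ _).1 hX
        rw [h.right_eq] at hY
        exact hY G hFG
  exact (h.dgLeft_tilde hG hFG).isCompleteCotorsionPair
    (T := spheres (T ⊔ ObjectProperty.singleton G))
    (rightPerp_spheres hT' hG (Or.inr ((ObjectProperty.singleton_iff _ _).2 rfl)))
    (h.dgLeft_diskSum hG hFG) (isSeparator_diskSum hG)

end CotorsionPair

/-! ### Subcomplexes and their cycles -/

namespace CotorsionPair

open CategoryTheory.Subobject hiding sSup
open Cardinal CochainComplex HomologicalComplex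

section

variable {A : Type u} [Category.{v} A] [Abelian A] {X : Ch A}

/-- The degree `n` part of a subcomplex. -/
noncomputable def termSubobject (U : Subobject X) (n : ℤ) : Subobject (X.X n) :=
  Subobject.mk (U.arrow.f n)

lemma termSubobject_factors_iff (U : Subobject X) (n : ℤ) {Z : A} (f : Z ⟶ X.X n) :
    (termSubobject U n).Factors f ↔ ∃ g : Z ⟶ (U : Ch A).X n, g ≫ U.arrow.f n = f :=
  mk_factors_iff _ _

lemma termSubobject_le_iff (U : Subobject X) (n : ℤ) (s : Subobject (X.X n)) :
    termSubobject U n ≤ s ↔ s.Factors (U.arrow.f n) := by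
  refine ⟨fun h => factors_of_le _ h ((termSubobject_factors_iff _ _ _).2 ⟨𝟙 _, by simp⟩),
    fun h => Subobject.mk_le_of_comm (s.factorThru _ h) (by simp)⟩

lemma termSubobject_mono (n : ℤ) {U V : Subobject X} (h : U ≤ V) :
    termSubobject U n ≤ termSubobject V n := by
  rw [termSubobject_le_iff, termSubobject_factors_iff]
  exact ⟨(ofLE U V h).f n, by rw [← comp_f, ofLE_arrow]⟩

/-- The degree `n` cycles of a subcomplex. -/
noncomputable def cyclesSubobject (U : Subobject X) (n : ℤ) : Subobject (X.cycles n) :=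
  (Subobject.pullback (X.iCycles n)).obj (termSubobject U n)

lemma cyclesSubobject_factors_iff (U : Subobject X) (n : ℤ) {Z : A} (f : Z ⟶ X.cycles n) :
    (cyclesSubobject U n).Factors f ↔ (termSubobject U n).Factors (f ≫ X.iCycles n) :=
  pullback_factors_iff _ _ _

lemma cyclesSubobject_mono (n : ℤ) {U V : Subobject X} (h : U ≤ V) :
    cyclesSubobject U n ≤ cyclesSubobject V n :=
  (Subobject.pullback (X.iCycles n)).monotone (termSubobject_mono n h)

instance (U : Subobject X) (n : ℤ) : Mono (cyclesMap U.arrow n) := by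
  have : Mono (cyclesMap U.arrow n ≫ X.iCycles n) := by
    rw [cyclesMap_i]
    infer_instance
  exact mono_of_mono _ (X.iCycles n)

lemma cyclesSubobject_eq_mk (U : Subobject X) (n : ℤ) :
    cyclesSubobject U n = Subobject.mk (cyclesMap U.arrow n) := by
  refine le_antisymm (le_of_factors ?_)
    (Subobject.mk_le_of_comm ((cyclesSubobject U n).factorThru (cyclesMap U.arrow n) ?_) ?_)
  · have h := (cyclesSubobject_factors_iff U n _).1 (factors_self (cyclesSubobject U n))
    rw [termSubobject_factors_iff] at h
    obtain ⟨g, hg⟩ := h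
    have h0 : g ≫ (U : Ch A).d n (n + 1) = 0 := by
      rw [← cancel_mono (U.arrow.f (n + 1)), Category.assoc, ← U.arrow.comm, reassoc_of% hg,
        iCycles_d, comp_zero, zero_comp]
    have h1 : (U : Ch A).liftCycles g (n + 1) (by simp) h0 ≫ cyclesMap U.arrow n =
        (cyclesSubobject U n).arrow := by
      rw [← cancel_mono (X.iCycles n), Category.assoc, cyclesMap_i, liftCycles_i_assoc, hg]
    exact (mk_factors_iff _ _).2 ⟨_, h1⟩
  · rw [cyclesSubobject_factors_iff, termSubobject_factors_iff]
    exact ⟨(U : Ch A).iCycles n, by rw [cyclesMap_i]⟩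
  · exact factorThru_arrow _ _ _

/-- The boundaries in degree `n` of a subcomplex, where `m = n - 1`. -/
noncomputable def boundariesSubobject (U : Subobject X) (m n : ℤ) : Subobject (X.cycles n) :=
  (Subobject.exists (X.toCycles m n)).obj (termSubobject U m)

lemma boundariesSubobject_mono (m n : ℤ) {U V : Subobject X} (h : U ≤ V) :
    boundariesSubobject U m n ≤ boundariesSubobject V m n :=
  (Subobject.exists (X.toCycles m n)).monotone (termSubobject_mono m h)

lemma boundariesSubobject_le (U : Subobject X) (m n : ℤ) :
    boundariesSubobject U m n ≤ cyclesSubobject U n := by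
  rw [boundariesSubobject, exists_le_iff, termSubobject_le_iff, pullback_factors_iff,
    cyclesSubobject_factors_iff, termSubobject_factors_iff]
  exact ⟨(U : Ch A).d m n, by simp⟩

lemma acyclic_of_cyclesSubobject_le {U : Subobject X}
    (h : ∀ m n, m + 1 = n → cyclesSubobject U n ≤ boundariesSubobject U m n) :
    (U : Ch A).Acyclic := by
  intro n
  rw [exactAt_iff_epi_toCycles _ (sub_add_cancel n 1)]
  let I := imageSubobject ((U : Ch A).toCycles (n - 1) n)
  have h1 : boundariesSubobject U (n - 1) n ≤ Subobject.mk (I.arrow ≫ cyclesMap U.arrow n) := by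
    rw [boundariesSubobject, exists_le_iff, termSubobject_le_iff, pullback_factors_iff]
    refine (mk_factors_iff _ _).2 ⟨factorThruImageSubobject _, ?_⟩
    rw [← toCycles_cyclesMap]
    exact imageSubobject_arrow_comp_assoc _ _
  have h2 := (h (n - 1) n (by simp)).trans h1
  rw [cyclesSubobject_eq_mk] at h2
  have h3 : ofMkLEMk _ _ h2 ≫ I.arrow = 𝟙 _ := by
    rw [← cancel_mono (cyclesMap U.arrow n), Category.assoc, ofMkLEMk_comp, Category.id_comp]
  have h4 : Epi I.arrow := epi_of_epi_fac h3
  have h5 : Epi (factorThruImageSubobject ((U : Ch A).toCycles (n - 1) n) ≫ I.arrow) :=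
    epi_comp _ _
  have h6 : factorThruImageSubobject ((U : Ch A).toCycles (n - 1) n) ≫ I.arrow = _ :=
    imageSubobject_arrow_comp _
  rwa [h6] at h5

/-- A morphism from a disk to `X` factors through a subcomplex if and only if the corresponding
morphism to a term of `X` does. -/
lemma factors_iff_of_diskObj (U : Subobject X) {n : ℤ} {B : A} (f : diskObj n B ⟶ X) :
    U.Factors f ↔ (termSubobject U n).Factors (diskHomEquiv n B X f) := by
  rw [termSubobject_factors_iff]
  refine ⟨fun h => ⟨diskHomEquiv n B _ (U.factorThru f h), ?_⟩, fun ⟨g, hg⟩ => ?_⟩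
  · rw [← diskHomEquiv_naturality_right, factorThru_arrow]
  · refine (Subobject.factors_iff _ _).2 ⟨(diskHomEquiv n B _).symm g, ?_⟩
    apply (diskHomEquiv n B X).injective
    refine Eq.trans ?_ hg
    exact (diskHomEquiv_naturality_right _ U.arrow).trans
      (congrArg (· ≫ U.arrow.f n) (Equiv.apply_symm_apply _ _))

/-- The subcomplex generated by a subobject of a term. -/
noncomputable def subcomplexSpan {n : ℤ} (s : Subobject (X.X n)) : Subobject X :=
  imageSubobject ((diskHomEquiv n (s : A) X).symm s.arrow)

lemma subcomplexSpan_le_iff {n : ℤ} (s : Subobject (X.X n)) (U : Subobject X) :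
    subcomplexSpan s ≤ U ↔ s ≤ termSubobject U n := by
  rw [subcomplexSpan, imageSubobject_le_iff, factors_iff_of_diskObj, Equiv.apply_symm_apply]
  exact ⟨fun h => le_of_factors h, fun h => factors_of_le _ h (factors_self s)⟩

lemma termSubobject_le_iff_le_kernel (U : Subobject X) (n : ℤ) (s : Subobject (X.X (n + 1))) :
    termSubobject U (n + 1) ≤ s ↔
      U ≤ kernelSubobject (homDiskEquiv n X _ (cokernel.π s.arrow)) := by
  rw [termSubobject_le_iff, factors_iff_comp_cokernel]
  have h1 : U ≤ kernelSubobject (homDiskEquiv n X _ (cokernel.π s.arrow)) ↔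
      U.arrow ≫ homDiskEquiv n X _ (cokernel.π s.arrow) = 0 := by
    rw [← kernelSubobject_factors_iff]
    exact ⟨fun h => factors_of_le _ h (factors_self U), fun h => le_of_factors h⟩
  have h2 : (homDiskEquiv n (U : Ch A) (cokernel s.arrow)).symm
      (U.arrow ≫ homDiskEquiv n X _ (cokernel.π s.arrow)) =
        U.arrow.f (n + 1) ≫ cokernel.π s.arrow := by
    rw [homDiskEquiv_symm_naturality_left, Equiv.symm_apply_apply]
  have h3 : (homDiskEquiv n (U : Ch A) (cokernel s.arrow)).symm 0 = 0 := zero_comp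
  rw [h1, ← h2, ← (homDiskEquiv n (U : Ch A) (cokernel s.arrow)).symm.injective.eq_iff, h3]

end

section

variable {A : Type u} [Category.{v} A] [Abelian A] [IsGrothendieckAbelian.{v} A] {X : Ch A}

lemma termSubobject_iSup {ι : Sort*} (s : ι → Subobject X) (n : ℤ) :
    termSubobject (⨆ i, s i) n = ⨆ i, termSubobject (s i) n := by
  obtain ⟨n, rfl⟩ : ∃ k, n = k + 1 := ⟨n - 1, by simp⟩
  have h : GaloisConnection (fun U : Subobject X => termSubobject U (n + 1))
    (fun s => kernelSubobject (homDiskEquiv n X _ (cokernel.π s.arrow))) :=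
      fun U s => termSubobject_le_iff_le_kernel U n s
  exact h.l_iSup

lemma termSubobject_sup (U V : Subobject X) (n : ℤ) :
    termSubobject (U ⊔ V) n = termSubobject U n ⊔ termSubobject V n := by
  rw [sup_eq_iSup, termSubobject_iSup, sup_eq_iSup]
  exact iSup_congr fun b => by cases b <;> rfl

lemma cyclesSubobject_iSup {J : Type v} [PartialOrder J] [Nonempty J] [IsDirectedOrder J]
    (s : J →o Subobject X) (n : ℤ) :
    cyclesSubobject (⨆ j, s j) n = ⨆ j, cyclesSubobject (s j) n := by
  rw [cyclesSubobject, termSubobject_iSup]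
  exact pullback_iSup_of_monotone ⟨fun j => termSubobject (s j) n,
    fun i j h => termSubobject_mono n (s.monotone h)⟩ _

lemma cyclesSubobject_iSup_nat (s : ℕ → Subobject X) (hs : Monotone s) (n : ℤ) :
    cyclesSubobject (⨆ j, s j) n = ⨆ j, cyclesSubobject (s j) n := by
  rw [cyclesSubobject, termSubobject_iSup]
  exact pullback_iSup_nat (fun j => termSubobject (s j) n)
    (fun i j h => termSubobject_mono n (hs h)) _

lemma boundariesSubobject_iSup {ι : Sort*} (s : ι → Subobject X) (m n : ℤ) :
    boundariesSubobject (⨆ i, s i) m n = ⨆ i, boundariesSubobject (s i) m n := by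
  rw [boundariesSubobject, termSubobject_iSup, exists_iSup]
  rfl

lemma cyclesSubobject_bot (n : ℤ) : cyclesSubobject (⊥ : Subobject X) n = ⊥ := by
  refine le_bot_iff.1 (le_of_factors ?_)
  have h1 : (cyclesSubobject (⊥ : Subobject X) n).arrow = 0 := by
    have h := (cyclesSubobject_factors_iff _ n _).1 
      (factors_self (cyclesSubobject (⊥ : Subobject X) n))
    obtain ⟨g, hg⟩ := (termSubobject_factors_iff _ _ _).1 h
    rw [bot_arrow, zero_f, comp_zero] at hg
    rw [← cancel_mono (X.iCycles n), ← hg, zero_comp]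
  rw [h1]
  exact factors_zero

variable {θ : Cardinal.{v}} {G : A}

lemma IsAdmissible.isBounded_imageSubobject (hθ : IsAdmissible θ G) {Y Z : A}
    (hY : IsBounded θ G Y) (f : Y ⟶ Z) : IsBounded θ G (imageSubobject f : A) :=
  hθ.isBounded_of_epi hY (factorThruImageSubobject f)

lemma isBounded_diskObj (hθ : ℵ₀ ≤ θ) (hθ' : θ ^ ℵ₀ ≤ θ) {B : A} (hB : IsBounded θ G B) (n : ℤ) :
    IsBounded θ (diskSum G) (diskObj n B) := by
  refine IsBounded.of_forall_X hθ' fun m => ?_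
  by_cases h₀ : m = n
  · subst h₀
    exact hB.of_iso (diskXIso₀ m B)
  by_cases h₁ : m = n + 1
  · subst h₁
    exact hB.of_iso (diskXIso₁ n B)
  · have hz : IsZero ((diskObj n B).X m) := isZero_double_X _ _ _ h₀ h₁
    have : Subsingleton (G ⟶ (diskObj n B).X m) := ⟨fun _ _ => hz.eq_of_tgt _ _⟩
    exact (le_one_iff_subsingleton.2 this).trans (one_le_aleph0.trans hθ)

lemma IsBounded.termSubobject {V : Subobject X} (h : IsBounded θ (diskSum G) (V : Ch A)) (n : ℤ) :
    IsBounded θ G (termSubobject V n : A) := by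
  classical
  have h1 : IsBounded θ G ((V : Ch A).X n) :=
    (mk_le_of_injective (f := fun g : G ⟶ (V : Ch A).X n =>
      (diskSumHomEquiv G (V : Ch A)).symm (Function.update 0 ⟨n⟩ g)) fun g g' hg => by
        have := congrFun ((diskSumHomEquiv G (V : Ch A)).symm.injective hg) ⟨n⟩
        rwa [Function.update_self, Function.update_self] at this).trans h
  exact h1.of_iso (Subobject.underlyingIso _)

lemma IsAdmissible.isBounded_subcomplexSpan (hθ : IsAdmissible θ (diskSum G)) (hθ' : θ ^ ℵ₀ ≤ θ)
    {n : ℤ} {s : Subobject (X.X n)} (hs : IsBounded θ G (s : A)) :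
    IsBounded θ (diskSum G) (subcomplexSpan s : Ch A) :=
  hθ.isBounded_imageSubobject (isBounded_diskObj hθ.aleph0_le hθ' hs n) _

end

end CotorsionPair

/-! ### Filtrations of acyclic complexes -/

namespace CategoryTheory.Subobject

variable {A : Type u} [Category.{v} A]

lemma prop_of_prop_ofLE {W : MorphismProperty A} [W.RespectsIso] {X Y Y' : A} {i : Y ⟶ X}
    {i' : Y' ⟶ X} [Mono i] [Mono i'] {s t : Subobject X} (hs : s = Subobject.mk i)
    (ht : t = Subobject.mk i') (hst : s ≤ t) (h : W (ofLE s t hst)) (φ : Y ⟶ Y')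
    (hφ : φ ≫ i' = i) : W φ := by
  subst hs ht
  refine (W.arrow_mk_iso_iff (Arrow.isoMk (underlyingIso i) (underlyingIso i') ?_)).1 h
  have : (underlyingIso i).hom ≫ φ = ofLE _ _ hst ≫ (underlyingIso i').hom := by
    rw [← cancel_mono i', Category.assoc, Category.assoc, hφ, underlyingIso_hom_comp_eq_mk,
      underlyingIso_hom_comp_eq_mk, ofLE_arrow]
  exact this

variable [Abelian A]

/-- A morphism on the union of two subobjects vanishes if it vanishes on both of them. -/
lemma eq_zero_of_ofLE_comp_eq_zero {X Z : A} {s t r : Subobject X} (hs : s ≤ r) (ht : t ≤ r)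
    (hr : r ≤ s ⊔ t) (φ : (r : A) ⟶ Z) (h₁ : ofLE s r hs ≫ φ = 0) (h₂ : ofLE t r ht ≫ φ = 0) :
    φ = 0 := by
  have key (p : Subobject X) (hp : p ≤ r) (h : ofLE p r hp ≫ φ = 0) :
      p ≤ Subobject.mk ((kernelSubobject φ).arrow ≫ r.arrow) := by
    refine Subobject.le_mk_of_comm (factorThruKernelSubobject φ _ h) ?_
    rw [← Category.assoc, factorThruKernelSubobject_comp_arrow, ofLE_arrow]
  have hle := hr.trans (sup_le (key s hs h₁) (key t ht h₂))
  have h3 : ofLEMk _ _ hle ≫ (kernelSubobject φ).arrow = 𝟙 _ := by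
    rw [← cancel_mono r.arrow, Category.assoc, ofLEMk_comp, Category.id_comp]
  rw [← Category.id_comp φ, ← h3, Category.assoc, kernelSubobject_arrow_comp, comp_zero]

end CategoryTheory.Subobject

namespace CotorsionPair

open CategoryTheory.Subobject hiding sSup
open Cardinal CochainComplex HomologicalComplex

variable {A : Type u} [Category.{v} A] [Abelian A]

lemma acyclic_of_shortExact {S : ShortComplex (Ch A)} (hS : S.ShortExact) (h₁ : S.X₁.Acyclic)
    (h₂ : S.X₂.Acyclic) : S.X₃.Acyclic := by
  intro n
  rw [exactAt_iff_isZero_homology]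
  refine (hS.homology_exact₃ n (n + 1) (by simp)).isZero_of_both_zeros ?_ ?_
  · exact ((exactAt_iff_isZero_homology _ _).1 (h₂ n)).eq_of_src _ _
  · exact ((exactAt_iff_isZero_homology _ _).1 (h₁ (n + 1))).eq_of_tgt _ _

variable [IsGrothendieckAbelian.{v} A]

/-- If the image of `r` under `p` is contained in a subobject of size at most `θ`, then `r` is
contained in the union of the kernel of `p` and of a subobject of size at most `θ`. -/
lemma IsAdmissible.exists_isBounded_le_sup {θ : Cardinal.{v}} {G : A} (hθ : IsAdmissible θ G)
    {X Y : A} (p : X ⟶ Y) {t : Subobject Y} (ht : IsBounded θ G (t : A)) {r k : Subobject X}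
    (hr : r ≤ (Subobject.pullback p).obj t) (hk : ∀ f : G ⟶ X, f ≫ p = 0 → k.Factors f) :
    ∃ s : Subobject X, IsBounded θ G (s : A) ∧ r ≤ k ⊔ s := by
  classical
  let l (g : G ⟶ (t : A)) : G ⟶ X :=
    if h : ∃ f : G ⟶ X, f ≫ p = g ≫ t.arrow then h.choose else 0
  refine ⟨imageSubobject (Sigma.desc l), hθ.isBounded_image ht l,
    le_of_forall_factors hθ.isSeparator fun f hf => ?_⟩
  have h1 := (pullback_factors_iff _ _ _).1 (factors_of_le f hr hf)
  have h2 : ∃ f' : G ⟶ X, f' ≫ p = t.factorThru _ h1 ≫ t.arrow := ⟨f, by simp⟩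
  have h3 : l (t.factorThru _ h1) ≫ p = f ≫ p := by
    have : l (t.factorThru _ h1) = h2.choose := dif_pos h2
    rw [this, h2.choose_spec, factorThru_arrow]
  have h4 : k.Factors (f - l (t.factorThru _ h1)) :=
    hk _ (by rw [Preadditive.sub_comp, h3, sub_self])
  have h5 := factors_add _ _
    (factors_of_le _ (le_sup_left (b := imageSubobject (Sigma.desc l))) h4)
    (factors_of_le _ (le_sup_right (a := k))
      (factors_imageSubobject_sigmaDesc l (t.factorThru _ h1)))
  rwa [sub_add_cancel] at h5

variable {X : Ch A} {θ : Cardinal.{v}} {G : A} {C : ObjectProperty A}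
  {H : ∀ n, Set (Subobject (X.cycles n))}

/-- The acyclic subcomplexes whose cycles belong to the given families of subobjects. -/
def goodSubcomplexes (H : ∀ n, Set (Subobject (X.cycles n))) : Set (Subobject X) :=
  {U | (∀ n, cyclesSubobject U n ∈ H n) ∧
    ∀ m n, m + 1 = n → cyclesSubobject U n ≤ boundariesSubobject U m n}

lemma goodSubcomplexes_bot (hH : ∀ n, IsHillFamily C θ G (H n)) :
    ⊥ ∈ goodSubcomplexes H := by
  refine ⟨fun n => ?_, fun m n _ => ?_⟩
  · rw [cyclesSubobject_bot, ← sSup_empty]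
    exact (hH n).sSup_mem (Set.empty_subset _)
  · rw [cyclesSubobject_bot]
    exact bot_le

lemma goodSubcomplexes_iSup (hH : ∀ n, IsHillFamily C θ G (H n)) {J : Type v} [LinearOrder J]
    [Nonempty J] (s : J →o Subobject X) (hs : ∀ j, s j ∈ goodSubcomplexes H) :
    (⨆ j, s j) ∈ goodSubcomplexes H := by
  refine ⟨fun n => ?_, fun m n hmn => ?_⟩
  · rw [cyclesSubobject_iSup]
    exact (hH n).iSup_mem fun j => (hs j).1 n
  · rw [cyclesSubobject_iSup, boundariesSubobject_iSup]
    exact iSup_mono fun j => (hs j).2 m n hmn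

/-- One step of the construction of a larger good subcomplex: the cycles of `U ⊔ V` are enlarged to
members of the given families, and `V` is enlarged such that these consist of boundaries. -/
lemma exists_isBounded_step (hθ : IsAdmissible θ G) (hθ₁ : IsAdmissible θ (diskSum G))
    (hθ₂ : θ ^ ℵ₀ ≤ θ) (hX : X.Acyclic) (hH : ∀ n, IsHillFamily C θ G (H n)) {U : Subobject X}
    (hU : U ∈ goodSubcomplexes H) {V : Subobject X} (hV : IsBounded θ (diskSum G) (V : Ch A)) :
    ∃ V' : Subobject X, IsBounded θ (diskSum G) (V' : Ch A) ∧ V ≤ V' ∧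
      ∀ n, ∃ h ∈ H n, cyclesSubobject (U ⊔ V) n ≤ h ∧
        ∀ m, m + 1 = n → h ≤ boundariesSubobject (U ⊔ V') m n := by
  have h1 (n : ℤ) : ∃ h ∈ H n, IsBounded θ G (h : A) ∧
      cyclesSubobject (U ⊔ V) n ≤ cyclesSubobject U n ⊔ h := by
    -- modulo `U`, the cycles of `U ⊔ V` are bounded, being contained in the image of `V`
    let π := cokernel.π (termSubobject U n).arrow
    have hπ : (termSubobject U n).arrow ≫ π = 0 := cokernel.condition _
    have hW : cyclesSubobject (U ⊔ V) n ≤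
        (Subobject.pullback (X.iCycles n ≫ π)).obj
          ((Subobject.exists π).obj (termSubobject V n)) := by
      have hle : termSubobject (U ⊔ V) n ≤
          (Subobject.pullback π).obj ((Subobject.exists π).obj (termSubobject V n)) := by
        rw [termSubobject_sup]
        refine sup_le (le_of_factors ?_) ((exists_le_iff _ _ _).1 le_rfl)
        rw [pullback_factors_iff, hπ]
        exact factors_zero
      rw [Subobject.pullback_comp]
      exact (Subobject.pullback (X.iCycles n)).monotone hle
    obtain ⟨s, hs, hle⟩ := hθ.exists_isBounded_le_sup (X.iCycles n ≫ π)
      (hθ.isBounded_exists π (hV.termSubobject n)) hW (k := cyclesSubobject U n) fun f hf => by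
        rw [cyclesSubobject_factors_iff, factors_iff_comp_cokernel, Category.assoc]
        exact hf
    obtain ⟨h, hh, hh', hsh⟩ := (hH n).exists_le hs
    exact ⟨h, hh, hh', hle.trans (sup_le_sup_left hsh _)⟩
  choose h hh hhb hhle using h1
  have h2 (m : ℤ) : ∃ t : Subobject (X.X m), IsBounded θ G (t : A) ∧
      h (m + 1) ≤ (Subobject.exists (X.toCycles m (m + 1))).obj t := by
    have : Epi (X.toCycles m (m + 1)) := (exactAt_iff_epi_toCycles X rfl).1 (hX _)
    exact hθ.exists_isBounded_le_exists _ (hhb (m + 1))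
  choose t ht hle using h2
  -- adding `t m` in degree `m` turns the cycles in `h (m + 1)` into boundaries
  refine ⟨V ⊔ ⨆ m, subcomplexSpan (t m), hθ₁.isBounded_sup hV
    (hθ₁.isBounded_iSup_countable _ fun m => hθ₁.isBounded_subcomplexSpan hθ₂ (ht m)),
    le_sup_left, fun n => ⟨cyclesSubobject U n ⊔ h n, (hH n).sup_mem (hU.1 n) (hh n), hhle n, ?_⟩⟩
  rintro m rfl
  refine sup_le ((hU.2 m _ rfl).trans (boundariesSubobject_mono _ _ le_sup_left)) ?_
  refine (hle m).trans ((Subobject.exists _).monotone ?_)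
  rw [← subcomplexSpan_le_iff]
  exact (le_iSup (fun m => subcomplexSpan (t m)) m).trans (le_sup_right.trans le_sup_right)

/-- Every good subcomplex can be enlarged to a good subcomplex which contains a given bounded
one, and which is generated over it by a bounded one. -/
lemma exists_goodSubcomplex (hθ : IsAdmissible θ G) (hθ₁ : IsAdmissible θ (diskSum G))
    (hθ₂ : θ ^ ℵ₀ ≤ θ) (hX : X.Acyclic) (hH : ∀ n, IsHillFamily C θ G (H n)) {U : Subobject X}
    (hU : U ∈ goodSubcomplexes H) {V : Subobject X} (hV : IsBounded θ (diskSum G) (V : Ch A)) :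
    ∃ V' : Subobject X, IsBounded θ (diskSum G) (V' : Ch A) ∧ V ≤ V' ∧
      U ⊔ V' ∈ goodSubcomplexes H := by
  let S := { V : Subobject X // IsBounded θ (diskSum G) (V : Ch A) }
  have step (V : S) := exists_isBounded_step hθ hθ₁ hθ₂ hX hH hU V.2
  choose Φ hΦ hΦle h hh hle hle' using step
  let W (k : ℕ) : S := (fun V : S => (⟨Φ V, hΦ V⟩ : S))^[k] ⟨V, hV⟩
  have hW (k : ℕ) : (W (k + 1)).1 = Φ (W k) := by
    simp only [W, Function.iterate_succ_apply']
  have hmono : Monotone fun k => (W k).1 := monotone_nat_of_le_succ fun k => by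
    rw [hW]
    exact hΦle _
  have hmono' : Monotone fun k => U ⊔ (W k).1 := fun i j hij => sup_le_sup_left (hmono hij) _
  -- the cycles of the union are interleaved with members of the Hill family
  have hc (n : ℤ) : cyclesSubobject (⨆ k, U ⊔ (W k).1) n = ⨆ k, h (W k) n := by
    refine le_antisymm ?_ (iSup_le fun k => ?_)
    · rw [cyclesSubobject_iSup_nat _ hmono']
      exact iSup_mono fun k => hle (W k) n
    · refine (hle' (W k) n (n - 1) (by simp)).trans ((boundariesSubobject_le _ _ _).trans ?_)
      refine cyclesSubobject_mono n ?_
      rw [← hW]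
      exact le_iSup (fun k => U ⊔ (W k).1) (k + 1)
  refine ⟨⨆ k, (W k).1, hθ₁.isBounded_iSup_countable _ fun k => (W k).2,
    le_iSup (fun k => (W k).1) 0, ?_⟩
  rw [sup_iSup]
  refine ⟨fun n => ?_, fun m n hmn => ?_⟩
  · rw [hc]
    exact (hH n).iSup_mem fun k => hh _ _
  · rw [hc, boundariesSubobject_iSup]
    refine iSup_le fun k => (hle' (W k) n m hmn).trans ?_
    rw [← hW]
    exact le_iSup (fun k => boundariesSubobject (U ⊔ (W k).1) m n) (k + 1)

/-- The quotient of two good subcomplexes is acyclic with cycles in the left class. -/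
lemma tilde_leftPerp_cokernel (hH : ∀ n, IsHillFamily C θ G (H n)) {U U' : Subobject X}
    (hU : U ∈ goodSubcomplexes H) (hU' : U' ∈ goodSubcomplexes H) (hle : U ≤ U') :
    tilde (leftPerp C) (cokernel (Subobject.ofLE U U' hle)) := by
  have hS := shortExact_cokernel (Subobject.ofLE U U' hle)
  have h1 := acyclic_of_cyclesSubobject_le hU.2
  refine ⟨acyclic_of_shortExact hS h1 (acyclic_of_cyclesSubobject_le hU'.2), fun n => ?_⟩
  have h2 := shortExact_map_cyclesFunctor hS h1 n
  refine (leftPerp_iff_llp h2).2 ?_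
  refine prop_of_prop_ofLE (cyclesSubobject_eq_mk U n) (cyclesSubobject_eq_mk U' n)
    (cyclesSubobject_mono n hle) ((hH n).llp (hU.1 n) (hU'.1 n) _) _ ?_
  have : cyclesMap (Subobject.ofLE U U' hle) n ≫ cyclesMap U'.arrow n = cyclesMap U.arrow n := by
    rw [← cyclesMap_comp, ofLE_arrow]
  exact this

/-- Every acyclic complex with cycles in the left class of a cotorsion pair which is cogenerated by
a set is filtered by such complexes of bounded size. -/
theorem isFilteredBy_tilde {T : ObjectProperty A} [ObjectProperty.Small.{v} T]
    (hθ : IsAdmissible θ G) (hθ₁ : IsAdmissible θ (diskSum G)) (hθ₂ : θ ^ ℵ₀ ≤ θ)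
    (hT : ∀ t, T t → #(G ⟶ t) ≤ θ) (hG : leftPerp (rightPerp T) G)
    (hX : tilde (leftPerp (rightPerp T)) X) :
    IsFilteredBy.{v} (fun Q : Ch A => tilde (leftPerp (rightPerp T)) Q ∧
      IsBounded θ (diskSum G) Q) X := by
  have hH (n : ℤ) := exists_isHillFamily T hθ hT hG (hX.2 n)
  choose H hH using hH
  refine isFilteredBy_of_subobjects (fun Z hZ => ?_) (goodSubcomplexes H)
    (goodSubcomplexes_bot hH) (fun s hs => goodSubcomplexes_iSup hH s hs) fun U hU hUtop => ?_
  · refine ObjectProperty.le_isoClosure _ _ ⟨?_, ?_⟩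
    · rw [← (isCotorsionPair_rightPerp T).leftPerp_spheres]
      exact fun Y _ => extOneVanishes_of_isZero_left hZ Y
    · have : Subsingleton (diskSum G ⟶ Z) := ⟨fun _ _ => hZ.eq_of_tgt _ _⟩
      exact (le_one_iff_subsingleton.2 this).trans (one_le_aleph0.trans hθ.aleph0_le)
  · obtain ⟨f, hf⟩ : ∃ f : diskSum G ⟶ X, ¬ U.Factors f := by
      by_contra! h
      exact hUtop (top_le_iff.1 (le_of_forall_factors hθ₁.isSeparator fun f _ => h f))
    obtain ⟨V₀, hV₀, hf'⟩ := hθ₁.exists_isBounded_factors f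
    obtain ⟨V, hV, hle, hgood⟩ := exists_goodSubcomplex hθ hθ₁ hθ₂ hX.1 hH hU hV₀
    refine ⟨U ⊔ V, hgood, fun h => hf ?_, le_sup_left, ObjectProperty.le_isoClosure _ _
      ⟨tilde_leftPerp_cokernel hH hU hgood _, ?_⟩⟩
    · rw [h]
      exact factors_of_le f (hle.trans le_sup_right) hf'
    · let p : (V : Ch A) ⟶ cokernel (Subobject.ofLE U (U ⊔ V) le_sup_left) :=
        Subobject.ofLE V (U ⊔ V) le_sup_right ≫ cokernel.π _
      have : Epi p := Preadditive.epi_of_cancel_zero _ fun g hg => by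
        rw [← cancel_epi (cokernel.π _), comp_zero]
        refine eq_zero_of_ofLE_comp_eq_zero le_sup_left le_sup_right le_rfl _ ?_ ?_
        · rw [cokernel.condition_assoc, zero_comp]
        · rw [← Category.assoc]
          exact hg
      exact hθ₁.isBounded_of_epi hV p

end CotorsionPair

/-! ### Complexes with respect to a cotorsion pair in a Grothendieck category -/

namespace CotorsionPair

open Cardinal MorphismProperty

variable {A : Type u} [Category.{v} A]

lemma exists_forall_card_hom_le (T : ObjectProperty A) [ObjectProperty.Small.{v} T] (G : A) :
    ∃ μ : Cardinal.{v}, ∀ t, T t → #(G ⟶ t) ≤ μ := by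
  let f (t : Shrink.{v} (Subtype T)) : Cardinal.{v} := #(G ⟶ ((equivShrink _).symm t).1)
  refine ⟨⨆ t, f t, fun t ht => ?_⟩
  have h := le_ciSup (f := f) bddAbove_of_small (equivShrink (Subtype T) ⟨t, ht⟩)
  simpa [f] using h

variable [Abelian A]

lemma IsFilteredBy.mono {L L' : ObjectProperty A} (hL : L ≤ L') {X : A}
    (h : IsFilteredBy.{w} L X) : IsFilteredBy.{w} L' X := by
  obtain ⟨J, _, _, _, _, s, hs⟩ := h
  have hle : monoWithCokernelIn L ≤ monoWithCokernelIn L' := fun _ _ _ hf =>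
    ⟨hf.1, ObjectProperty.monotone_isoClosure hL _ hf.2⟩
  exact ⟨J, _, _, _, inferInstance, s.ofLE hle, hs⟩

variable [IsGrothendieckAbelian.{v} A]

/-- Eklof's lemma. -/
lemma leftPerp_of_isFilteredBy {L C : ObjectProperty A} (hL : L ≤ leftPerp C) {X : A}
    (h : IsFilteredBy.{w} L X) : leftPerp C X := by
  obtain ⟨J, _, _, _, _, s, -⟩ := h
  have hle : monoWithCokernelIn L ≤ (injQuots C).llp := by
    rintro Y Z f ⟨_, Q, hQ, ⟨e⟩⟩
    exact (leftPerp_cokernel_iff f).1 ((hL _ hQ).of_iso e.symm)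
  exact leftPerp_iff_llp_zero.2 (transfiniteCompositionsOfShape_le _ J _ (s.ofLE hle).mem)

lemma IsBounded.exists_epi_sigma {θ : Cardinal.{v}} {G : A} (hG : IsSeparator G) {X : A}
    (hX : IsBounded θ G X) : ∃ p : (∐ fun _ : θ.out => G) ⟶ X, Epi p := by
  have hX' : #(G ⟶ X) ≤ #θ.out := by rwa [mk_out]
  obtain ⟨e⟩ := hX'
  let r : θ.out → (G ⟶ X) := Function.invFun e
  have hr : Function.Surjective r := Function.invFun_surjective e.injective
  refine ⟨Sigma.desc r, Preadditive.epi_of_cancel_zero _ fun g hg => hG.def _ _ fun f => ?_⟩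
  obtain ⟨k, rfl⟩ := hr f
  have := Sigma.ι (fun _ : θ.out => G) k ≫= hg
  rwa [Sigma.ι_desc_assoc, comp_zero, ← comp_zero (f := r k)] at this

/-- The objects of `F` of size at most `θ` are represented by quotients of a single object. -/
lemma exists_small_of_isBounded (F : ObjectProperty A) [F.IsClosedUnderIsomorphisms]
    (θ : Cardinal.{v}) {G : A} (hG : IsSeparator G) :
    ∃ T : ObjectProperty A, ObjectProperty.Small.{v} T ∧ T ≤ F ∧
      ∀ X, F X → IsBounded θ G X → ∃ Y, T Y ∧ Nonempty (X ≅ Y) := by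
  let T : ObjectProperty A := ObjectProperty.ofObj
    fun s : { s : Subobject (∐ fun _ : θ.out => G) // F (cokernel s.arrow) } => cokernel s.1.arrow
  refine ⟨T, inferInstanceAs (ObjectProperty.Small.{v} (ObjectProperty.ofObj _)), ?_, ?_⟩
  · rintro _ ⟨s⟩
    exact s.2
  · intro X hX hX'
    obtain ⟨p, hp⟩ := hX'.exists_epi_sigma hG
    let e : X ≅ cokernel (kernelSubobject p).arrow :=
      IsColimit.coconePointUniqueUpToIso
        (Abelian.epiIsCokernelOfKernel (KernelFork.ofι (kernelSubobject p).arrow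
          (kernelSubobject_arrow_comp p)) (KernelFork.IsLimit.ofι' _ _ fun k hk =>
            ⟨factorThruKernelSubobject p k hk, factorThruKernelSubobject_comp_arrow p k hk⟩))
        (colimit.isColimit _)
    exact ⟨_, ObjectProperty.ofObj_apply _ (⟨kernelSubobject p, F.prop_of_iso e hX⟩ :
      { s : Subobject (∐ fun _ : θ.out => G) // F (cokernel s.arrow) }), ⟨e⟩⟩

variable {F C : ObjectProperty A}

/-- The complexes in `tilde F` are filtered by those of size at most `θ`, for arbitrarily large
cardinals `θ`. -/
lemma IsCotorsionPair.exists_isFilteredBy (h : IsCotorsionPair F C) {T : ObjectProperty A}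
    [ObjectProperty.Small.{v} T] (hT : rightPerp T = C) {G : A} (hG : IsSeparator G) (hFG : F G)
    (μ : Cardinal.{v}) : ∃ θ : Cardinal.{v}, μ ≤ θ ∧ IsAdmissible θ (diskSum G) ∧
      ∀ X : Ch A, tilde F X →
        IsFilteredBy.{v} (fun Q : Ch A => tilde F Q ∧ IsBounded θ (diskSum G) Q) X := by
  obtain ⟨μ', hμ'⟩ := exists_forall_card_hom_le T G
  obtain ⟨θ, hθ, hθ₂, hθG, hθ₁⟩ := exists_isAdmissible_diskSum hG (max μ μ')
  obtain rfl : F = leftPerp (rightPerp T) := by rw [hT, h.left_eq]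
  exact ⟨θ, (le_max_left _ _).trans hθ, hθ₁, fun X hX => isFilteredBy_tilde hθG hθ₁ hθ₂
    (fun t ht => (hμ' t ht).trans ((le_max_right _ _).trans hθ)) hFG hX⟩

theorem IsCotorsionPair.isComplete_tilde_dgRight (h : IsCotorsionPair F C)
    {T : ObjectProperty A} [ObjectProperty.Small.{v} T] (hT : rightPerp T = C) {G : A}
    (hG : IsSeparator G) (hFG : F G) : IsCompleteCotorsionPair (tilde F) (dgRight F C) := by
  obtain ⟨θ, -, -, hθ⟩ := h.exists_isFilteredBy hT hG hFG 0
  have hF := h.tilde_dgRight.left_eq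
  have : (tilde F).IsClosedUnderIsomorphisms := ⟨fun e hX => by
    rw [hF] at hX ⊢
    exact hX.of_iso e⟩
  obtain ⟨T', _, hT'F, hT'⟩ := exists_small_of_isBounded (tilde F) θ (isSeparator_diskSum hG)
  refine h.tilde_dgRight.isCompleteCotorsionPair (T := T') ?_ (h.tilde_diskSum hFG)
    (isSeparator_diskSum hG)
  rw [h.dgRight_eq]
  refine le_antisymm (fun Y hY X hX => ?_) fun Y hY X hX => hY X (hT'F X hX)
  refine leftPerp_of_isFilteredBy (C := rightPerp T') ?_ (hθ X hX) Y hY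
  rintro Q ⟨hQ, hQ'⟩ Z hZ
  obtain ⟨Q', hQT, ⟨e⟩⟩ := hT' Q hQ hQ'
  exact (hZ Q' hQT).of_iso_left e.symm

lemma IsCotorsionPair.exists_isRegular_isFilteredBy (h : IsCotorsionPair F C)
    {T : ObjectProperty A} [ObjectProperty.Small.{v} T] (hT : rightPerp T = C) {G : A}
    (hG : IsSeparator G) (hFG : F G) (μ : Cardinal.{v}) :
    ∃ (κ : Cardinal.{v}) (_ : Fact κ.IsRegular), μ ≤ κ ∧
      ∀ X : Ch A, tilde F X → IsFilteredBy.{v} (presentableIn (tilde F) κ) X := by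
  obtain ⟨θ, hμ, hθ₁, hθ⟩ := h.exists_isFilteredBy hT hG hFG μ
  have : Fact (Order.succ θ).IsRegular := ⟨isRegular_succ hθ₁.aleph0_le⟩
  exact ⟨Order.succ θ, this, hμ.trans (Order.le_succ θ), fun X hX => (hθ X hX).mono
    fun Q hQ => ⟨hQ.1, hQ.2.isCardinalPresentable hθ₁ (Order.lt_succ θ)⟩⟩

end CotorsionPair

open CartMod CotorsionPair in
theorem mainTheorem4 {𝒮 : Type u} [SmallCategory 𝒮] (R : 𝒮ᵒᵖ ⥤ CommRingCat.{u})
    [IsFlatPresheaf R] (F C : ObjectProperty (ModCart R)) (hFC : IsCotorsionPair F C)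
    (hset : IsCogeneratedBySet.{u} C) (hgen : ∃ G : ModCart R, F G ∧ IsSeparator G) :
    IsCompleteCotorsionPair (tilde F) (dgRight F C) ∧
      IsCompleteCotorsionPair (dgLeft F C) (tilde C) ∧
      ∀ μ : Cardinal.{u}, ∃ (κ : Cardinal.{u}) (_ : Fact κ.IsRegular), μ ≤ κ ∧
        ∀ X : Ch (ModCart R), tilde F X →
          IsFilteredBy.{u} (presentableIn (tilde F) κ) X := by
  obtain ⟨G, hFG, hG⟩ := hgen
  obtain ⟨T, _, hT⟩ := hset
  have := CartMod.isGrothendieckAbelian (R := R) ⟨G, hG⟩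
  exact ⟨hFC.isComplete_tilde_dgRight hT hG hFG, hFC.isComplete_dgLeft_tilde hT hG hFG,
    hFC.exists_isRegular_isFilteredBy hT hG hFG⟩
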